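/- **The problem.** An instance of MSPEC is a finite simple undirected graph $G=(V\cup\{s,t\},E)$ with $n=|V\cup\{s,t\}|$ vertices, $m=|E|$ edges and a weight $w_{u,v}\ge 0$ on each edge. A power assignment $p:V\to\mathbb R_{\ge 0}$, extended by $p_s=p_t=0$, is *feasible* if removing all edges $(u,v)\in E$ with $p_u+p_v\ge w_{u,v}$ disconnects $s$ from $t$. Let $\mathrm{OPT}$ be the minimum of $\sum_{v\in V}p_v$ over feasible power assignments, and let $p^*$ be the minimum value $x\ge 0$ such that assigning power $x$ to every vertex of $V$ is feasible. Only instances that have a feasible power assignment are considered (equivalently, $(s,t)$ is not an edge of positive weight); for these both minima exist. **The algorithm.** Given $0<\varepsilon\le 1$, let $c=\lceil n^2/\varepsilon\rceil$ and $\alpha=\varepsilon p^*/n$. Let $G'$ be the graph with vertices $s$, $t$ and $v(0),\dots,v(c-1)$ for each $v\in V$, in which $u(i),v(j)$ are adjacent if $(u,v)\in E$ and $i\alpha+j\alpha<w_{u,v}$, and $u(i),x$ with $x\in\{s,t\}$ are adjacent if $(u,x)\in E$ and $i\alpha<w_{u,x}$ (and there are no other edges). Take a minimum-cardinality $s$–$t$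 vertex cut $K^*$ of $G'$ (a set of copies $v(i)$ meeting every $s$–$t$ path), and return $p_v=\alpha\cdot|\{j: v(j)\in K^*\}|$ for $v\in V$. **Theorem.** For every such instance, every $0<\varepsilon\le 1$ and every choice of the minimum $s$–$t$ vertex cut $K^*$ of $G'$, the power assignment $p$ is feasible and $\sum_{v\in V}p_v\le(1+\varepsilon)\,\mathrm{OPT}$. Moreover, there is a single program for the real RAM (unit-cost comparisons and arithmetic $+,-,\times,/$ on real numbers without rounding; unit-cost addition, subtraction, comparison and indirect addressing for natural numbers) that, given $n$, the list of edges with their weights, and $\varepsilon$, returns the powers $p$ obtained from some minimum $s$–$t$ vertex cut $K^*$ of $G'$ within $O\big(n^{5.5}\max\{m,1\}\,\varepsilon^{-2.5}\big)$ steps, with an absolute constant. In particular this program is a fully polynomial time approximation scheme for MSPEC: it returns a feasible power assignment of cost at most $(1+\varepsilon)\,\mathrm{OPT}$ in a number of steps polynomial in $n+m$ and $1/\varepsilon$. -/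

import Mathlib

universe u

noncomputable section

namespace MSPEC

/-! ### The Minimum Shared-Power Edge Cut problem -/

/-- The vertex set `V ∪ {s, t}`, for a set `V` of non-terminal vertices. -/
inductive Vert (V : Type u) : Type u
  | s : Vert V
  | t : Vert V
  | inner (v : V) : Vert V

/-- An undirected graph on `V ∪ {s, t}` with non-negative edge weights (the values of `weight`
off the edge set are never used). -/
structure Instance (V : Type u) where
  graph : SimpleGraph (Vert V)
  weight : Sym2 (Vert V) → ℝ
  weight_nonneg : ∀ e ∈ graph.edgeSet, 0 ≤ weight e

/-- Powers on `V`, extended by `p_s = p_t = 0`. -/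
def extend {V : Type u} (p : V → ℝ) : Vert V → ℝ
  | Vert.s => 0
  | Vert.t => 0
  | Vert.inner v => p v

/-- The graph left after removing every edge `(x, y)` with `p_x + p_y ≥ w_{x,y}`. -/
def remaining {V : Type u} (I : Instance V) (p : V → ℝ) : SimpleGraph (Vert V) where
  Adj x y := I.graph.Adj x y ∧ ¬ (extend p x + extend p y ≥ I.weight s(x, y))
  symm := ⟨fun x y h => ⟨h.1.symm, by rw [Sym2.eq_swap, add_comm]; exact h.2⟩⟩
  loopless := ⟨fun x h => I.graph.loopless.irrefl x h.1⟩

/-- A feasible power assignment: non-negative, and it disconnects `s` from `t`. -/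
def Feasible {V : Type u} (I : Instance V) (p : V → ℝ) : Prop :=
  (∀ v, 0 ≤ p v) ∧ ¬ (remaining I p).Reachable Vert.s Vert.t

/-- The power sums of the feasible power assignments. -/
def feasibleCosts {V : Type u} [Fintype V] (I : Instance V) : Set ℝ :=
  {x | ∃ p : V → ℝ, Feasible I p ∧ x = ∑ v, p v}

/-- The optimum `OPT`. -/
def opt {V : Type u} [Fintype V] (I : Instance V) : ℝ := sInf (feasibleCosts I)

/-- The values `x ≥ 0` such that giving power `x` to every vertex of `V` is feasible. -/
def bottleneckPowers {V : Type u} (I : Instance V) : Set ℝ :=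
  {x | 0 ≤ x ∧ Feasible I (fun _ : V => x)}

/-- The bottleneck optimum `p*`. -/
def bottleneck {V : Type u} (I : Instance V) : ℝ := sInf (bottleneckPowers I)

/-! ### The discretized graph and the approximate solution -/

/-- The number `n` of vertices of a graph on `V ∪ {s, t}`. -/
def order (V : Type u) : ℕ := Nat.card (Vert V)

/-- The number of copies `c = ⌈n² / ε⌉`. -/
def copies (V : Type u) (ε : ℝ) : ℕ := ⌈(order V : ℝ) ^ 2 / ε⌉₊

/-- The power `α = ε p* / n` represented by one copy. -/
def unit {V : Type u} (I : Instance V) (ε : ℝ) : ℝ := ε * bottleneck I / order V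

/-- Adjacency in the discretized graph with `c` copies `v(0), …, v(c-1)` of each `v ∈ V`, each
worth `α`. -/
def discreteAdj {V : Type u} (I : Instance V) (α : ℝ) (c : ℕ) :
    Vert (V × Fin c) → Vert (V × Fin c) → Prop
  | Vert.inner (a, i), Vert.inner (b, j) =>
      I.graph.Adj (Vert.inner a) (Vert.inner b) ∧
        (i : ℝ) * α + (j : ℝ) * α < I.weight s(Vert.inner a, Vert.inner b)
  | Vert.inner (a, i), Vert.s =>
      I.graph.Adj (Vert.inner a) Vert.s ∧ (i : ℝ) * α < I.weight s(Vert.inner a, Vert.s)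
  | Vert.inner (a, i), Vert.t =>
      I.graph.Adj (Vert.inner a) Vert.t ∧ (i : ℝ) * α < I.weight s(Vert.inner a, Vert.t)
  | Vert.s, Vert.inner (a, i) =>
      I.graph.Adj (Vert.inner a) Vert.s ∧ (i : ℝ) * α < I.weight s(Vert.inner a, Vert.s)
  | Vert.t, Vert.inner (a, i) =>
      I.graph.Adj (Vert.inner a) Vert.t ∧ (i : ℝ) * α < I.weight s(Vert.inner a, Vert.t)
  | _, _ => False

/-- The discretized graph `G'`. -/
def discreteGraph {V : Type u} (I : Instance V) (ε : ℝ) :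
    SimpleGraph (Vert (V × Fin (copies V ε))) where
  Adj := discreteAdj I (unit I ε) (copies V ε)
  symm := ⟨by
    rintro (_ | _ | ⟨a, i⟩) (_ | _ | ⟨b, j⟩) h <;> simp only [discreteAdj] at h ⊢ <;>
      first
        | exact h
        | exact ⟨h.1.symm, by rw [Sym2.eq_swap, add_comm]; exact h.2⟩⟩
  loopless := ⟨by
    rintro (_ | _ | ⟨a, i⟩) h
    · exact h
    · exact h
    · exact I.graph.loopless.irrefl _ h.1⟩

/-- `K` (which contains neither `s` nor `t`) is an `s`-`t` vertex cut of `H`: every walk from `s`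
to `t` in `H` passes through `K`. -/
def IsVertexCut {U : Type u} (H : SimpleGraph (Vert U)) (K : Finset U) : Prop :=
  ∀ W : H.Walk Vert.s Vert.t, ∃ x ∈ K, Vert.inner x ∈ W.support

/-- `K` is an `s`-`t` vertex cut of `H` of minimum cardinality. -/
def IsMinVertexCut {U : Type u} (H : SimpleGraph (Vert U)) (K : Finset U) : Prop :=
  IsVertexCut H K ∧ ∀ K' : Finset U, IsVertexCut H K' → K.card ≤ K'.card

/-- The powers `p_v = k_v α`, where `k_v` is the number of copies of `v` in `K`. -/
def cutPowers {V : Type u} (I : Instance V) (ε : ℝ) (K : Finset (V × Fin (copies V ε))) :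
    V → ℝ :=
  fun v => (Set.ncard {j : Fin (copies V ε) | (v, j) ∈ K} : ℝ) * unit I ε

/-! ### The real RAM

A program is a finite list of instructions. A machine has registers and arrays of natural numbers
and registers and arrays of real numbers. Register and array names are constants of the program,
so that a program uses finitely many of them; array cells are addressed by the content of a natural
number register. Every instruction takes one step. Natural numbers can only be added, subtracted
and compared; there is no rounding of real numbers. -/

inductive Instr : Type
  /-- `N[d] := z` -/
  | natConst (d z : ℕ)
  /-- `N[d] := N[a] + N[b]` -/
  | natAdd (d a b : ℕ)
  /-- `N[d] := max (N[a] - N[b]) 0` -/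
  | natSub (d a b : ℕ)
  /-- `N[d] := A_x[N[i]]`, for the array `A_x` of natural numbers -/
  | natLoad (d x i : ℕ)
  /-- `A_x[N[i]] := N[a]` -/
  | natStore (x i a : ℕ)
  /-- `R[d] := z` -/
  | realConst (d z : ℕ)
  /-- `R[d] := R[a] + R[b]` -/
  | realAdd (d a b : ℕ)
  /-- `R[d] := R[a] - R[b]` -/
  | realSub (d a b : ℕ)
  /-- `R[d] := R[a] * R[b]` -/
  | realMul (d a b : ℕ)
  /-- `R[d] := R[a] / R[b]` -/
  | realDiv (d a b : ℕ)
  /-- `R[d] := B_x[N[i]]`, for the array `B_x` of real numbers -/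
  | realLoad (d x i : ℕ)
  /-- `B_x[N[i]] := R[a]` -/
  | realStore (x i a : ℕ)
  /-- go to instruction `l` -/
  | jump (l : ℕ)
  /-- if `N[a] < N[b]` go to instruction `l` -/
  | natJump (a b l : ℕ)
  /-- if `R[a] < R[b]` go to instruction `l` -/
  | realJump (a b l : ℕ)

structure State where
  pc : ℕ
  nreg : ℕ → ℕ
  rreg : ℕ → ℝ
  narr : ℕ → ℕ → ℕ
  rarr : ℕ → ℕ → ℝ

/-- The effect of one instruction. -/
def exec (σ : State) : Instr → State
  | .natConst d z => { σ with pc := σ.pc + 1, nreg := Function.update σ.nreg d z }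
  | .natAdd d a b =>
      { σ with pc := σ.pc + 1, nreg := Function.update σ.nreg d (σ.nreg a + σ.nreg b) }
  | .natSub d a b =>
      { σ with pc := σ.pc + 1, nreg := Function.update σ.nreg d (σ.nreg a - σ.nreg b) }
  | .natLoad d x i =>
      { σ with pc := σ.pc + 1, nreg := Function.update σ.nreg d (σ.narr x (σ.nreg i)) }
  | .natStore x i a =>
      { σ with
        pc := σ.pc + 1
        narr := Function.update σ.narr x (Function.update (σ.narr x) (σ.nreg i) (σ.nreg a)) }
  | .realConst d z => { σ with pc := σ.pc + 1, rreg := Function.update σ.rreg d (z : ℝ) }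
  | .realAdd d a b =>
      { σ with pc := σ.pc + 1, rreg := Function.update σ.rreg d (σ.rreg a + σ.rreg b) }
  | .realSub d a b =>
      { σ with pc := σ.pc + 1, rreg := Function.update σ.rreg d (σ.rreg a - σ.rreg b) }
  | .realMul d a b =>
      { σ with pc := σ.pc + 1, rreg := Function.update σ.rreg d (σ.rreg a * σ.rreg b) }
  | .realDiv d a b =>
      { σ with pc := σ.pc + 1, rreg := Function.update σ.rreg d (σ.rreg a / σ.rreg b) }
  | .realLoad d x i =>
      { σ with pc := σ.pc + 1, rreg := Function.update σ.rreg d (σ.rarr x (σ.nreg i)) }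
  | .realStore x i a =>
      { σ with
        pc := σ.pc + 1
        rarr := Function.update σ.rarr x (Function.update (σ.rarr x) (σ.nreg i) (σ.rreg a)) }
  | .jump l => { σ with pc := l }
  | .natJump a b l => { σ with pc := if σ.nreg a < σ.nreg b then l else σ.pc + 1 }
  | .realJump a b l => { σ with pc := if σ.rreg a < σ.rreg b then l else σ.pc + 1 }

/-- The machine has halted when the program counter points outside the program. -/
def Halted (P : List Instr) (σ : State) : Prop := P.length ≤ σ.pc

/-- One step; a halted machine does not move. -/
def step (P : List Instr) (σ : State) : State :=
  match P[σ.pc]? with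
  | none => σ
  | some ins => exec σ ins

/-- Started in `σ`, the program `P` halts after at most `T` steps, in the state `σ'`. -/
def HaltsWithin (P : List Instr) (σ : State) (T : ℝ) (σ' : State) : Prop :=
  ∃ τ : ℕ, (τ : ℝ) ≤ T ∧ (step P)^[τ] σ = σ' ∧ Halted P σ'

/-! ### Input and output -/

/-- The name of a vertex of a graph on `{0, …, k-1} ∪ {s, t}`. -/
def code {k : ℕ} : Vert (Fin k) → ℕ
  | Vert.s => 0
  | Vert.t => 1
  | Vert.inner v => (v : ℕ) + 2

/-- `L` lists every edge of the graph exactly once, in any order and any orientation. -/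
def IsEdgeList {k : ℕ} (I : Instance (Fin k)) (L : List (Vert (Fin k) × Vert (Fin k))) : Prop :=
  (L.map fun e => s(e.1, e.2)).Nodup ∧
    ∀ e, e ∈ (L.map fun e => s(e.1, e.2)) ↔ e ∈ I.graph.edgeSet

/-- The initial state: `N[0] = n`, `N[1] = m`, `R[0] = ε`, the `i`-th edge of the list has its
endpoints in `A_0[i]` and `A_1[i]` and its weight in `B_0[i]`; everything else is zero. -/
def initial {k : ℕ} (I : Instance (Fin k)) (L : List (Vert (Fin k) × Vert (Fin k))) (ε : ℝ) :
    State where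
  pc := 0
  nreg r := if r = 0 then k + 2 else if r = 1 then L.length else 0
  rreg r := if r = 0 then ε else 0
  narr x i :=
    if x = 0 then (L[i]?.map fun e => code e.1).getD 0
    else if x = 1 then (L[i]?.map fun e => code e.2).getD 0
    else 0
  rarr x i := if x = 0 then (L[i]?.map fun e => I.weight s(e.1, e.2)).getD 0 else 0

/-- The output: the power of the vertex `v` is read from `B_1[v]`. -/
def output (k : ℕ) (σ : State) : Fin k → ℝ := fun v => σ.rarr 1 v

/-- The number of edges. -/
def size {V : Type u} (I : Instance V) : ℕ := I.graph.edgeSet.ncard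

/-- `P` carries out the discretization algorithm on every feasible instance and every
`0 < ε ≤ 1`: within `T n m ε` steps it outputs the powers given by a minimum `s`-`t` vertex cut of
the discretized graph. -/
def RunsAlgorithm (P : List Instr) (T : ℕ → ℕ → ℝ → ℝ) : Prop :=
  ∀ (k : ℕ) (I : Instance (Fin k)) (L : List (Vert (Fin k) × Vert (Fin k))) (ε : ℝ),
    (∃ p, Feasible I p) → IsEdgeList I L → 0 < ε → ε ≤ 1 →
      ∃ σ, HaltsWithin P (initial I L ε) (T (order (Fin k)) (size I) ε) σ ∧
        ∃ K, IsMinVertexCut (discreteGraph I ε) K ∧ output k σ = cutPowers I ε K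

/-- `P` is a fully polynomial time approximation scheme: on every feasible instance and every
`0 < ε ≤ 1` it outputs a feasible power assignment of cost at most `(1 + ε) OPT`, in time
polynomial in `n + m` and `1 / ε`. -/
def IsFPTAS (P : List Instr) : Prop :=
  ∃ d : ℕ, ∃ C : ℝ,
    ∀ (k : ℕ) (I : Instance (Fin k)) (L : List (Vert (Fin k) × Vert (Fin k))) (ε : ℝ),
      (∃ p, Feasible I p) → IsEdgeList I L → 0 < ε → ε ≤ 1 →
        ∃ σ, HaltsWithin P (initial I L ε)
            (C * ((order (Fin k) : ℝ) + size I) ^ d * (1 / ε) ^ d) σ ∧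
          Feasible I (output k σ) ∧ ∑ v, output k σ v ≤ (1 + ε) * opt I

end MSPEC

end

/-!
The approximation guarantee rests on two translations. A feasible assignment `p` yields the vertex
cut of the discretized graph that consists of the copies `v(i)` with `i α < p_v`
(`Feasible.isVertexCut_lowCopies`). Applied to an optimal assignment, it bounds the cost of a minimum
cut by `OPT + n α ≤ (1 + ε) OPT`, since `n α = ε p*` and `p* ≤ OPT` (`IsMinVertexCut.sum_le`). Applied
to the uniform assignment `p*`, it shows that a minimum cut has fewer than `c` elements
(`exists_small_cut`), so that every vertex keeps a copy `v(i)` with `i ≤ k_v`, where `k_v` copies are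
cut; hence a path that survives the powers `k_v α` would lift to a path avoiding the cut
(`IsMinVertexCut.feasible`). The minima exist because the feasible assignments form a closed set.

The program computes `p*` as the width of a widest path (`widest_spec`) and then a maximum system of
vertex-disjoint paths in the discretized graph by augmenting paths. The system is stored as a
predecessor function `pred`, where a vertex on no path is its own predecessor; in this form paths
are matchings, and weak and strong duality are short counting arguments (`Flow.value_le`,
`Flow.card_le_value`). The search uses that the copies of `v` adjacent to a given copy `u(i)` form an
initial segment: one pointer per vertex `v` suffices to remember the copies already entered, so that
a search takes `O(m)` steps for each of the at most `n c` visited vertices and one for each copy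
entered, although the discretized graph may have `m c²` edges. There are at most `c` augmentations,
by the bound on minimum cuts. This gives `O(n c² max(m, 1)) = O(n⁵ max(m, 1) / ε²)` steps
(`scheme_halts`), which implies both time bounds since `n ≥ 1` and `ε ≤ 1`.

The machine program is the compilation of a structured program, whose behaviour and running time are
derived with a Hoare-style calculus (`Cmd.Ex`). A loop rule with a decreasing bound on the number of
iterations accounts for the time, and a frame rule for the memory that is not written to.
-/

namespace MSPEC

/-! ### Closed sets, walks and cuts -/

section

variable {V : Type u} {U : Type u}

theorem not_reachable_of_closed {W : Type*} {G : SimpleGraph W} {a b : W} (R : Set W)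
    (ha : a ∈ R) (hb : b ∉ R) (hR : ∀ x ∈ R, ∀ y, G.Adj x y → y ∈ R) : ¬ G.Reachable a b := by
  rintro ⟨w⟩
  induction w with
  | nil => exact hb ha
  | cons h _ ih => exact ih (hR _ ha _ h) hb

theorem isVertexCut_of_closed {H : SimpleGraph (Vert U)} {K : Finset U} (R : Set (Vert U))
    (hs : Vert.s ∈ R) (ht : Vert.t ∉ R)
    (hR : ∀ x ∈ R, ∀ y, H.Adj x y → y ∈ R ∨ ∃ z ∈ K, y = Vert.inner z) : IsVertexCut H K := by
  intro W
  suffices h : ∀ (a b : Vert U) (W : H.Walk a b), a ∈ R → b ∉ R →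
      ∃ x ∈ K, Vert.inner x ∈ W.support from h _ _ W hs ht
  clear W hs ht
  intro a b W
  induction W with
  | nil => exact fun h h' => absurd h h'
  | cons hadj p ih =>
    intro ha hb
    rcases hR _ ha _ hadj with h | ⟨z, hz, rfl⟩
    · obtain ⟨x, hx, hx'⟩ := ih h hb
      exact ⟨x, hx, by simp [hx']⟩
    · exact ⟨z, hz, by simp⟩

/-- The set of vertices that a vertex cut leaves reachable from `s`. -/
theorem IsVertexCut.exists_closed {H : SimpleGraph (Vert U)} {K : Finset U}
    (hK : IsVertexCut H K) : ∃ R : Set (Vert U), Vert.s ∈ R ∧ Vert.t ∉ R ∧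
      (∀ z ∈ K, Vert.inner z ∉ R) ∧
      ∀ x ∈ R, ∀ y, H.Adj x y → y ∈ R ∨ ∃ z ∈ K, y = Vert.inner z := by
  refine ⟨{x | ∃ W : H.Walk Vert.s x, ∀ z ∈ K, Vert.inner z ∉ W.support}, ⟨.nil, by simp⟩, ?_,
    ?_, ?_⟩
  · rintro ⟨W, hW⟩
    obtain ⟨x, hx, hx'⟩ := hK W
    exact hW x hx hx'
  · rintro z hz ⟨W, hW⟩
    exact hW z hz W.end_mem_support
  · rintro x ⟨W, hW⟩ y hxy
    by_cases hy : ∃ z ∈ K, y = Vert.inner z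
    · exact Or.inr hy
    · refine Or.inl ⟨W.concat hxy, fun z hz hmem => ?_⟩
      rw [SimpleGraph.Walk.support_concat, List.mem_append] at hmem
      rcases hmem with h | h
      · exact hW z hz h
      · exact hy ⟨z, hz, (List.mem_singleton.1 h).symm⟩

/-! ### Attainment of the minima -/

theorem extend_mono {p q : V → ℝ} (h : ∀ v, p v ≤ q v) (x : Vert V) : extend p x ≤ extend q x := by
  cases x <;> simp [extend, h]

theorem Feasible.mono {I : Instance V} {p q : V → ℝ} (hp : Feasible I p) (h : ∀ v, p v ≤ q v) :
    Feasible I q := by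
  refine ⟨fun v => (hp.1 v).trans (h v), fun hr => hp.2 (hr.mono ?_)⟩
  intro x y hxy
  refine ⟨hxy.1, fun hle => hxy.2 (le_trans hle ?_)⟩
  exact add_le_add (extend_mono h x) (extend_mono h y)

theorem continuous_extend (x : Vert V) : Continuous fun p : V → ℝ => extend p x := by
  cases x <;> simp only [extend] <;> fun_prop

theorem isClosed_feasible (I : Instance V) : IsClosed {p : V → ℝ | Feasible I p} := by
  have h1 : IsClosed {p : V → ℝ | ∀ v, 0 ≤ p v} := by
    simp only [Set.ofPred_forall]
    exact isClosed_iInter fun v => isClosed_le continuous_const (continuous_apply v)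
  have h2 : IsOpen {p : V → ℝ | (remaining I p).Reachable Vert.s Vert.t} := by
    rw [isOpen_iff_mem_nhds]
    rintro p ⟨W⟩
    change ∀ᶠ q in nhds p, (remaining I q).Reachable Vert.s Vert.t
    generalize Vert.s = a at W
    generalize Vert.t = b at W
    induction W with
    | nil => exact Filter.Eventually.of_forall fun _ => SimpleGraph.Reachable.refl _
    | @cons x y z hadj _ ih =>
      have h3 : ∀ᶠ q in nhds p, extend q x + extend q y < I.weight s(x, y) :=
        ((continuous_extend x).add (continuous_extend y)).continuousAt.eventually_lt
          continuousAt_const (not_le.1 hadj.2)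
      filter_upwards [ih, h3] with q hq hq'
      have : (remaining I q).Adj x y := ⟨hadj.1, not_le.2 hq'⟩
      exact this.reachable.trans hq
  exact h1.inter h2.isClosed_compl

theorem Feasible.le_sum [Fintype V] {I : Instance V} {p : V → ℝ} (hp : Feasible I p) (v : V) :
    p v ≤ ∑ v, p v :=
  Finset.single_le_sum (fun v _ => hp.1 v) (Finset.mem_univ v)

/-- The power sum of a feasible assignment is feasible as a uniform power, so `p* ≤ OPT`. -/
theorem Feasible.sum_mem_bottleneckPowers [Fintype V] {I : Instance V} {p : V → ℝ}
    (hp : Feasible I p) : ∑ v, p v ∈ bottleneckPowers I :=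
  ⟨Finset.sum_nonneg fun v _ => hp.1 v, hp.mono hp.le_sum⟩

theorem isLeast_bottleneck [Fintype V] {I : Instance V} (h : ∃ p, Feasible I p) :
    IsLeast (bottleneckPowers I) (bottleneck I) := by
  obtain ⟨p, hp⟩ := h
  have hb : BddBelow (bottleneckPowers I) := ⟨0, fun x hx => hx.1⟩
  have hc : IsClosed (bottleneckPowers I) := by
    have : Continuous fun (x : ℝ) (_ : V) => x := by fun_prop
    exact isClosed_Ici.inter ((isClosed_feasible I).preimage this)
  exact ⟨hc.csInf_mem ⟨_, hp.sum_mem_bottleneckPowers⟩ hb, fun x hx => csInf_le hb hx⟩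

theorem isLeast_opt [Fintype V] {I : Instance V} (h : ∃ p, Feasible I p) :
    IsLeast (feasibleCosts I) (opt I) := by
  obtain ⟨p, hp⟩ := h
  -- It suffices to minimize over the compact set of assignments bounded by the cost of `p`.
  have hcomp : IsCompact ({q : V → ℝ | Feasible I q} ∩ Set.Icc 0 (fun _ => ∑ v, p v)) :=
    isCompact_Icc.inter_left (isClosed_feasible I)
  obtain ⟨q, ⟨hq, -⟩, hmin⟩ := hcomp.exists_isMinOn ⟨p, hp, hp.1, hp.le_sum⟩
    (f := fun q => ∑ v, q v) (by fun_prop)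
  have hle : IsLeast (feasibleCosts I) (∑ v, q v) := by
    refine ⟨⟨q, hq, rfl⟩, ?_⟩
    rintro _ ⟨r, hr, rfl⟩
    rcases le_total (∑ v, r v) (∑ v, p v) with h | h
    · exact hmin ⟨hr, hr.1, fun v => (hr.le_sum v).trans h⟩
    · exact (hmin ⟨hp, hp.1, hp.le_sum⟩).trans h
  rw [opt, hle.csInf_eq]
  exact hle

/-! ### The discretized graph -/

/-- The vertex of the original graph of which a vertex of the discretized graph is a copy. -/
def proj {c : ℕ} : Vert (V × Fin c) → Vert V
  | Vert.s => Vert.s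
  | Vert.t => Vert.t
  | Vert.inner x => Vert.inner x.1

/-- The power level `i α` of a copy `v(i)`; the terminals have level `0`. -/
noncomputable def level {c : ℕ} (α : ℝ) : Vert (V × Fin c) → ℝ
  | Vert.s => 0
  | Vert.t => 0
  | Vert.inner x => (x.2 : ℕ) * α

theorem weight_terminals {I : Instance V} (h : ∃ p, Feasible I p)
    (hst : I.graph.Adj Vert.s Vert.t) : I.weight s(Vert.s, Vert.t) ≤ 0 := by
  obtain ⟨p, hp⟩ := h
  by_contra hw
  have : (remaining I p).Adj Vert.s Vert.t := ⟨hst, by simpa [extend] using hw⟩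
  exact hp.2 this.reachable

/-- On a feasible instance the two terminals are not joined by an edge of positive weight, so the
cases in the definition of the discretized graph agree. -/
theorem discreteGraph_adj {I : Instance V} {ε : ℝ} (h : ∃ p, Feasible I p)
    (x y : Vert (V × Fin (copies V ε))) :
    (discreteGraph I ε).Adj x y ↔ I.graph.Adj (proj x) (proj y) ∧
      level (unit I ε) x + level (unit I ε) y < I.weight s(proj x, proj y) := by
  have hst := weight_terminals h
  rcases x with _ | _ | ⟨a, i⟩ <;> rcases y with _ | _ | ⟨b, j⟩ <;>
    simp only [discreteGraph, discreteAdj, proj, level, zero_add, add_zero]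
  · simp
  · simp only [false_iff, not_and, not_lt]; exact hst
  · rw [Sym2.eq_swap, I.graph.adj_comm]
  · simp only [false_iff, not_and, not_lt]
    rw [Sym2.eq_swap, I.graph.adj_comm]; exact hst
  · simp
  · rw [Sym2.eq_swap, I.graph.adj_comm]

instance [Finite V] : Finite (Vert V) :=
  Finite.of_surjective (fun x : Option (Option V) => match x with
    | none => Vert.s
    | some none => Vert.t
    | some (some v) => Vert.inner v) (by
      rintro (_ | _ | v)
      · exact ⟨none, rfl⟩
      · exact ⟨some none, rfl⟩
      · exact ⟨some (some v), rfl⟩)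

theorem order_eq (V : Type u) [Fintype V] : order V = Fintype.card V + 2 := by
  have e : Vert V ≃ Option (Option V) :=
    { toFun := fun x => match x with
        | Vert.s => none
        | Vert.t => some none
        | Vert.inner v => some (some v)
      invFun := fun x => match x with
        | none => Vert.s
        | some none => Vert.t
        | some (some v) => Vert.inner v
      left_inv := by rintro (_ | _ | v) <;> rfl
      right_inv := by rintro (_ | _ | v) <;> rfl }
  rw [order, Nat.card_congr e]
  simp

open Classical in
/-- A feasible assignment gives a vertex cut: the copies whose level is below the power. -/
noncomputable def lowCopies [Fintype V] (I : Instance V) (ε : ℝ) (p : V → ℝ) :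
    Finset (V × Fin (copies V ε)) :=
  Finset.univ.filter fun x => ((x.2 : ℕ) : ℝ) * unit I ε < p x.1

theorem Feasible.isVertexCut_lowCopies [Fintype V] {I : Instance V} {p : V → ℝ}
    (hp : Feasible I p) (ε : ℝ) : IsVertexCut (discreteGraph I ε) (lowCopies I ε p) := by
  refine isVertexCut_of_closed
    {x | (remaining I p).Reachable Vert.s (proj x) ∧ extend p (proj x) ≤ level (unit I ε) x}
    ⟨.refl _, le_rfl⟩ (fun h => hp.2 h.1) ?_
  rintro x ⟨hx, hx'⟩ y hxy
  rw [discreteGraph_adj ⟨p, hp⟩] at hxy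
  by_cases hy : extend p (proj y) ≤ level (unit I ε) y
  · have : (remaining I p).Adj (proj x) (proj y) := ⟨hxy.1, by linarith [hxy.2]⟩
    exact Or.inl ⟨hx.trans this.reachable, hy⟩
  · right
    rcases y with _ | _ | y
    · exact absurd le_rfl hy
    · exact absurd le_rfl hy
    · exact ⟨y, by simpa [lowCopies, extend, proj, level] using hy, rfl⟩

theorem card_lowCopies_le [Fintype V] {I : Instance V} {ε : ℝ} (hα : 0 < unit I ε) (p : V → ℝ) :
    (lowCopies I ε p).card ≤ ∑ v, ⌈p v / unit I ε⌉₊ := by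
  classical
  have h : lowCopies I ε p ⊆ (Finset.univ.sigma (fun v => Finset.univ.filter
      fun i : Fin (copies V ε) => (i : ℕ) < ⌈p v / unit I ε⌉₊)).map
        (Equiv.sigmaEquivProd V (Fin (copies V ε))).toEmbedding := by
    rintro ⟨v, i⟩ hx
    simp only [lowCopies, Finset.mem_filter, Finset.mem_univ, true_and] at hx
    simp only [Finset.mem_map_equiv, Finset.mem_sigma, Finset.mem_filter, Finset.mem_univ,
      true_and]
    change (i : ℕ) < ⌈p v / unit I ε⌉₊
    rwa [Nat.lt_ceil, lt_div_iff₀ hα]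
  refine (Finset.card_le_card h).trans ?_
  rw [Finset.card_map, Finset.card_sigma]
  refine Finset.sum_le_sum fun v _ => ?_
  rw [← Finset.card_range ⌈p v / unit I ε⌉₊]
  refine Finset.card_le_card_of_injOn (fun i => (i : ℕ)) ?_ (fun a _ b _ h => Fin.ext h)
  intro i hi
  simpa using hi

/-! ### The approximation guarantee -/

theorem copies_pos (V : Type u) [Fintype V] {ε : ℝ} (h0 : 0 < ε) : 0 < copies V ε := by
  have : (0 : ℝ) < order V := by rw [order_eq]; positivity
  exact Nat.ceil_pos.2 (by positivity)

theorem unit_nonneg [Fintype V] {I : Instance V} (h : ∃ p, Feasible I p) {ε : ℝ} (h0 : 0 < ε) :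
    0 ≤ unit I ε := by
  have := (isLeast_bottleneck h).1.1
  unfold unit
  positivity

/-- The uniform assignment `p*` yields a vertex cut smaller than the number of copies, so no vertex
loses all its copies in a minimum cut. -/
theorem exists_small_cut [Fintype V] {I : Instance V} (h : ∃ p, Feasible I p) {ε : ℝ}
    (h0 : 0 < ε) (h1 : ε ≤ 1) :
    ∃ K, IsVertexCut (discreteGraph I ε) K ∧ K.card < copies V ε := by
  have hb := (isLeast_bottleneck h).1
  refine ⟨_, hb.2.isVertexCut_lowCopies ε, ?_⟩
  have hn : (0 : ℝ) < order V := by rw [order_eq]; positivity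
  rcases hb.1.eq_or_lt with h2 | h2
  · have : lowCopies I ε (fun _ => bottleneck I) = ∅ := by
      ext x
      simp [lowCopies, unit, ← h2]
    rw [this]
    exact copies_pos V h0
  · have hα : 0 < unit I ε := by unfold unit; positivity
    refine (card_lowCopies_le hα _).trans_lt ?_
    rw [Finset.sum_const, smul_eq_mul, Finset.card_univ, copies, Nat.lt_ceil]
    have e : bottleneck I / unit I ε = order V / ε := by
      unfold unit
      field_simp
    rw [e]
    have hc := Nat.ceil_lt_add_one (a := (order V : ℝ) / ε) (by positivity)
    have hN : (order V : ℝ) = Fintype.card V + 2 := by rw [order_eq]; push_cast; ring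
    push_cast
    have hle : (order V : ℝ) ≤ order V / ε := (le_div_iff₀ h0).2 (by nlinarith)
    have hsq : (order V : ℝ) ^ 2 / ε = order V * (order V / ε) := by ring
    rw [hsq]
    have hk : (0 : ℝ) ≤ Fintype.card V := by positivity
    nlinarith

/-- A minimum cut with `k_v` copies of each `v` leaves one of the copies `v(0), …, v(k_v)` alive, so a
path that survives the powers `k_v α` lifts to a path that avoids the cut. -/
theorem IsMinVertexCut.feasible [Fintype V] {I : Instance V} (h : ∃ p, Feasible I p) {ε : ℝ}
    (h0 : 0 < ε) (h1 : ε ≤ 1) {K : Finset (V × Fin (copies V ε))}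
    (hK : IsMinVertexCut (discreteGraph I ε) K) : Feasible I (cutPowers I ε K) := by
  classical
  obtain ⟨K', hK', hlt⟩ := exists_small_cut h h0 h1
  have hcard : K.card < copies V ε := (hK.2 K' hK').trans_lt hlt
  have hα := unit_nonneg h h0
  -- Among the first `k_v + 1` copies of `v`, one survives.
  have key : ∀ v, ∃ i : Fin (copies V ε), (v, i) ∉ K ∧
      ((i : ℕ) : ℝ) * unit I ε ≤ cutPowers I ε K v := by
    intro v
    by_contra hcon
    push Not at hcon
    set S : Finset (Fin (copies V ε)) := Finset.univ.filter fun j => (v, j) ∈ K with hS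
    have hSn : Set.ncard {j : Fin (copies V ε) | (v, j) ∈ K} = S.card := by
      rw [← Set.ncard_coe_finset]; congr 1; ext; simp [hS]
    have hSK : S.card ≤ K.card :=
      Finset.card_le_card_of_injOn (fun j => (v, j)) (fun j hj => by simpa [hS] using hj)
        (fun a _ b _ hab => by simpa using hab)
    have hsub : (Finset.univ : Finset (Fin (S.card + 1))).card ≤ S.card := by
      refine Finset.card_le_card_of_injOn (fun j => Fin.castLE (by omega) j) ?_
        (fun a _ b _ hab => by simpa using hab)
      intro j _
      by_contra hj
      have hj' : (v, Fin.castLE (by omega) j) ∉ K := by simpa [hS] using hj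
      have := hcon _ hj'
      unfold cutPowers at this
      rw [hSn] at this
      have h3 : ((j : ℕ) : ℝ) ≤ S.card := by
        have := j.2
        exact_mod_cast (by omega : (j : ℕ) ≤ S.card)
      exact absurd this (not_lt.2 (mul_le_mul_of_nonneg_right (by simpa using h3) hα))
    simp at hsub
  choose f hf hf' using key
  let lift : Vert V → Vert (V × Fin (copies V ε)) := fun x => match x with
    | Vert.s => Vert.s
    | Vert.t => Vert.t
    | Vert.inner v => Vert.inner (v, f v)
  obtain ⟨R, hs, ht, -, hR⟩ := hK.1.exists_closed
  refine ⟨fun v => by unfold cutPowers; positivity,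
    not_reachable_of_closed {x | lift x ∈ R} hs ht ?_⟩
  intro x hx y hxy
  have hp : ∀ x, proj (lift x) = x := by rintro (_ | _ | x) <;> rfl
  have hl : ∀ x, level (unit I ε) (lift x) ≤ extend (cutPowers I ε K) x := by
    rintro (_ | _ | x)
    · exact le_rfl
    · exact le_rfl
    · exact hf' x
  have hadj : (discreteGraph I ε).Adj (lift x) (lift y) := by
    rw [discreteGraph_adj h, hp, hp]
    exact ⟨hxy.1, by linarith [not_le.1 hxy.2, hl x, hl y]⟩
  rcases hR _ hx _ hadj with h | ⟨z, hz, hyz⟩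
  · exact h
  · rcases y with _ | _ | y
    · cases hyz
    · cases hyz
    · cases hyz
      exact absurd hz (hf y)

theorem sum_cutPowers [Fintype V] (I : Instance V) (ε : ℝ) (K : Finset (V × Fin (copies V ε))) :
    ∑ v, cutPowers I ε K v = K.card * unit I ε := by
  classical
  unfold cutPowers
  rw [← Finset.sum_mul, ← Nat.cast_sum]
  congr 2
  rw [Finset.card_eq_sum_card_fiberwise (f := Prod.fst) (t := Finset.univ) (by simp)]
  refine Finset.sum_congr rfl fun v _ => ?_
  rw [← Set.ncard_coe_finset]
  refine Set.ncard_congr (fun j _ => (v, j)) (by simp) (by simp) ?_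
  rintro ⟨a, b⟩ hb
  simp only [Finset.coe_filter, Set.mem_ofPred_eq] at hb
  exact ⟨b, by simpa [← hb.2] using hb.1, by simp [hb.2]⟩

/-- Rounding the optimal powers up to multiples of `α` costs at most `n α = ε p* ≤ ε OPT`. -/
theorem IsMinVertexCut.sum_le [Fintype V] {I : Instance V} (h : ∃ p, Feasible I p) {ε : ℝ}
    (h0 : 0 < ε) {K : Finset (V × Fin (copies V ε))}
    (hK : IsMinVertexCut (discreteGraph I ε) K) :
    ∑ v, cutPowers I ε K v ≤ (1 + ε) * opt I := by
  rw [sum_cutPowers]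
  obtain ⟨p, hp, hpo⟩ := (isLeast_opt h).1
  have hpb : bottleneck I ≤ opt I := hpo ▸ (isLeast_bottleneck h).2 hp.sum_mem_bottleneckPowers
  have hb0 := (isLeast_bottleneck h).1.1
  rcases (unit_nonneg h h0).eq_or_lt with hα | hα
  · rw [← hα, mul_zero]
    have : 0 ≤ opt I := hb0.trans hpb
    positivity
  · have h1 : (K.card : ℝ) ≤ ∑ v, (p v / unit I ε + 1) := by
      have h2 := (hK.2 _ (hp.isVertexCut_lowCopies ε)).trans (card_lowCopies_le hα p)
      refine (Nat.cast_le.2 h2).trans ?_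
      rw [Nat.cast_sum]
      refine Finset.sum_le_sum fun v _ => (Nat.ceil_lt_add_one ?_).le
      exact div_nonneg (hp.1 v) hα.le
    rw [Finset.sum_add_distrib, ← Finset.sum_div, ← hpo, Finset.sum_const, nsmul_one,
      Finset.card_univ] at h1
    have hN : (order V : ℝ) = Fintype.card V + 2 := by rw [order_eq]; push_cast; ring
    have hn : (0 : ℝ) < order V := by rw [hN]; positivity
    have h3 : (order V : ℝ) * unit I ε = ε * bottleneck I := by
      unfold unit
      field_simp
    calc (K.card : ℝ) * unit I ε ≤ (opt I / unit I ε + Fintype.card V) * unit I ε := by gcongr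
      _ = opt I + Fintype.card V * unit I ε := by field_simp
      _ ≤ opt I + ε * bottleneck I := by rw [← h3, hN]; nlinarith
      _ ≤ (1 + ε) * opt I := by nlinarith

end

/-! ### Structured programs -/

section

/-- The contents of the registers and arrays: a machine state without its program counter. -/
structure Mem where
  nreg : ℕ → ℕ
  rreg : ℕ → ℝ
  narr : ℕ → ℕ → ℕ
  rarr : ℕ → ℕ → ℝ

/-- The machine state with memory `m` and program counter `pc`. -/
def Mem.at (m : Mem) (pc : ℕ) : State := ⟨pc, m.nreg, m.rreg, m.narr, m.rarr⟩

/-- The memory of a machine state. -/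
def State.mem (σ : State) : Mem := ⟨σ.nreg, σ.rreg, σ.narr, σ.rarr⟩

/-- A comparison of two registers, of natural or of real numbers. -/
inductive Cond : Type
  | natLt (a b : ℕ)
  | realLt (a b : ℕ)

/-- The truth of a comparison. -/
def Cond.holds (m : Mem) : Cond → Prop
  | .natLt a b => m.nreg a < m.nreg b
  | .realLt a b => m.rreg a < m.rreg b

/-- The instruction that jumps to `l` if the comparison holds. -/
def Cond.jump (l : ℕ) : Cond → Instr
  | .natLt a b => .natJump a b l
  | .realLt a b => .realJump a b l

/-- Programs with structured control flow; `op` is meant for instructions that do not jump. -/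
inductive Cmd : Type
  | skip
  | op (i : Instr)
  | seq (c d : Cmd)
  | cond (b : Cond) (c d : Cmd)
  | loop (b : Cond) (c : Cmd)

namespace Cmd

/-- Sequential composition of a list of commands. -/
def block : List Cmd → Cmd
  | [] => skip
  | c :: l => seq c (block l)

/-- The number of machine instructions of the compiled program. -/
def len : Cmd → ℕ
  | skip => 0
  | op _ => 1
  | seq c d => c.len + d.len
  | cond _ c d => 2 + d.len + c.len
  | loop _ c => 3 + c.len

/-- The machine code of a program to be stored from address `o` on. -/
def code : Cmd → ℕ → List Instr
  | skip, _ => []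
  | op i, _ => [i]
  | seq c d, o => c.code o ++ d.code (o + c.len)
  | cond b c d, o =>
      b.jump (o + 2 + d.len) ::
        (d.code (o + 1) ++ .jump (o + 2 + d.len + c.len) :: c.code (o + 2 + d.len))
  | loop b c, o =>
      b.jump (o + 2) :: .jump (o + 3 + c.len) :: (c.code (o + 2) ++ [.jump o])

theorem length_code (c : Cmd) (o : ℕ) : (c.code o).length = c.len := by
  induction c generalizing o with
  | skip => rfl
  | op => rfl
  | seq c d hc hd => simp [code, len, hc, hd]
  | cond b c d hc hd => simp [code, len, hc, hd]; omega
  | loop b c hc => simp [code, len, hc]; omega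

/-- `Run c m τ m'`: started with memory `m`, the program `c` ends with memory `m'` after exactly
`τ` machine steps. -/
inductive Run : Cmd → Mem → ℕ → Mem → Prop
  | skip (m) : Run skip m 0 m
  | op {i m m'} (h : ∀ pc, exec (m.at pc) i = m'.at (pc + 1)) : Run (op i) m 1 m'
  | seq {c d m m₁ m₂ τ τ'} : Run c m τ m₁ → Run d m₁ τ' m₂ → Run (seq c d) m (τ + τ') m₂
  | condTrue {b c d m m' τ} : b.holds m → Run c m τ m' → Run (cond b c d) m (1 + τ) m'
  | condFalse {b c d m m' τ} : ¬ b.holds m → Run d m τ m' → Run (cond b c d) m (1 + (τ + 1)) m'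
  | loopFalse {b c m} : ¬ b.holds m → Run (loop b c) m 2 m
  | loopTrue {b c m m₁ m₂ τ τ'} : b.holds m → Run c m τ m₁ → Run (loop b c) m₁ τ' m₂ →
      Run (loop b c) m (1 + (τ + (1 + τ'))) m₂

/-- The program `P` contains the code `l` at the addresses from `o` on. -/
def Stored (P : List Instr) (o : ℕ) (l : List Instr) : Prop :=
  ∀ i ins, l[i]? = some ins → P[o + i]? = some ins

theorem Stored.append_left {P o l l'} (h : Stored P o (l ++ l')) : Stored P o l := by
  intro i ins hi
  refine h i ins ?_
  rw [List.getElem?_append_left (List.getElem?_eq_some_iff.1 hi).1, hi]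

theorem Stored.append_right {P o l l'} (h : Stored P o (l ++ l')) :
    Stored P (o + l.length) l' := by
  intro i ins hi
  rw [add_assoc]
  refine h _ ins ?_
  rw [List.getElem?_append_right (by omega), ← hi]
  congr 1
  omega

theorem Stored.head {P o i l} (h : Stored P o (i :: l)) : P[o]? = some i := h 0 i rfl

theorem Stored.tail {P o i l} (h : Stored P o (i :: l)) : Stored P (o + 1) l := by
  intro j ins hj
  rw [add_assoc, add_comm 1]
  exact h (j + 1) ins (by simpa using hj)

theorem step_at {P : List Instr} {m : Mem} {o : ℕ} {i : Instr} (h : P[o]? = some i) :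
    step P (m.at o) = exec (m.at o) i := by
  have : P[(m.at o).pc]? = some i := h
  simp [step, this]

theorem exec_jump_of_holds {b : Cond} {m : Mem} (h : b.holds m) (o l : ℕ) :
    exec (m.at o) (b.jump l) = m.at l := by
  cases b <;> simp_all [Cond.holds, Cond.jump, exec, Mem.at]

theorem exec_jump_of_not_holds {b : Cond} {m : Mem} (h : ¬ b.holds m) (o l : ℕ) :
    exec (m.at o) (b.jump l) = m.at (o + 1) := by
  cases b <;> simp only [Cond.holds] at h <;> simp [Cond.jump, exec, Mem.at, h]

/-- The compiled code does what the structured program does, in the same number of steps. -/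
theorem Run.correct {c : Cmd} {m m' : Mem} {τ : ℕ} (h : Run c m τ m') (P : List Instr) (o : ℕ)
    (hP : Stored P o (c.code o)) : (step P)^[τ] (m.at o) = m'.at (o + c.len) := by
  induction h generalizing o with
  | skip => rfl
  | op h =>
    rw [Function.iterate_one, step_at hP.head, h]
    rfl
  | seq _ _ ih ih' =>
    rw [add_comm, Function.iterate_add_apply, ih o hP.append_left, ih' _ ?_, len, add_assoc]
    simpa only [length_code] using hP.append_right
  | @condTrue b c d m m' τ hb _ ih =>
    have hP' := hP.tail.append_right.tail
    rw [length_code] at hP'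
    rw [add_comm, Function.iterate_add_apply, Function.iterate_one, step_at hP.head,
      exec_jump_of_holds hb, ih _ (by convert hP' using 1; omega)]
    congr 1
    simp only [len]
    omega
  | @condFalse b c d m m' τ hb _ ih =>
    have hP' := hP.tail.append_right
    rw [length_code] at hP'
    rw [add_comm, Function.iterate_add_apply, Function.iterate_one, step_at hP.head,
      exec_jump_of_not_holds hb, add_comm, Function.iterate_add_apply, ih _ hP.tail.append_left,
      Function.iterate_one, step_at hP'.head]
    simp only [len, exec, Mem.at, State.mk.injEq, and_true]
    omega
  | @loopFalse b c m hb =>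
    change step P (step P (m.at o)) = _
    rw [step_at hP.head, exec_jump_of_not_holds hb, step_at hP.tail.head]
    simp only [len, exec, Mem.at, State.mk.injEq, and_true]
    omega
  | @loopTrue b c m m₁ m₂ τ τ' hb _ _ ih ih' =>
    have hP' := hP.tail.tail.append_right
    rw [length_code] at hP'
    rw [add_comm, Function.iterate_add_apply, Function.iterate_one, step_at hP.head,
      exec_jump_of_holds hb, add_comm, Function.iterate_add_apply, ih _ hP.tail.tail.append_left,
      add_comm, Function.iterate_add_apply, Function.iterate_one, step_at hP'.head]
    exact ih' o hP

/-! ### Reasoning about programs -/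

/-- Started with memory `m`, the program `c` ends within `T` steps with a memory satisfying `Q`. -/
def Ex (c : Cmd) (m : Mem) (T : ℕ) (Q : Mem → Prop) : Prop :=
  ∃ τ ≤ T, ∃ m', Run c m τ m' ∧ Q m'

theorem Ex.mono {c : Cmd} {m : Mem} {T T' : ℕ} {Q Q' : Mem → Prop} (h : Ex c m T Q)
    (hT : T ≤ T') (hQ : ∀ m', Q m' → Q' m') : Ex c m T' Q' := by
  obtain ⟨τ, hτ, m', hr, hq⟩ := h
  exact ⟨τ, hτ.trans hT, m', hr, hQ _ hq⟩

theorem Ex.seq {c d : Cmd} {m : Mem} {T T' : ℕ} {Q Q' : Mem → Prop} (h : Ex c m T Q)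
    (h' : ∀ m', Q m' → Ex d m' T' Q') : Ex (seq c d) m (T + T') Q' := by
  obtain ⟨τ, hτ, m', hr, hq⟩ := h
  obtain ⟨τ', hτ', m'', hr', hq'⟩ := h' _ hq
  exact ⟨τ + τ', by omega, m'', hr.seq hr', hq'⟩

theorem Ex.cond {b : Cond} {c d : Cmd} {m : Mem} {T : ℕ} {Q : Mem → Prop}
    (h : b.holds m → Ex c m T Q) (h' : ¬ b.holds m → Ex d m T Q) :
    Ex (cond b c d) m (T + 2) Q := by
  by_cases hb : b.holds m
  · obtain ⟨τ, hτ, m', hr, hq⟩ := h hb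
    exact ⟨_, by omega, m', hr.condTrue hb, hq⟩
  · obtain ⟨τ, hτ, m', hr, hq⟩ := h' hb
    exact ⟨_, by omega, m', hr.condFalse hb, hq⟩

/-- The memory after one instruction that does not jump. -/
noncomputable def after (m : Mem) (i : Instr) : Mem := (exec (m.at 0) i).mem

open Classical in
/-- The memory after a program without loops. -/
noncomputable def eval : Cmd → Mem → Mem
  | skip, m => m
  | op i, m => after m i
  | seq c d, m => d.eval (c.eval m)
  | cond b c d, m => if b.holds m then c.eval m else d.eval m
  | loop _ _, m => m

/-- An upper bound for the number of steps of a program without loops. -/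
def time : Cmd → ℕ
  | skip => 0
  | op _ => 1
  | seq c d => c.time + d.time
  | cond _ c d => c.time + d.time + 2
  | loop _ _ => 0

/-- Whether an instruction is not a jump. -/
def isSimple : Instr → Bool
  | .jump _ => false
  | .natJump _ _ _ => false
  | .realJump _ _ _ => false
  | _ => true

/-- Whether a program has no loops, and no jumps other than those of its conditionals. -/
def loopFree : Cmd → Bool
  | skip => true
  | op i => isSimple i
  | seq c d => c.loopFree && d.loopFree
  | cond _ c d => c.loopFree && d.loopFree
  | loop _ _ => false

theorem Ex.of_eval {c : Cmd} (hc : c.loopFree = true) {m : Mem} {Q : Mem → Prop}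
    (hQ : Q (c.eval m)) : Ex c m c.time Q := by
  suffices h : Ex c m c.time (· = c.eval m) from h.mono le_rfl (by rintro _ rfl; exact hQ)
  clear hQ
  induction c generalizing m with
  | skip => exact ⟨0, le_rfl, m, .skip m, rfl⟩
  | op i =>
    refine ⟨1, le_rfl, after m i, .op fun pc => ?_, rfl⟩
    cases i <;> first | rfl | simp [loopFree, isSimple] at hc
  | seq c d ih ih' =>
    simp only [loopFree, Bool.and_eq_true] at hc
    exact (ih hc.1).seq (by rintro _ rfl; exact ih' hc.2)
  | cond b c d ih ih' =>
    simp only [loopFree, Bool.and_eq_true] at hc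
    by_cases hb : b.holds m
    · simp only [eval, hb, if_true]
      exact Ex.mono (Ex.cond (T := c.time) (fun _ => ih hc.1) (fun h => absurd hb h))
        (by simp only [time]; omega) fun _ h => h
    · simp only [eval, hb, if_false]
      exact Ex.mono (Ex.cond (T := d.time) (fun h => absurd h hb) (fun _ => ih' hc.2))
        (by simp only [time]; omega) fun _ h => h
  | loop b c => simp [loopFree] at hc

/-- Whether a program may change the register `r` of natural numbers. -/
def setsNat (r : ℕ) : Cmd → Bool
  | op (.natConst d _) | op (.natAdd d _ _) | op (.natSub d _ _) | op (.natLoad d _ _) => d == r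
  | seq c d => c.setsNat r || d.setsNat r
  | cond _ c d => c.setsNat r || d.setsNat r
  | loop _ c => c.setsNat r
  | _ => false

/-- Whether a program may change the register `r` of real numbers. -/
def setsReal (r : ℕ) : Cmd → Bool
  | op (.realConst d _) | op (.realAdd d _ _) | op (.realSub d _ _) | op (.realMul d _ _)
  | op (.realDiv d _ _) | op (.realLoad d _ _) => d == r
  | seq c d => c.setsReal r || d.setsReal r
  | cond _ c d => c.setsReal r || d.setsReal r
  | loop _ c => c.setsReal r
  | _ => false

/-- Whether a program may change the array `x` of natural numbers. -/
def setsNatArray (x : ℕ) : Cmd → Bool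
  | op (.natStore y _ _) => y == x
  | seq c d => c.setsNatArray x || d.setsNatArray x
  | cond _ c d => c.setsNatArray x || d.setsNatArray x
  | loop _ c => c.setsNatArray x
  | _ => false

/-- Whether a program may change the array `x` of real numbers. -/
def setsRealArray (x : ℕ) : Cmd → Bool
  | op (.realStore y _ _) => y == x
  | seq c d => c.setsRealArray x || d.setsRealArray x
  | cond _ c d => c.setsRealArray x || d.setsRealArray x
  | loop _ c => c.setsRealArray x
  | _ => false

/-- The memories `m` and `m'` agree wherever the program `c` does not write. -/
structure Frame (c : Cmd) (m m' : Mem) : Prop where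
  nreg : ∀ r, c.setsNat r = false → m'.nreg r = m.nreg r
  rreg : ∀ r, c.setsReal r = false → m'.rreg r = m.rreg r
  narr : ∀ r, c.setsNatArray r = false → m'.narr r = m.narr r
  rarr : ∀ r, c.setsRealArray r = false → m'.rarr r = m.rarr r

theorem Frame.refl (c : Cmd) (m : Mem) : Frame c m m :=
  ⟨fun _ _ => rfl, fun _ _ => rfl, fun _ _ => rfl, fun _ _ => rfl⟩

theorem Frame.trans {c : Cmd} {m m' m'' : Mem} (h : Frame c m m') (h' : Frame c m' m'') :
    Frame c m m'' :=
  ⟨fun r hr => (h'.nreg r hr).trans (h.nreg r hr), fun r hr => (h'.rreg r hr).trans (h.rreg r hr),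
    fun r hr => (h'.narr r hr).trans (h.narr r hr), fun r hr => (h'.rarr r hr).trans (h.rarr r hr)⟩

theorem Run.frame {c : Cmd} {m m' : Mem} {τ : ℕ} (h : Run c m τ m') : Frame c m m' := by
  induction h with
  | skip m => exact .refl _ _
  | @op i m m' h =>
    have h0 := h 0
    cases i <;> simp only [exec, Mem.at, State.mk.injEq] at h0 <;>
      (obtain ⟨-, h1, h2, h3, h4⟩ := h0
       constructor <;> intro r hr <;> simp only [← h1, ← h2, ← h3, ← h4] <;>
       simp only [setsNat, setsReal, setsNatArray, setsRealArray, beq_eq_false_iff_ne] at hr <;>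
       exact Function.update_of_ne (Ne.symm hr) _ _)
  | seq _ _ h h' =>
    constructor <;> intro r hr <;>
      simp only [setsNat, setsReal, setsNatArray, setsRealArray, Bool.or_eq_false_iff] at hr
    · exact (h'.nreg r hr.2).trans (h.nreg r hr.1)
    · exact (h'.rreg r hr.2).trans (h.rreg r hr.1)
    · exact (h'.narr r hr.2).trans (h.narr r hr.1)
    · exact (h'.rarr r hr.2).trans (h.rarr r hr.1)
  | condTrue _ _ h =>
    constructor <;> intro r hr <;>
      simp only [setsNat, setsReal, setsNatArray, setsRealArray, Bool.or_eq_false_iff] at hr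
    · exact h.nreg r hr.1
    · exact h.rreg r hr.1
    · exact h.narr r hr.1
    · exact h.rarr r hr.1
  | condFalse _ _ h =>
    constructor <;> intro r hr <;>
      simp only [setsNat, setsReal, setsNatArray, setsRealArray, Bool.or_eq_false_iff] at hr
    · exact h.nreg r hr.2
    · exact h.rreg r hr.2
    · exact h.narr r hr.2
    · exact h.rarr r hr.2
  | loopFalse => exact .refl _ _
  | loopTrue _ _ _ h h' =>
    exact Frame.trans ⟨fun r hr => h.nreg r hr, fun r hr => h.rreg r hr, fun r hr => h.narr r hr,
      fun r hr => h.rarr r hr⟩ h'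

theorem Ex.frame {c : Cmd} {m : Mem} {T : ℕ} {Q : Mem → Prop} (h : Ex c m T Q) :
    Ex c m T (fun m' => Frame c m m' ∧ Q m') := by
  obtain ⟨τ, hτ, m', hr, hq⟩ := h
  exact ⟨τ, hτ, m', hr, hr.frame, hq⟩

/-- The rule for loops: `Inv` is an invariant, whose second argument bounds the number of
iterations that are left. -/
theorem Ex.loop {b : Cond} {c : Cmd} {m₀ : Mem} {T k₀ : ℕ} {Q : Mem → Prop}
    (Inv : Mem → ℕ → Prop) (h₀ : Inv m₀ k₀)
    (h : ∀ m k, Frame c m₀ m → Inv m k → b.holds m → Ex c m T (fun m' => ∃ k' < k, Inv m' k'))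
    (hQ : ∀ m k, Frame c m₀ m → Inv m k → ¬ b.holds m → Q m) :
    Ex (loop b c) m₀ (k₀ * (T + 2) + 2) Q := by
  suffices H : ∀ k m, Frame c m₀ m → Inv m k → Ex (Cmd.loop b c) m (k * (T + 2) + 2) Q from
    H k₀ m₀ (.refl _ _) h₀
  intro k
  induction k using Nat.strong_induction_on with
  | _ k ih =>
    intro m hF hI
    by_cases hb : b.holds m
    · obtain ⟨τ, hτ, m₁, hr, k', hk', hI'⟩ := h m k hF hI hb
      obtain ⟨τ', hτ', m₂, hr', hq⟩ := ih k' hk' m₁ (hF.trans hr.frame) hI'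
      refine ⟨_, ?_, m₂, .loopTrue hb hr hr', hq⟩
      have : (k' + 1) * (T + 2) ≤ k * (T + 2) := Nat.mul_le_mul_right _ hk'
      rw [add_mul] at this
      omega
    · exact ⟨2, by omega, m, .loopFalse hb, hQ m k hF hI hb⟩

/-- The machine runs the compiled program as the structured program prescribes. -/
theorem Ex.haltsWithin {c : Cmd} {σ : State} {T : ℕ} {Q : Mem → Prop} {B : ℝ}
    (h : Ex c σ.mem T Q) (hσ : σ.pc = 0) (hB : (T : ℝ) ≤ B) :
    ∃ σ', HaltsWithin (c.code 0) σ B σ' ∧ Q σ'.mem := by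
  obtain ⟨τ, hτ, m', hr, hq⟩ := h
  refine ⟨m'.at (0 + c.len), ⟨τ, (Nat.cast_le.2 hτ).trans hB, ?_, ?_⟩, hq⟩
  · have : σ = σ.mem.at 0 := by cases σ; simp_all [Mem.at, State.mem]
    rw [this]
    exact hr.correct _ 0 fun i ins hi => by rwa [zero_add]
  · simp [Halted, length_code, Mem.at]

theorem after_natConst (m : Mem) (d z : ℕ) :
    after m (.natConst d z) = { m with nreg := Function.update m.nreg d z } := rfl
theorem after_natAdd (m : Mem) (d a b : ℕ) : after m (.natAdd d a b) =
    { m with nreg := Function.update m.nreg d (m.nreg a + m.nreg b) } := rfl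
theorem after_natSub (m : Mem) (d a b : ℕ) : after m (.natSub d a b) =
    { m with nreg := Function.update m.nreg d (m.nreg a - m.nreg b) } := rfl
theorem after_natLoad (m : Mem) (d x i : ℕ) : after m (.natLoad d x i) =
    { m with nreg := Function.update m.nreg d (m.narr x (m.nreg i)) } := rfl
theorem after_natStore (m : Mem) (x i a : ℕ) : after m (.natStore x i a) =
    { m with
      narr := Function.update m.narr x (Function.update (m.narr x) (m.nreg i) (m.nreg a)) } := rfl
theorem after_realConst (m : Mem) (d z : ℕ) :
    after m (.realConst d z) = { m with rreg := Function.update m.rreg d (z : ℝ) } := rfl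
theorem after_realAdd (m : Mem) (d a b : ℕ) : after m (.realAdd d a b) =
    { m with rreg := Function.update m.rreg d (m.rreg a + m.rreg b) } := rfl
theorem after_realMul (m : Mem) (d a b : ℕ) : after m (.realMul d a b) =
    { m with rreg := Function.update m.rreg d (m.rreg a * m.rreg b) } := rfl
theorem after_realDiv (m : Mem) (d a b : ℕ) : after m (.realDiv d a b) =
    { m with rreg := Function.update m.rreg d (m.rreg a / m.rreg b) } := rfl
theorem after_realLoad (m : Mem) (d x i : ℕ) : after m (.realLoad d x i) =
    { m with rreg := Function.update m.rreg d (m.rarr x (m.nreg i)) } := rfl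
theorem after_realStore (m : Mem) (x i a : ℕ) : after m (.realStore x i a) =
    { m with
      rarr := Function.update m.rarr x (Function.update (m.rarr x) (m.nreg i) (m.rreg a)) } := rfl

end Cmd

end

/-! ### Vertex-disjoint paths as matchings -/

section

/-- A system of vertex-disjoint paths from `0` to `1` in the relation `A` on `{0, …, N-1}`, given by
the predecessor `pred y` of every vertex `y`. A vertex `y` on none of the paths has `pred y = y`.
The last vertex of a path is the predecessor of no vertex. -/
structure Flow (N : ℕ) (A : ℕ → ℕ → Prop) (pred : ℕ → ℕ) : Prop where
  lt : ∀ y < N, pred y < N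
  zero : pred 0 = 0
  one : pred 1 = 1
  edge : ∀ y, 2 ≤ y → y < N → pred y = y ∨ A (pred y) y
  inj : ∀ y < N, ∀ y' < N, pred y = pred y' → pred y ≠ 0 → y = y'
  free : ∀ w, 2 ≤ w → w < N → (∀ y < N, pred y ≠ w) → A w 1

/-- The number of paths. -/
def flowValue (N : ℕ) (pred : ℕ → ℕ) : ℕ := ((Finset.Ico 2 N).filter fun y => pred y = 0).card

/-- A system of paths during an augmentation: the predecessor of `h` is to be chosen anew, and
apart from it there is a path system, one of whose paths is incomplete and begins with `h`. -/
structure HoleFlow (N : ℕ) (A : ℕ → ℕ → Prop) (pred : ℕ → ℕ) (h F : ℕ) : Prop where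
  lt : ∀ y < N, pred y < N
  zero : pred 0 = 0
  one : pred 1 = 1
  edge : ∀ y, 2 ≤ y → y < N → pred y = y ∨ A (pred y) y
  inj : ∀ y < N, ∀ y' < N, y ≠ h → y' ≠ h → pred y = pred y' → pred y ≠ 0 → y = y'
  free : ∀ w, 2 ≤ w → w < N → (∀ y < N, y ≠ h → pred y ≠ w) → A w 1
  value : ((Finset.Ico 2 N).filter fun y => y ≠ h ∧ pred y = 0).card = F

variable {N : ℕ} {A : ℕ → ℕ → Prop} {pred : ℕ → ℕ}

theorem Flow.of_eq_self (hN : 2 ≤ N) (h : ∀ y < N, pred y = y) : Flow N A pred where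
  lt y hy := by rwa [h y hy]
  zero := h 0 (by omega)
  one := h 1 (by omega)
  edge y _ hy := .inl (h y hy)
  inj y hy y' hy' he _ := by rwa [h y hy, h y' hy'] at he
  free w _ hw hne := absurd (h w hw) (hne w hw)

/-- An augmentation starts by leading from `z` to the sink; the vertex that `z` preceded becomes the
hole. -/
theorem Flow.open_hole (hf : Flow N A pred) {z h : ℕ} (hz : z ≠ 0) (hp : pred h = z)
    (hA : A z 1) : HoleFlow N A pred h (flowValue N pred) where
  lt := hf.lt
  zero := hf.zero
  one := hf.one
  edge := hf.edge
  inj y hy y' hy' _ _ := hf.inj y hy y' hy'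
  free w h2 hw hy := by
    by_cases hwz : w = z
    · exact hwz ▸ hA
    · refine hf.free w h2 hw fun y hyN hyw => ?_
      by_cases hyh : y = h
      · subst hyh; exact hwz (hyw.symm.trans hp)
      · exact hy y hyN hyh hyw
  value := by
    unfold flowValue
    congr 1
    refine Finset.filter_congr fun y _ => ⟨fun h => h.2, fun h' => ⟨?_, h'⟩⟩
    rintro rfl
    exact hz (hp.symm.trans h')

/-- Choosing the predecessor `x` for the hole `h` makes a hole of the vertex `h'` that `x` preceded. -/
theorem HoleFlow.move {h F : ℕ} (hf : HoleFlow N A pred h F) {x h' : ℕ} (hx : x < N)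
    (hA : x = h ∨ A x h) (h2 : 2 ≤ h) (hN : h < N) (hh : h' ≠ h) (hN' : h' < N)
    (hp : pred h' = x) (hx0 : x ≠ 0) : HoleFlow N A (Function.update pred h x) h' F where
  lt y hy := by
    by_cases e : y = h
    · simpa [e] using hx
    · simpa [e] using hf.lt y hy
  zero := by rw [Function.update_of_ne (by omega), hf.zero]
  one := by rw [Function.update_of_ne (by omega), hf.one]
  edge y hy2 hy := by
    by_cases e : y = h
    · subst e; simpa using hA
    · simpa [e] using hf.edge y hy2 hy
  inj y hy y' hy' hne hne' he h0 := by
    by_cases e : y = h <;> by_cases e' : y' = h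
    · rw [e, e']
    · subst e
      rw [Function.update_self, Function.update_of_ne e', ← hp] at he
      exact absurd (hf.inj h' hN' y' hy' hh e' he (hp ▸ hx0)).symm hne'
    · subst e'
      rw [Function.update_self, Function.update_of_ne e, ← hp] at he
      exact absurd (hf.inj h' hN' y hy hh e he.symm (hp ▸ hx0)).symm hne
    · rw [Function.update_of_ne e, Function.update_of_ne e'] at he
      rw [Function.update_of_ne e] at h0
      exact hf.inj y hy y' hy' e e' he h0
  free w hw2 hw hy := by
    have hxw : x ≠ w := by simpa using hy h hN hh.symm
    refine hf.free w hw2 hw fun y hyN hyh hyw => ?_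
    by_cases e : y = h'
    · subst e; exact hxw (hp.symm.trans hyw)
    · exact hy y hyN e (by rwa [Function.update_of_ne hyh])
  value := by
    rw [← hf.value]
    congr 1
    refine Finset.filter_congr fun y _ => ?_
    by_cases e : y = h
    · subst e; simp [hx0]
    · by_cases e' : y = h'
      · subst e'; simp [hp, hx0]
      · simp [e, e']

/-- Choosing the source as the predecessor of the hole completes a new path. -/
theorem HoleFlow.close {h F : ℕ} (hf : HoleFlow N A pred h F) (hA : A 0 h) (h2 : 2 ≤ h)
    (hN : h < N) : Flow N A (Function.update pred h 0) ∧
      flowValue N (Function.update pred h 0) = F + 1 := by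
  refine ⟨⟨fun y hy => ?_, ?_, ?_, fun y hy2 hy => ?_, fun y hy y' hy' he h0 => ?_,
    fun w hw2 hw hy => ?_⟩, ?_⟩
  · by_cases e : y = h
    · simp [e]; omega
    · simpa [e] using hf.lt y hy
  · rw [Function.update_of_ne (by omega), hf.zero]
  · rw [Function.update_of_ne (by omega), hf.one]
  · by_cases e : y = h
    · subst e; simpa using Or.inr hA
    · simpa [e] using hf.edge y hy2 hy
  · have e : y ≠ h := by rintro rfl; simp at h0
    have e' : y' ≠ h := by rintro rfl; rw [he] at h0; simp at h0
    rw [Function.update_of_ne e, Function.update_of_ne e'] at he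
    rw [Function.update_of_ne e] at h0
    exact hf.inj y hy y' hy' e e' he h0
  · exact hf.free w hw2 hw fun y hyN hyh hyw => hy y hyN (by rwa [Function.update_of_ne hyh])
  · rw [flowValue, ← hf.value]
    have : ((Finset.Ico 2 N).filter fun y => Function.update pred h 0 y = 0) =
        insert h ((Finset.Ico 2 N).filter fun y => y ≠ h ∧ pred y = 0) := by
      ext y
      by_cases e : y = h
      · subst e; simp; omega
      · simp [e]
    rw [this, Finset.card_insert_of_notMem (by simp)]

/-- Weak duality: there are at most as many disjoint paths as vertices in a cut `K`. Here `R` is the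
set of vertices reached from `0` without using `K`; every vertex in `R` is the predecessor of a
vertex in `R ∪ K`, and so is `0` once for every path. -/
theorem Flow.value_le (hf : Flow N A pred) (R K : Finset ℕ) (hR : R ⊆ Finset.Ico 2 N)
    (hK : ∀ x, x = 0 ∨ x ∈ R → ∀ y, 2 ≤ y → y < N → A x y → y ∈ R ∪ K)
    (ht : ∀ x ∈ R, ¬ A x 1) : flowValue N pred ≤ K.card := by
  have hex : ∀ x ∈ R, ∃ y < N, pred y = x := by
    intro x hx
    by_contra hcon
    push Not at hcon
    obtain ⟨h2, hN⟩ := Finset.mem_Ico.1 (hR hx)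
    exact ht x hx (hf.free x h2 hN hcon)
  choose! g hgN hg using hex
  set S := (Finset.Ico 2 N).filter fun y => pred y = 0 with hS
  have hdisj : Disjoint S (R.image g) := by
    rw [Finset.disjoint_left]
    intro y hy hy'
    obtain ⟨x, hx, rfl⟩ := Finset.mem_image.1 hy'
    have h1 := (Finset.mem_filter.1 hy).2
    rw [hg x hx] at h1
    have := Finset.mem_Ico.1 (hR hx)
    omega
  have hsub : S ∪ R.image g ⊆ R ∪ K := by
    intro y hy
    rcases Finset.mem_union.1 hy with hy | hy
    · obtain ⟨hy1, hy0⟩ := Finset.mem_filter.1 hy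
      obtain ⟨h2, hN⟩ := Finset.mem_Ico.1 hy1
      refine hK 0 (.inl rfl) y h2 hN ?_
      have := hf.edge y h2 hN
      rw [hy0] at this
      exact this.resolve_left (by omega)
    · obtain ⟨x, hx, rfl⟩ := Finset.mem_image.1 hy
      have hx2 := Finset.mem_Ico.1 (hR hx)
      have hgx := hg x hx
      have h2 : 2 ≤ g x := by
        by_contra hlt
        have h01 : g x = 0 ∨ g x = 1 := by omega
        rcases h01 with h | h
        · rw [h, hf.zero] at hgx; omega
        · rw [h, hf.one] at hgx; omega
      rcases hf.edge (g x) h2 (hgN x hx) with h | h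
      · rw [← h, hgx]; exact Finset.mem_union_left _ hx
      · rw [hgx] at h
        exact hK x (.inr hx) _ h2 (hgN x hx) h
  have hinj : Set.InjOn g R := by
    intro x hx x' hx' he
    rw [← hg x hx, ← hg x' hx', he]
  have h1 := Finset.card_le_card hsub
  rw [Finset.card_union_of_disjoint hdisj, Finset.card_image_of_injOn hinj] at h1
  have h2 := Finset.card_union_le R K
  change S.card ≤ K.card
  omega

/-- Strong duality: let `W` be a set of vertices, and `Y` a set containing `W` except possibly `0`
whose members have their predecessors in `W`. Then `Y \ W` has at most as many elements as there
are paths. -/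
theorem Flow.card_le_value (hf : Flow N A pred) (W Y : Finset ℕ)
    (hWY : W.erase 0 ⊆ Y) (hY : Y ⊆ Finset.Ico 2 N) (hp : ∀ y ∈ Y, pred y ∈ W) :
    (Y \ W).card ≤ flowValue N pred := by
  have h1 : (Y.filter fun y => pred y = 0).card ≤ flowValue N pred :=
    Finset.card_le_card (Finset.filter_subset_filter _ hY)
  have h2 : (Y.filter fun y => ¬ pred y = 0).card ≤ (W.erase 0).card := by
    refine Finset.card_le_card_of_injOn pred ?_ ?_
    · intro y hy
      obtain ⟨hy, hy0⟩ := Finset.mem_filter.1 hy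
      exact Finset.mem_erase.2 ⟨hy0, hp y hy⟩
    · intro y hy y' hy' he
      obtain ⟨hy, hy0⟩ := Finset.mem_filter.1 hy
      obtain ⟨hy', -⟩ := Finset.mem_filter.1 hy'
      exact hf.inj y (Finset.mem_Ico.1 (hY hy)).2 y' (Finset.mem_Ico.1 (hY hy')).2 he hy0
  have h3 := Finset.card_filter_add_card_filter_not (s := Y) (fun y => pred y = 0)
  have h4 : Y \ W = Y \ W.erase 0 := by
    ext y
    have : y ∈ Y → y ≠ 0 := fun hy => by have := Finset.mem_Ico.1 (hY hy); omega
    simp only [Finset.mem_sdiff, Finset.mem_erase]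
    tauto
  rw [h4]
  have h5 := Finset.card_sdiff_add_card_eq_card hWY
  omega

/-! ### The search for an augmenting path -/

/-- The search tree: `Q` lists the `T` visited vertices in the order of their discovery, `vis` is
their indicator function, and the visited vertex `x ≠ 0` was discovered from the earlier vertex
`par x` through the vertex `via x`, whose predecessor it is: a new path may enter `via x` from
`par x`, which sets `x` free. -/
structure Tree (N : ℕ) (A : ℕ → ℕ → Prop) (pred vis par via Q : ℕ → ℕ) (T : ℕ) : Prop where
  pos : 0 < T
  head : Q 0 = 0
  lt : ∀ r < T, Q r < N
  inj : ∀ r < T, ∀ r' < T, Q r = Q r' → r = r'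
  vis_le : ∀ x < N, vis x ≤ 1
  vis_iff : ∀ x < N, vis x = 1 ↔ ∃ r < T, Q r = x
  via_lt : ∀ r, 0 < r → r < T → via (Q r) < N
  pred_via : ∀ r, 0 < r → r < T → pred (via (Q r)) = Q r
  par_via : ∀ r, 0 < r → r < T → par (Q r) = via (Q r) ∨ A (par (Q r)) (via (Q r))
  par_mem : ∀ r, 0 < r → r < T → ∃ r' < r, Q r' = par (Q r)

variable {vis par via Q : ℕ → ℕ} {T : ℕ}

theorem Tree.init (hN : 0 < N) {vis Q : ℕ → ℕ} (h0 : ∀ x < N, vis x = if x = 0 then 1 else 0)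
    (hQ : Q 0 = 0) : Tree N A pred vis par via Q 1 where
  pos := one_pos
  head := hQ
  lt r hr := by rw [Nat.lt_one_iff.1 hr, hQ]; exact hN
  inj := by omega
  vis_le x hx := by rw [h0 x hx]; split_ifs <;> omega
  vis_iff x hx := by
    rw [h0 x hx]
    constructor
    · intro h; exact ⟨0, one_pos, by split_ifs at h with h'; rw [hQ, h']⟩
    · rintro ⟨r, hr, hx⟩; rw [Nat.lt_one_iff.1 hr, hQ] at hx; simp [hx.symm]
  via_lt := by omega
  pred_via := by omega
  par_via := by omega
  par_mem := by omega

theorem Tree.card_le (h : Tree N A pred vis par via Q T) : T ≤ N := by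
  have := Finset.card_le_card_of_injOn (s := Finset.range T) (t := Finset.range N) Q
    (fun r hr => by simpa using h.lt r (by simpa using hr))
    (fun r hr r' hr' he => h.inj r (by simpa using hr) r' (by simpa using hr') he)
  simpa using this

/-- The discovery of the vertex `pred y` from the visited vertex `z`. -/
theorem Tree.visit (h : Tree N A pred vis par via Q T) {y z : ℕ} (hy : y < N)
    (hp : pred y < N) (hz : ∃ r < T, Q r = z) (hA : z = y ∨ A z y) (hv : vis (pred y) < 1) :
    Tree N A pred (Function.update vis (pred y) 1) (Function.update par (pred y) z)
      (Function.update via (pred y) y) (Function.update Q T (pred y)) (T + 1) := by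
  have hnew : ∀ r < T, Q r ≠ pred y := fun r hr he => by
    have := (h.vis_iff _ hp).2 ⟨r, hr, he⟩
    omega
  have hQ : ∀ r < T, Function.update Q T (pred y) r = Q r := fun r hr =>
    Function.update_of_ne (by omega) _ _
  have h0 := h.pos
  refine ⟨by omega, by rw [hQ 0 h0, h.head], fun r hr => ?_, fun r hr r' hr' he => ?_,
    fun x hx => ?_, fun x hx => ?_, fun r h1 hr => ?_, fun r h1 hr => ?_, fun r h1 hr => ?_,
    fun r h1 hr => ?_⟩
  · rcases Nat.lt_succ_iff_lt_or_eq.1 hr with hr | rfl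
    · rw [hQ r hr]; exact h.lt r hr
    · simpa using hp
  · rcases Nat.lt_succ_iff_lt_or_eq.1 hr with hr | rfl <;>
      rcases Nat.lt_succ_iff_lt_or_eq.1 hr' with hr' | rfl
    · rw [hQ r hr, hQ r' hr'] at he; exact h.inj r hr r' hr' he
    · rw [hQ r hr, Function.update_self] at he; exact absurd he (hnew r hr)
    · rw [hQ r' hr', Function.update_self] at he; exact absurd he.symm (hnew r' hr')
    · rfl
  · by_cases e : x = pred y
    · simp [e]
    · simpa [e] using h.vis_le x hx
  · by_cases e : x = pred y
    · subst e; simp only [Function.update_self, true_iff]; exact ⟨T, by omega, by simp⟩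
    · rw [Function.update_of_ne e, h.vis_iff x hx]
      constructor
      · rintro ⟨r, hr, rfl⟩; exact ⟨r, by omega, hQ r hr⟩
      · rintro ⟨r, hr, he⟩
        rcases Nat.lt_succ_iff_lt_or_eq.1 hr with hr | rfl
        · exact ⟨r, hr, by rw [← he, hQ r hr]⟩
        · rw [Function.update_self] at he; exact absurd he.symm e
  all_goals rcases Nat.lt_succ_iff_lt_or_eq.1 hr with hr | rfl
  · rw [hQ r hr, Function.update_of_ne (hnew r hr)]; exact h.via_lt r h1 hr
  · simpa using hy
  · rw [hQ r hr, Function.update_of_ne (hnew r hr)]; exact h.pred_via r h1 hr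
  · simp
  · rw [hQ r hr, Function.update_of_ne (hnew r hr), Function.update_of_ne (hnew r hr)]
    exact h.par_via r h1 hr
  · simpa using hA
  · rw [hQ r hr, Function.update_of_ne (hnew r hr)]
    obtain ⟨r', hr', he⟩ := h.par_mem r h1 hr
    exact ⟨r', hr', by rw [hQ r' (by omega), he]⟩
  · obtain ⟨r', hr', he⟩ := hz
    exact ⟨r', hr', by rw [hQ r' hr', he]; simp⟩

/-! ### Augmentation along a path of the search tree -/

/-- The state of the augmentation of `pred₀` that has still to follow the search tree from the
`r`-th visited vertex `z` back to `0`. -/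
structure Augment (N : ℕ) (A : ℕ → ℕ → Prop) (pred₀ via Q pred : ℕ → ℕ) (z r : ℕ) : Prop where
  eq : Q r = z
  ne_one : ∀ r' ≤ r, Q r' ≠ 1
  chain : ∀ r', 0 < r' → r' ≤ r → pred (via (Q r')) = Q r'
  hole : z ≠ 0 → HoleFlow N A pred (via z) (flowValue N pred₀)
  done : z = 0 → Flow N A pred ∧ flowValue N pred = flowValue N pred₀ + 1

theorem Tree.augment_init (h : Tree N A pred vis par via Q T) (hf : Flow N A pred) (hN : 1 < N)
    (h01 : ¬ A 0 1) (hv : vis 1 = 1) :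
    ∃ r < T, Augment N A pred via Q pred (par 1) r := by
  obtain ⟨R, hR, hQ⟩ := (h.vis_iff 1 hN).1 hv
  have hR0 : 0 < R := by
    rcases Nat.eq_zero_or_pos R with rfl | h'
    · rw [h.head] at hQ; omega
    · exact h'
  have hvia : via 1 = 1 := by
    have := h.pred_via R hR0 hR
    rw [hQ] at this
    exact hf.inj _ (hQ ▸ h.via_lt R hR0 hR) 1 hN (by rw [this, hf.one]) (by omega)
  obtain ⟨r, hr, hQr⟩ := h.par_mem R hR0 hR
  rw [hQ] at hQr
  have hne : ∀ r' ≤ r, Q r' ≠ 1 := fun r' hr' he => by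
    have := h.inj r' (by omega) R hR (by rw [he, hQ])
    omega
  have hA : A (par 1) 1 := by
    have := h.par_via R hR0 hR
    rw [hQ, hvia] at this
    exact this.resolve_left fun he => hne r le_rfl (by rw [hQr, he])
  refine ⟨r, by omega, hQr, hne, fun r' h0 hr' => h.pred_via r' h0 (by omega), fun hz => ?_,
    fun hz => absurd (hz ▸ hA) h01⟩
  refine hf.open_hole hz ?_ hA
  rcases Nat.eq_zero_or_pos r with rfl | h0
  · rw [h.head] at hQr; exact absurd hQr.symm hz
  · have := h.pred_via r h0 (by omega)
    rwa [hQr] at this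

theorem Tree.augment_step {pred₀ : ℕ → ℕ} (h : Tree N A pred₀ vis par via Q T) {z r : ℕ}
    (hr : r < T) (ha : Augment N A pred₀ via Q pred z r) (hz : z ≠ 0) :
    ∃ r' < r, Augment N A pred₀ via Q (Function.update pred (via z) (par z)) (par z) r' := by
  have hr0 : 0 < r := by
    rcases Nat.eq_zero_or_pos r with rfl | h'
    · exact absurd (ha.eq.symm.trans h.head) hz
    · exact h'
  obtain ⟨r', hr', hQ'⟩ := h.par_mem r hr0 hr
  rw [ha.eq] at hQ'
  have hf := ha.hole hz
  have hp : pred (via z) = z := by simpa [ha.eq] using ha.chain r hr0 le_rfl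
  have hN : via z < N := by simpa [ha.eq] using h.via_lt r hr0 hr
  have hA : par z = via z ∨ A (par z) (via z) := by simpa [ha.eq] using h.par_via r hr0 hr
  have hz1 : z ≠ 1 := ha.eq ▸ ha.ne_one r le_rfl
  have h2 : 2 ≤ via z := by
    by_contra hlt
    have h01 : via z = 0 ∨ via z = 1 := by omega
    rcases h01 with h | h
    · rw [h, hf.zero] at hp; exact hz hp.symm
    · rw [h, hf.one] at hp; exact hz1 hp.symm
  have hne : ∀ r'', 0 < r'' → r'' ≤ r' → via (Q r'') ≠ via z := by
    intro r'' h0 hr'' he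
    have h1 := ha.chain r'' h0 (by omega)
    rw [he, hp, ← ha.eq] at h1
    have := h.inj r hr r'' (by omega) h1
    omega
  refine ⟨r', hr', hQ', fun s hs => ha.ne_one s (by omega), fun s h0 hs => ?_, fun hx => ?_,
    fun hx => ?_⟩
  · rw [Function.update_of_ne (hne s h0 hs)]
    exact ha.chain s h0 (by omega)
  · have hr'0 : 0 < r' := by
      rcases Nat.eq_zero_or_pos r' with rfl | h'
      · exact absurd (hQ'.symm.trans h.head) hx
      · exact h'
    refine hf.move (hQ' ▸ h.lt r' (by omega)) hA h2 hN ?_ ?_ ?_ hx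
    · rw [← hQ']; exact hne r' hr'0 le_rfl
    · rw [← hQ']; exact h.via_lt r' hr'0 (by omega)
    · rw [← hQ']; exact ha.chain r' hr'0 (by omega)
  · rw [hx] at hA ⊢
    exact hf.close (hA.resolve_left (by omega)) h2 hN

end

/-! ### Scanning the edges of a network of copies -/

section

/-- A network whose vertices `0, …, N-1` are copies of the vertices `0, …, n-1` of a graph with the
`M` directed edges `src e → dst e` of weight `w e`. The vertex `x` is a copy of `own x`, of level
`val x`; the copies of `v` that paths may enter are `base v, …, lim v - 1`. -/
structure Net where
  n : ℕ
  N : ℕ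
  M : ℕ
  src : ℕ → ℕ
  dst : ℕ → ℕ
  own : ℕ → ℕ
  base : ℕ → ℕ
  lim : ℕ → ℕ
  w : ℕ → ℝ
  val : ℕ → ℝ

namespace Net

/-- Two copies are joined if their levels sum up to less than the weight of an edge. -/
def Adj (C : Net) (x y : ℕ) : Prop :=
  ∃ e < C.M, C.src e = C.own x ∧ C.dst e = C.own y ∧ C.val x + C.val y < C.w e

/-- Vertex `0` is the source, which paths may not enter, and vertex `1` is the sink; levels increase
along the copies of each vertex. -/
structure Valid (C : Net) : Prop where
  two_le : 2 ≤ C.n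
  n_le : C.n ≤ C.N
  dst_lt : ∀ e < C.M, C.dst e < C.n
  own_lt : ∀ y < C.N, C.own y < C.n
  base_le : ∀ y < C.N, 0 < y → C.base (C.own y) ≤ y
  lt_lim : ∀ y < C.N, 0 < y → y < C.lim (C.own y)
  block : ∀ v < C.n, ∀ y, C.base v ≤ y → y < C.lim v → 0 < y ∧ y < C.N ∧ C.own y = v
  base_le_lim : ∀ v < C.n, C.base v ≤ C.lim v
  mono : ∀ v < C.n, ∀ y y', C.base v ≤ y → y ≤ y' → y' < C.lim v → C.val y ≤ C.val y'

/-- The edge `e` leads from the vertex `x` to no further copy. -/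
def Blocked (C : Net) (nxt : ℕ → ℕ) (x e : ℕ) : Prop :=
  nxt (C.dst e) = C.lim (C.dst e) ∨ C.w e ≤ C.val x + C.val (nxt (C.dst e))

end Net

/-- The state of the search: the first `q` of the `T` visited vertices have been taken from the
queue `Q`; the last of them, `z`, is being scanned, and its edges before `e` have been scanned. Of
every vertex `v` the copies before `nxt v` have been entered. -/
structure Scan (C : Net) (pred vis Q nxt : ℕ → ℕ) (q T z e : ℕ) : Prop where
  q_le : q ≤ T
  e_le : e ≤ C.M
  base_le : ∀ v < C.n, C.base v ≤ nxt v
  le_lim : ∀ v < C.n, nxt v ≤ C.lim v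
  reached : ∀ v < C.n, ∀ y, C.base v ≤ y → y < nxt v → vis (pred y) = 1
  pos : e < C.M → 0 < q
  cur : 0 < q → Q (q - 1) = z
  self : ∀ r < q, vis (pred (Q r)) = 1
  scanned : ∀ r < q, ∀ e' < C.M, C.src e' = C.own (Q r) →
    (r + 1 = q ∧ e ≤ e') ∨ C.Blocked nxt (Q r) e'

variable {C : Net} {pred vis par via Q nxt : ℕ → ℕ} {q T z e : ℕ}

theorem Scan.init (hC : C.Valid) (hn : ∀ v < C.n, nxt v = C.base v) {z : ℕ} :
    Scan C pred vis Q nxt 0 1 z C.M where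
  q_le := by omega
  e_le := le_rfl
  base_le v hv := (hn v hv).ge
  le_lim v hv := (hn v hv).le.trans (hC.base_le_lim v hv)
  reached v hv y h h' := by rw [hn v hv] at h'; omega
  pos := by omega
  cur := by omega
  self := by omega
  scanned := by omega

theorem Scan.mono (h : Scan C pred vis Q nxt q T z e) {vis' Q' : ℕ → ℕ} {T' : ℕ}
    (hv : ∀ x, vis x = 1 → vis' x = 1) (hQ : ∀ r < T, Q' r = Q r) (hT : T ≤ T') :
    Scan C pred vis' Q' nxt q T' z e where
  q_le := h.q_le.trans hT
  e_le := h.e_le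
  base_le := h.base_le
  le_lim := h.le_lim
  reached v hv' y hy hy' := hv _ (h.reached v hv' y hy hy')
  pos := h.pos
  cur hq := by rw [hQ _ (by have := h.q_le; omega)]; exact h.cur hq
  self r hr := by rw [hQ _ (hr.trans_le h.q_le)]; exact hv _ (h.self r hr)
  scanned r hr := by rw [hQ _ (hr.trans_le h.q_le)]; exact h.scanned r hr

theorem Scan.next_edge (h : Scan C pred vis Q nxt q T z e) (he : e < C.M)
    (hb : C.src e = C.own z → C.Blocked nxt z e) : Scan C pred vis Q nxt q T z (e + 1) where
  q_le := h.q_le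
  e_le := he
  base_le := h.base_le
  le_lim := h.le_lim
  reached := h.reached
  pos _ := h.pos he
  cur := h.cur
  self := h.self
  scanned r hr e' he' hs := by
    rcases h.scanned r hr e' he' hs with ⟨h1, h2⟩ | h1
    · rcases h2.eq_or_lt with rfl | h2
      · have hz : Q r = z := by rw [← h.cur (by omega), ← h1]; rfl
        exact .inr (hz ▸ hb (hz ▸ hs))
      · exact .inl ⟨h1, h2⟩
    · exact .inr h1

theorem Scan.advance (hC : C.Valid) (h : Scan C pred vis Q nxt q T z e) (he : e < C.M)
    (hl : nxt (C.dst e) < C.lim (C.dst e)) (hv : vis (pred (nxt (C.dst e))) = 1) :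
    Scan C pred vis Q (Function.update nxt (C.dst e) (nxt (C.dst e) + 1)) q T z e where
  q_le := h.q_le
  e_le := h.e_le
  base_le v hv := by
    by_cases hve : v = C.dst e
    · subst hve; rw [Function.update_self]; have := h.base_le _ hv; omega
    · rw [Function.update_of_ne hve]; exact h.base_le v hv
  le_lim v hv := by
    by_cases hve : v = C.dst e
    · subst hve; rw [Function.update_self]; exact hl
    · rw [Function.update_of_ne hve]; exact h.le_lim v hv
  reached v hv' y hy hy' := by
    by_cases hve : v = C.dst e
    · subst hve
      rw [Function.update_self] at hy'
      rcases Nat.lt_succ_iff_lt_or_eq.1 hy' with h' | rfl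
      · exact h.reached _ hv' y hy h'
      · exact hv
    · rw [Function.update_of_ne hve] at hy'; exact h.reached v hv' y hy hy'
  pos := h.pos
  cur := h.cur
  self := h.self
  scanned r hr e' he' hs := by
    refine (h.scanned r hr e' he' hs).imp_right fun h1 => ?_
    by_cases hve : C.dst e' = C.dst e
    · unfold Net.Blocked at h1 ⊢
      rw [hve] at h1 ⊢
      rw [Function.update_self]
      rcases h1 with h1 | h1
      · omega
      · -- Levels increase along the copies of a vertex, so the edge stays blocked.
        rcases Nat.lt_or_ge (nxt (C.dst e) + 1) (C.lim (C.dst e)) with h2 | h2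
        · have := hC.mono _ (hC.dst_lt e he) _ _ (h.base_le _ (hC.dst_lt e he))
            (Nat.le_succ _) h2
          exact .inr (by linarith)
        · exact .inl (by omega)
    · unfold Net.Blocked at h1 ⊢
      rwa [Function.update_of_ne hve]

theorem Scan.dequeue (h : Scan C pred vis Q nxt q T z C.M) (hq : q < T)
    (hv : vis (pred (Q q)) = 1) : Scan C pred vis Q nxt (q + 1) T (Q q) 0 where
  q_le := hq
  e_le := Nat.zero_le _
  base_le := h.base_le
  le_lim := h.le_lim
  reached := h.reached
  pos _ := Nat.succ_pos _
  cur _ := rfl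
  self r hr := by
    rcases Nat.lt_succ_iff_lt_or_eq.1 hr with hr | rfl
    · exact h.self r hr
    · exact hv
  scanned r hr e' he' hs := by
    rcases Nat.lt_succ_iff_lt_or_eq.1 hr with hr | rfl
    · rcases h.scanned r hr e' he' hs with ⟨-, h2⟩ | h2
      · omega
      · exact .inr h2
    · exact .inl ⟨rfl, Nat.zero_le _⟩

/-- The cut found by a search that has not reached the sink: the copies entered but not visited. -/
def cutIds (C : Net) (vis nxt : ℕ → ℕ) : Finset ℕ :=
  (Finset.Ico 2 C.N).filter fun y => vis y < 1 ∧ y < nxt (C.own y)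

/-- After a complete search, the edges of a visited vertex lead to entered copies only. -/
theorem Scan.lt_nxt (hC : C.Valid) (ht : Tree C.N C.Adj pred vis par via Q T)
    (h : Scan C pred vis Q nxt T T z C.M) {x y : ℕ} (hx : x < C.N) (hv : vis x = 1)
    (hy0 : 0 < y) (hy : y < C.N) (hA : C.Adj x y) : y < nxt (C.own y) := by
  obtain ⟨e, he, hs, hd, hw⟩ := hA
  obtain ⟨r, hr, rfl⟩ := (ht.vis_iff x hx).1 hv
  rcases h.scanned r hr e he hs with ⟨-, h1⟩ | h1
  · omega
  · unfold Net.Blocked at h1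
    rw [hd] at h1
    have hov := hC.own_lt y hy
    have hlim := hC.lt_lim y hy hy0
    by_contra hlt
    rcases h1 with h1 | h1
    · omega
    · have := hC.mono _ hov _ _ (h.base_le _ hov) (not_lt.1 hlt) hlim
      linarith

theorem Scan.visited_pred (hC : C.Valid) (h : Scan C pred vis Q nxt q T z e) {y : ℕ}
    (hy0 : 0 < y) (hy : y < C.N) (hn : y < nxt (C.own y)) : vis (pred y) = 1 :=
  h.reached _ (hC.own_lt y hy) y (hC.base_le y hy hy0) hn

theorem card_cutIds_le (hC : C.Valid) (hf : Flow C.N C.Adj pred)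
    (ht : Tree C.N C.Adj pred vis par via Q T) (h : Scan C pred vis Q nxt T T z C.M)
    (h1 : vis 1 ≠ 1) : (cutIds C vis nxt).card ≤ flowValue C.N pred := by
  set W := (Finset.range C.N).filter fun x => vis x = 1 with hW
  set Y := (Finset.Ico 2 C.N).filter (fun y => y < nxt (C.own y)) ∪ W.erase 0 with hY
  have hsub : cutIds C vis nxt ⊆ Y \ W := by
    intro y hy
    simp only [cutIds, Finset.mem_filter, Finset.mem_Ico] at hy
    simp only [hY, hW, Finset.mem_sdiff, Finset.mem_union, Finset.mem_filter, Finset.mem_Ico,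
      Finset.mem_range]
    exact ⟨.inl ⟨hy.1, hy.2.2⟩, fun h => by omega⟩
  refine (Finset.card_le_card hsub).trans (hf.card_le_value W Y Finset.subset_union_right ?_ ?_)
  · refine Finset.union_subset (Finset.filter_subset _ _) fun y hy => ?_
    simp only [hW, Finset.mem_erase, Finset.mem_filter, Finset.mem_range] at hy
    have : y ≠ 1 := by rintro rfl; exact h1 hy.2.2
    simp only [Finset.mem_Ico]
    omega
  · intro y hy
    rcases Finset.mem_union.1 hy with hy | hy
    · simp only [Finset.mem_filter, Finset.mem_Ico] at hy
      simp only [hW, Finset.mem_filter, Finset.mem_range]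
      exact ⟨hf.lt y hy.1.2, h.visited_pred hC (by omega) hy.1.2 hy.2⟩
    · simp only [hW, Finset.mem_erase, Finset.mem_filter, Finset.mem_range] at hy
      obtain ⟨r, hr, rfl⟩ := (ht.vis_iff y hy.2.1).1 hy.2.2
      simp only [hW, Finset.mem_filter, Finset.mem_range]
      exact ⟨hf.lt _ hy.2.1, h.self r hr⟩

/-! ### The network of an instance -/

/-- The number of a vertex of the discretized graph in the network. -/
def vid {k c : ℕ} : Vert (Fin k × Fin c) → ℕ
  | Vert.s => 0
  | Vert.t => 1
  | Vert.inner x => 2 + (x.1 * c + x.2)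

theorem vid_inner_lt {k c : ℕ} (x : Fin k × Fin c) : vid (Vert.inner x) < 2 + k * c := by
  have h := (finProdFinEquiv x).2
  rw [finProdFinEquiv_apply_val] at h
  simp only [vid]
  rw [mul_comm (x.1 : ℕ) c]
  omega

theorem vid_lt {k c : ℕ} (x : Vert (Fin k × Fin c)) : vid x < 2 + k * c := by
  rcases x with _ | _ | x
  · simp [vid]
  · simp [vid]; omega
  · exact vid_inner_lt x

theorem exists_vid {k c : ℕ} {y : ℕ} (h2 : 2 ≤ y) (hy : y < 2 + k * c) :
    ∃ x : Fin k × Fin c, vid (Vert.inner x) = y := by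
  refine ⟨finProdFinEquiv.symm ⟨y - 2, by omega⟩, ?_⟩
  have h := congrArg Fin.val (finProdFinEquiv.apply_symm_apply (⟨y - 2, by omega⟩ : Fin (k * c)))
  rw [finProdFinEquiv_apply_val] at h
  simp only [vid]
  rw [mul_comm _ c, add_comm (c * _), h]
  simp only
  omega

theorem vid_injective {k c : ℕ} :
    Function.Injective fun x : Fin k × Fin c => vid (Vert.inner x) := by
  intro x y h
  simp only [vid] at h
  apply finProdFinEquiv.injective
  apply Fin.ext
  rw [finProdFinEquiv_apply_val, finProdFinEquiv_apply_val, mul_comm c, mul_comm c]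
  omega

/-- The network `C` represents the discretized graph of the instance `I` with `c` copies of
level `α`. -/
structure Net.Encodes {k : ℕ} (C : Net) (I : Instance (Fin k)) (α : ℝ) (c : ℕ) : Prop where
  N_eq : C.N = 2 + k * c
  own_eq : ∀ x : Vert (Fin k × Fin c), C.own (vid x) = code (proj x)
  val_eq : ∀ x : Vert (Fin k × Fin c), C.val (vid x) = level α x
  edge : ∀ e < C.M, ∃ x y, I.graph.Adj x y ∧ C.src e = code x ∧ C.dst e = code y ∧
    C.w e = I.weight s(x, y)
  exists_edge : ∀ x y, I.graph.Adj x y → ∃ e < C.M, C.src e = code x ∧ C.dst e = code y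

theorem code_injective {k : ℕ} : Function.Injective (code : Vert (Fin k) → ℕ) := by
  rintro (_ | _ | x) (_ | _ | y) h <;> simp only [code] at h <;> first | rfl | omega | skip
  congr 1
  exact Fin.ext (by omega)

section
variable {k : ℕ} {I : Instance (Fin k)} {ε : ℝ}

theorem Net.Encodes.adj_iff (hE : C.Encodes I (unit I ε) (copies (Fin k) ε))
    (h : ∃ p, Feasible I p) (x y : Vert (Fin k × Fin (copies (Fin k) ε))) :
    C.Adj (vid x) (vid y) ↔ (discreteGraph I ε).Adj x y := by
  rw [discreteGraph_adj h]
  unfold Net.Adj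
  simp only [hE.own_eq, hE.val_eq]
  constructor
  · rintro ⟨e, he, hs, hd, hw⟩
    obtain ⟨a, b, hab, h1, h2, h3⟩ := hE.edge e he
    have ha : a = proj x := code_injective (h1.symm.trans hs)
    have hb : b = proj y := code_injective (h2.symm.trans hd)
    rw [h3, ha, hb] at hw
    exact ⟨ha ▸ hb ▸ hab, hw⟩
  · rintro ⟨hA, hw⟩
    obtain ⟨e, he, hs, hd⟩ := hE.exists_edge _ _ hA
    refine ⟨e, he, hs, hd, ?_⟩
    obtain ⟨a, b, hab, h1, h2, h3⟩ := hE.edge e he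
    have ha : a = proj x := code_injective (h1.symm.trans hs)
    have hb : b = proj y := code_injective (h2.symm.trans hd)
    rwa [h3, ha, hb]

theorem Net.Encodes.not_adj_zero_one (hE : C.Encodes I (unit I ε) (copies (Fin k) ε))
    (h : ∃ p, Feasible I p) : ¬ C.Adj 0 1 := by
  have := hE.adj_iff h Vert.s Vert.t
  simp only [vid] at this
  rw [this]
  exact fun h => h

/-- Weak duality in terms of the discretized graph. -/
theorem Net.Encodes.value_le (hE : C.Encodes I (unit I ε) (copies (Fin k) ε))
    (h : ∃ p, Feasible I p) (hf : Flow C.N C.Adj pred)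
    {K : Finset (Fin k × Fin (copies (Fin k) ε))} (hK : IsVertexCut (discreteGraph I ε) K) :
    flowValue C.N pred ≤ K.card := by
  classical
  obtain ⟨R, hs, ht, -, hR⟩ := hK.exists_closed
  have hmem : ∀ x, x = 0 ∨ x ∈ ((Finset.univ.filter fun x => Vert.inner x ∈ R).image
      fun x => vid (Vert.inner x)) → ∃ x' ∈ R, vid x' = x := by
    rintro x (rfl | hx)
    · exact ⟨_, hs, rfl⟩
    · obtain ⟨x', hx', rfl⟩ := Finset.mem_image.1 hx
      exact ⟨_, (Finset.mem_filter.1 hx').2, rfl⟩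
  refine (hf.value_le ((Finset.univ.filter fun x => Vert.inner x ∈ R).image
    fun x => vid (Vert.inner x)) (K.image fun x => vid (Vert.inner x)) ?_ ?_ ?_).trans
    Finset.card_image_le
  · intro y hy
    obtain ⟨x, -, rfl⟩ := Finset.mem_image.1 hy
    rw [Finset.mem_Ico, hE.N_eq]
    exact ⟨by simp [vid], vid_inner_lt x⟩
  · intro x hx y h2 hy hA
    obtain ⟨x', hx', rfl⟩ := hmem x hx
    obtain ⟨y', rfl⟩ := exists_vid h2 (hE.N_eq ▸ hy)
    rw [hE.adj_iff h] at hA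
    rcases hR _ hx' _ hA with h3 | ⟨z, hz, h3⟩
    · exact Finset.mem_union_left _ (Finset.mem_image.2 ⟨y', by simpa using h3, rfl⟩)
    · cases h3
      exact Finset.mem_union_right _ (Finset.mem_image.2 ⟨_, hz, rfl⟩)
  · intro x hx hA
    obtain ⟨x', hx', rfl⟩ := hmem x (.inr hx)
    have hA' := (hE.adj_iff h x' Vert.t).1 hA
    rcases hR _ hx' _ hA' with h3 | ⟨z, hz, h3⟩
    · exact ht h3
    · cases h3

/-- A complete search that has not reached the sink yields a minimum vertex cut. -/
theorem Net.Encodes.isMinVertexCut (hE : C.Encodes I (unit I ε) (copies (Fin k) ε))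
    (hC : C.Valid) (h : ∃ p, Feasible I p) (hf : Flow C.N C.Adj pred)
    (ht : Tree C.N C.Adj pred vis par via Q T) (hS : Scan C pred vis Q nxt T T z C.M)
    (h1 : vis 1 ≠ 1) : IsMinVertexCut (discreteGraph I ε)
      (Finset.univ.filter fun x => vid (Vert.inner x) ∈ cutIds C vis nxt) := by
  have hlt : ∀ x : Vert (Fin k × Fin (copies (Fin k) ε)), vid x < C.N := fun x =>
    hE.N_eq ▸ vid_lt x
  refine ⟨isVertexCut_of_closed {x | vis (vid x) = 1} ?_ h1 ?_, fun K' hK' => ?_⟩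
  · exact (ht.vis_iff 0 (hlt Vert.s)).2 ⟨0, ht.pos, ht.head⟩
  · intro x hx y hxy
    rw [← hE.adj_iff h] at hxy
    have key : 0 < vid y → vid y < nxt (C.own (vid y)) := fun h0 =>
      hS.lt_nxt hC ht (hlt x) hx h0 (hlt y) hxy
    rcases y with _ | _ | y
    · exact .inl ((ht.vis_iff 0 (hlt Vert.s)).2 ⟨0, ht.pos, ht.head⟩)
    · have h2 := hS.visited_pred hC one_pos (hlt Vert.t) (key one_pos)
      rw [hf.one] at h2
      exact absurd h2 h1
    · by_cases hv : vis (vid (Vert.inner y)) = 1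
      · exact .inl hv
      · refine .inr ⟨y, ?_, rfl⟩
        simp only [cutIds, Finset.mem_filter, Finset.mem_univ, true_and, Finset.mem_Ico]
        have h2 : 2 ≤ vid (Vert.inner y) := by simp [vid]
        have := ht.vis_le _ (hlt (Vert.inner y))
        exact ⟨⟨h2, hlt _⟩, by omega, key (by omega)⟩
  · refine le_trans ?_ ((card_cutIds_le hC hf ht hS h1).trans (hE.value_le h hf hK'))
    exact Finset.card_le_card_of_injOn (fun x => vid (Vert.inner x)) (fun x hx => by simpa using hx)
      vid_injective.injOn

/-- The power of `v` counts the numbers in the cut that belong to copies of `v`. -/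
theorem Net.Encodes.cutPowers_eq (hE : C.Encodes I (unit I ε) (copies (Fin k) ε)) (v : Fin k) :
    cutPowers I ε (Finset.univ.filter fun x => vid (Vert.inner x) ∈ cutIds C vis nxt) v =
      ((cutIds C vis nxt).filter fun y => C.own y = v + 2).card * unit I ε := by
  unfold cutPowers
  congr 2
  rw [← Set.ncard_coe_finset]
  refine Set.ncard_congr (fun j _ => vid (Vert.inner (v, j))) ?_ ?_ ?_
  · intro j hj
    simp only [Finset.mem_filter, Finset.mem_univ, true_and, Set.mem_ofPred_eq] at hj
    simp [hj, hE.own_eq, proj, code]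
  · intro a b _ _ hab
    simpa using vid_injective hab
  · intro y hy
    simp only [Finset.coe_filter, Set.mem_ofPred_eq] at hy
    obtain ⟨hy1, hy2⟩ := hy
    have hy3 := hy1
    simp only [cutIds, Finset.mem_filter, Finset.mem_Ico] at hy3
    obtain ⟨⟨a, j⟩, rfl⟩ := exists_vid hy3.1.1 (hE.N_eq ▸ hy3.1.2)
    rw [hE.own_eq] at hy2
    simp only [proj, code, add_left_inj] at hy2
    have : a = v := Fin.ext hy2
    subst this
    exact ⟨j, by simpa using hy1, rfl⟩

end

end

/-! ### Reading the input -/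

section

open Cmd Instr

/-! The program uses its memory as follows, for the network of the copies described by `Net` and the
search described by `Tree` and `Scan`; the remaining registers hold intermediate results.

* Natural number registers: `0` the number `n` of vertices, `1` the number of edges, `2`, `3`, `4` the
  constants `0`, `1`, `2`, `5` the number of directed edges, `6` the number of copies, `7` the number
  of vertices of the network, `8` a loop counter or the edge being scanned, `12` whether to search
  again, `13` and `14` the start and the end of the queue, `15` the current vertex of the search or of
  the augmentation, `16` whether the search is going on.
* Arrays of natural numbers: `0` and `1` the endpoints of the edges, `2` `base`, `3` `lim`, `4` `own`,
  `5` `nxt`, `6` `vis`, `7` `pred`, `8` `par`, `9` `via`, `10` the queue.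
* Real registers: `0` the accuracy `ε`, `1` the power `α` of a copy, `2`, `3`, `9` the constants `0`,
  `1`, `2`, `4` the bottleneck optimum.
* Arrays of real numbers: `0` the weights, `1` the output, `2` the bottleneck values of the edges,
  `3` the levels of the copies, `4` the widths. -/

/-- The bottleneck value of an edge `(a, b)` of weight `w`: the least uniform power that removes the
edge. The terminals, which have no power, are the vertices `0` and `1`. -/
noncomputable def halfWeight (a b : ℕ) (w : ℝ) : ℝ :=
  if a < 2 then w else if b < 2 then w else w / 2

theorem halfWeight_comm (a b : ℕ) (w : ℝ) : halfWeight a b w = halfWeight b a w := by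
  unfold halfWeight
  split_ifs <;> rfl

theorem halfWeight_nonneg {a b : ℕ} {w : ℝ} (hw : 0 ≤ w) : 0 ≤ halfWeight a b w := by
  unfold halfWeight
  split_ifs <;> positivity

/-- One edge: stores its reverse, and its bottleneck value for both directions. -/
def prepareBody : Cmd := block [
  op (natLoad 10 0 8), op (natLoad 11 1 8), op (realLoad 6 0 8),
  op (natStore 0 9 11), op (natStore 1 9 10), op (realStore 0 9 6),
  cond (.natLt 10 4) skip (cond (.natLt 11 4) skip (op (realDiv 6 6 9))),
  op (realStore 2 8 6), op (realStore 2 9 6), op (realAdd 5 5 6),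
  op (natAdd 8 8 3), op (natAdd 9 9 3)]

/-- Adds the reversed edges to the edge list, and computes the bottleneck values of the edges. The
widths of all vertices but the source are `0`; that of the source exceeds all bottleneck values. -/
def prepare : Cmd := block [
  block [op (natConst 3 1), op (natConst 4 2), op (natAdd 5 1 1), op (realConst 3 1),
    op (realConst 9 2), op (realConst 5 1), op (natAdd 9 1 2)],
  loop (.natLt 8 1) prepareBody,
  op (realStore 4 2 5)]

/-- The registers that hold constants. -/
structure Consts (m : Mem) : Prop where
  n2 : m.nreg 2 = 0
  n3 : m.nreg 3 = 1
  n4 : m.nreg 4 = 2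
  r2 : m.rreg 2 = 0
  r3 : m.rreg 3 = 1

/-- Of the `l` edges, with endpoints `S e`, `D e` and weights `W e`, those before `i` are prepared: their
reverses are stored `l` places after them, and their bottleneck values are known. -/
structure Prepared (S D : ℕ → ℕ) (W : ℕ → ℝ) (l i : ℕ) (m : Mem) : Prop where
  src : ∀ e < l, m.narr 0 e = S e
  dst : ∀ e < l, m.narr 1 e = D e
  w : ∀ e < l, m.rarr 0 e = W e
  half : ∀ e < i, m.rarr 2 e = halfWeight (S e) (D e) (W e)
  src' : ∀ e < i, m.narr 0 (e + l) = D e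
  dst' : ∀ e < i, m.narr 1 (e + l) = S e
  w' : ∀ e < i, m.rarr 0 (e + l) = W e
  half' : ∀ e < i, m.rarr 2 (e + l) = halfWeight (S e) (D e) (W e)

theorem prepareBody_spec {S D : ℕ → ℕ} {W : ℕ → ℝ} {l i : ℕ} {m : Mem} (h3 : m.nreg 3 = 1)
    (h4 : m.nreg 4 = 2) (h9 : m.rreg 9 = 2) (hi : i < l) (hi8 : m.nreg 8 = i)
    (hi9 : m.nreg 9 = i + l) (h : Prepared S D W l i m) :
    Prepared S D W l (i + 1) (prepareBody.eval m) ∧ (prepareBody.eval m).nreg 8 = i + 1 ∧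
      (prepareBody.eval m).nreg 9 = i + 1 + l ∧
      (prepareBody.eval m).rreg 5 = m.rreg 5 + halfWeight (S i) (D i) (W i) := by
  have e1 := h.src i hi
  have e2 := h.dst i hi
  have e3 := h.w i hi
  have key : (prepareBody.eval m).narr 0 = Function.update (m.narr 0) (i + l) (D i) ∧
      (prepareBody.eval m).narr 1 = Function.update (m.narr 1) (i + l) (S i) ∧
      (prepareBody.eval m).rarr 0 = Function.update (m.rarr 0) (i + l) (W i) ∧
      (prepareBody.eval m).rarr 2 = Function.update (Function.update (m.rarr 2) i
        (halfWeight (S i) (D i) (W i))) (i + l) (halfWeight (S i) (D i) (W i)) ∧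
      (prepareBody.eval m).nreg 8 = i + 1 ∧ (prepareBody.eval m).nreg 9 = i + 1 + l ∧
      (prepareBody.eval m).rreg 5 = m.rreg 5 + halfWeight (S i) (D i) (W i) := by
    unfold halfWeight
    by_cases ha : S i < 2
    · simp [prepareBody, block, eval, Cond.holds, after_natLoad, after_natStore, after_realLoad,
        after_realStore, after_natAdd, after_realAdd, h3, h4, hi8, hi9, e1, e2, e3, ha]
      omega
    · by_cases hb : D i < 2 <;>
      · simp [prepareBody, block, eval, Cond.holds, after_natLoad, after_natStore, after_realLoad,
          after_realStore, after_natAdd, after_realAdd, after_realDiv, h3, h4, h9, hi8, hi9, e1,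
          e2, e3, ha, hb]
        omega
  obtain ⟨k1, k2, k3, k4, k5, k6, k7⟩ := key
  refine ⟨⟨?_, ?_, ?_, ?_, ?_, ?_, ?_, ?_⟩, k5, k6, k7⟩ <;> intro e he <;>
    simp only [k1, k2, k3, k4, Function.update_apply]
  · rw [if_neg (by omega)]; exact h.src e he
  · rw [if_neg (by omega)]; exact h.dst e he
  · rw [if_neg (by omega)]; exact h.w e he
  · rw [if_neg (by omega)]
    split_ifs with h'
    · rw [h']
    · exact h.half e (by omega)
  all_goals split_ifs with h'
  · rw [show e = i by omega]
  · exact h.src' e (by omega)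
  · rw [show e = i by omega]
  · exact h.dst' e (by omega)
  · rw [show e = i by omega]
  · exact h.w' e (by omega)
  · rw [show e = i by omega]
  · omega
  · exact h.half' e (by omega)

theorem prepare_spec {l : ℕ} {m : Mem} (hl : m.nreg 1 = l) (h2 : m.nreg 2 = 0)
    (h8 : m.nreg 8 = 0) (hr2 : m.rreg 2 = 0) (hW : ∀ e < l, 0 ≤ m.rarr 0 e)
    (h4 : m.rarr 4 = fun _ => 0) :
    Ex prepare m (30 * l + 30) (fun m' => Frame prepare m m' ∧ Consts m' ∧ m'.nreg 5 = l + l ∧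
      Prepared (m.narr 0) (m.narr 1) (m.rarr 0) l l m' ∧ ∃ b : ℝ, 0 < b ∧
      m'.rarr 4 = Function.update (fun _ => 0) 0 b ∧
      ∀ e < l, halfWeight (m.narr 0 e) (m.narr 1 e) (m.rarr 0 e) < b) := by
  refine Ex.frame (Ex.mono (Ex.seq (Ex.of_eval (c := block _) rfl (Q := fun m₁ => Consts m₁ ∧
    m₁.rreg 9 = 2 ∧ m₁.nreg 5 = l + l ∧ m₁.rreg 5 = 1 ∧ m₁.nreg 9 = l ∧ m₁.nreg 8 = 0 ∧
    m₁.nreg 1 = l ∧ m₁.narr = m.narr ∧ m₁.rarr = m.rarr) ?_) (T' := 30 * l + 20) ?_) ?_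
    fun _ h => h)
  · simp only [block, eval, after_natConst, after_natAdd, after_realConst]
    refine ⟨⟨?_, ?_, ?_, ?_, ?_⟩, ?_⟩ <;> simp [h2, hr2, hl, h8]
  · rintro m₁ ⟨hc, hr9, h5, hr5, h9, h8, h1, hn, hr⟩
    refine Ex.mono (Ex.seq (Ex.loop (T := prepareBody.time) (k₀ := l) (fun m' j => ∃ i, i + j = l ∧
      m'.nreg 8 = i ∧ m'.nreg 9 = i + l ∧ Prepared (m.narr 0) (m.narr 1) (m.rarr 0) l i m' ∧
      0 < m'.rreg 5 ∧ ∀ e < i, halfWeight (m.narr 0 e) (m.narr 1 e) (m.rarr 0 e) < m'.rreg 5)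
      ⟨0, by omega, h8, by omega, ?_, by rw [hr5]; exact one_pos, by omega⟩ ?_
      (Q := fun m' => Consts m' ∧ m'.nreg 5 = l + l ∧
        Prepared (m.narr 0) (m.narr 1) (m.rarr 0) l l m' ∧ m'.rarr 4 = (fun _ => 0) ∧
        0 < m'.rreg 5 ∧ ∀ e < l, halfWeight (m.narr 0 e) (m.narr 1 e) (m.rarr 0 e) < m'.rreg 5)
      ?_) (T' := 1) ?_) ?_ fun _ h => h
    · constructor <;> intro e he <;> first | omega | simp [hn, hr]
    · rintro m₂ j hF ⟨i, hij, hi8, hi9, hP, hpos, hlt⟩ hb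
      simp only [Cond.holds, hi8, hF.nreg 1 rfl, h1] at hb
      obtain ⟨k1, k2, k3, k4⟩ := prepareBody_spec ((hF.nreg 3 rfl).trans hc.n3)
        ((hF.nreg 4 rfl).trans hc.n4) ((hF.rreg 9 rfl).trans hr9) hb hi8 hi9 hP
      have hnn := halfWeight_nonneg (a := m.narr 0 i) (b := m.narr 1 i) (hW i hb)
      refine Ex.of_eval rfl ⟨j - 1, by omega, i + 1, by omega, k2, k3, k1, ?_, fun e he => ?_⟩
      · rw [k4]; linarith
      · rw [k4]
        rcases Nat.lt_succ_iff_lt_or_eq.1 he with he | rfl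
        · have := hlt e he; linarith
        · linarith
    · rintro m₂ j hF ⟨i, hij, hi8, hi9, hP, hpos, hlt⟩ hb
      simp only [Cond.holds, hi8, hF.nreg 1 rfl, h1] at hb
      obtain rfl : i = l := by omega
      exact ⟨⟨(hF.nreg 2 rfl).trans hc.n2, (hF.nreg 3 rfl).trans hc.n3,
        (hF.nreg 4 rfl).trans hc.n4, (hF.rreg 2 rfl).trans hc.r2, (hF.rreg 3 rfl).trans hc.r3⟩,
        (hF.nreg 5 rfl).trans h5, hP, by rw [hF.rarr 4 rfl, hr, h4], hpos, hlt⟩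
    · rintro m₂ ⟨hc, h5, hP, hr4, hpos, hlt⟩
      refine Ex.of_eval (c := block _) rfl ⟨?_, ?_, ?_, m₂.rreg 5, hpos, ?_, hlt⟩
      · constructor <;> simp [block, eval, after_realStore, hc.n2, hc.n3, hc.n4, hc.r2, hc.r3]
      · simpa [block, eval, after_realStore] using h5
      · constructor <;> simp only [block, eval, after_realStore] <;> intro e he
        · exact hP.src e he
        · exact hP.dst e he
        · simpa using hP.w e he
        · simpa using hP.half e he
        · exact hP.src' e he
        · exact hP.dst' e he
        · simpa using hP.w' e he
        · simpa using hP.half' e he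
      · simp [block, eval, after_realStore, hc.n2, hr4]
    · have : prepareBody.time = 16 := rfl
      rw [this]
      omega
  · have : ∀ a b c d e f g, (block [op a, op b, op c, op d, op e, op f, op g]).time = 7 :=
      fun _ _ _ _ _ _ _ => rfl
    rw [this]
    omega

/-! ### The bottleneck optimum -/

/-- Relaxes one edge; after an increase of a width, the edges are gone through anew. -/
def widestBody : Cmd := block [
  op (natLoad 10 0 8), op (natLoad 11 1 8), op (realLoad 6 2 8),
  op (realLoad 7 4 10), op (realLoad 8 4 11),
  cond (.realLt 7 6) (op (realAdd 6 7 2)) skip,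
  cond (.realLt 8 6) (block [op (realStore 4 11 6), op (natConst 8 0)]) (op (natAdd 8 8 3))]

/-- Computes the widest paths from the source, by relaxing edges until none can be relaxed; the
width of the sink is the bottleneck optimum. -/
def widest : Cmd := block [op (natConst 8 0), loop (.natLt 8 5) widestBody, op (realLoad 4 4 3)]

/-- In the graph with the `M` directed edges `S e → D e` of value `H e`, the set `R` contains the
source, but not the sink, and is closed under the edges of value more than `x`. -/
structure Separates (M : ℕ) (S D : ℕ → ℕ) (H : ℕ → ℝ) (x : ℝ) (R : Set ℕ) : Prop where
  source : 0 ∈ R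
  sink : 1 ∉ R
  closed : ∀ e < M, S e ∈ R → x < H e → D e ∈ R

/-- The invariant of the relaxation: widths never exceed the bottleneck value of any separation,
and they take values in a finite set, so that they can increase only finitely often. -/
structure Widths (M : ℕ) (S D : ℕ → ℕ) (H : ℕ → ℝ) (b : ℝ) (B : ℕ → ℝ) : Prop where
  source : B 0 = b
  nonneg : ∀ v, 0 ≤ B v
  lt : ∀ v, v ≠ 0 → B v < b
  mem : ∀ v, v ≠ 0 → B v ∈ insert 0 ((Finset.range M).image H)
  le : ∀ x, 0 ≤ x → ∀ R, Separates M S D H x R → ∀ v, v ∉ R → B v ≤ x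

/-- The number of increases of widths that are still possible. -/
noncomputable def widthsLeft (n M : ℕ) (H : ℕ → ℝ) (B : ℕ → ℝ) : ℕ :=
  ∑ v ∈ Finset.range n, ((insert 0 ((Finset.range M).image H)).filter fun s => B v < s).card

theorem widthsLeft_le (n M : ℕ) (H : ℕ → ℝ) (B : ℕ → ℝ) : widthsLeft n M H B ≤ n * (M + 1) := by
  unfold widthsLeft
  refine (Finset.sum_le_card_nsmul _ _ (M + 1) fun v _ => ?_).trans (by simp)
  refine (Finset.card_filter_le _ _).trans ((Finset.card_insert_le _ _).trans ?_)
  have := Finset.card_image_le (s := Finset.range M) (f := H)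
  simp at this
  omega

/-- Relaxing an edge preserves the invariant, and uses up one of the possible increases. -/
theorem Widths.relax {n M : ℕ} {S D : ℕ → ℕ} {H : ℕ → ℝ} {b : ℝ} {B : ℕ → ℝ}
    (h : Widths M S D H b B) (hH : ∀ e < M, H e < b) (hD : ∀ e < M, D e < n) {e : ℕ}
    (he : e < M) (hlt : B (D e) < min (B (S e)) (H e)) :
    Widths M S D H b (Function.update B (D e) (min (B (S e)) (H e))) ∧
      widthsLeft n M H (Function.update B (D e) (min (B (S e)) (H e))) < widthsLeft n M H B := by
  have hD0 : D e ≠ 0 := by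
    intro h0
    rw [h0, h.source] at hlt
    exact absurd (hH e he) (not_lt.2 (hlt.le.trans (min_le_right _ _)))
  have hmem : min (B (S e)) (H e) ∈ insert 0 ((Finset.range M).image H) := by
    have hHe : H e ∈ insert 0 ((Finset.range M).image H) :=
      Finset.mem_insert_of_mem (Finset.mem_image_of_mem _ (Finset.mem_range.2 he))
    by_cases hs : S e = 0
    · rw [hs, h.source, min_eq_right (hH e he).le]; exact hHe
    · rcases min_choice (B (S e)) (H e) with h' | h' <;> rw [h']
      · exact h.mem _ hs
      · exact hHe
  refine ⟨⟨?_, fun v => ?_, fun v hv => ?_, fun v hv => ?_, fun x hx R hR v hv => ?_⟩, ?_⟩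
  · rw [Function.update_of_ne hD0.symm, h.source]
  · by_cases hvD : v = D e
    · subst hvD; rw [Function.update_self]; exact (h.nonneg _).trans hlt.le
    · rw [Function.update_of_ne hvD]; exact h.nonneg v
  · by_cases hvD : v = D e
    · subst hvD; rw [Function.update_self]; exact (min_le_right _ _).trans_lt (hH e he)
    · rw [Function.update_of_ne hvD]; exact h.lt v hv
  · by_cases hvD : v = D e
    · subst hvD; rw [Function.update_self]; exact hmem
    · rw [Function.update_of_ne hvD]; exact h.mem v hv
  · by_cases hvD : v = D e
    · subst hvD
      rw [Function.update_self]
      by_cases hs : S e ∈ R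
      · exact (min_le_right _ _).trans (not_lt.1 fun hlt => hv (hR.closed e he hs hlt))
      · exact (min_le_left _ _).trans (h.le x hx R hR _ hs)
    · rw [Function.update_of_ne hvD]; exact h.le x hx R hR v hv
  · unfold widthsLeft
    refine Finset.sum_lt_sum (fun v _ => Finset.card_le_card fun s hs => ?_)
      ⟨D e, Finset.mem_range.2 (hD e he), Finset.card_lt_card ?_⟩
    · rw [Finset.mem_filter] at hs ⊢
      refine ⟨hs.1, ?_⟩
      by_cases hvD : v = D e
      · subst hvD; rw [Function.update_self] at hs; exact hlt.trans hs.2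
      · rw [Function.update_of_ne hvD] at hs; exact hs.2
    · rw [Finset.ssubset_iff_of_subset]
      · refine ⟨min (B (S e)) (H e), Finset.mem_filter.2 ⟨hmem, hlt⟩, fun hs => ?_⟩
        rw [Finset.mem_filter, Function.update_self] at hs
        exact lt_irrefl _ hs.2
      · intro s hs
        rw [Finset.mem_filter] at hs ⊢
        rw [Function.update_self] at hs
        exact ⟨hs.1, hlt.trans hs.2⟩

theorem eval_widestBody {S D : ℕ → ℕ} {H B : ℕ → ℝ} {e : ℕ} {m : Mem} (h3 : m.nreg 3 = 1)
    (hr2 : m.rreg 2 = 0) (h0 : m.narr 0 = S) (h1 : m.narr 1 = D)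
    (hH : m.rarr 2 = H) (hB : m.rarr 4 = B) (h8 : m.nreg 8 = e) :
    (B (D e) < min (B (S e)) (H e) →
      (widestBody.eval m).rarr 4 = Function.update B (D e) (min (B (S e)) (H e)) ∧
      (widestBody.eval m).nreg 8 = 0) ∧
    (¬ B (D e) < min (B (S e)) (H e) →
      (widestBody.eval m).rarr 4 = B ∧ (widestBody.eval m).nreg 8 = e + 1) := by
  rcases lt_or_ge (B (S e)) (H e) with hlt | hge
  · rw [min_eq_left hlt.le]
    by_cases hb : B (D e) < B (S e)
    · simp [widestBody, block, eval, Cond.holds, after_natLoad, after_realLoad, after_realStore,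
        after_realAdd, after_natConst, hr2, h0, h1, hH, hB, h8, hlt, hb]
    · simp [widestBody, block, eval, Cond.holds, after_natLoad, after_realLoad, after_natAdd,
        after_realAdd, h3, hr2, h0, h1, hH, hB, h8, hlt, hb]
  · rw [min_eq_right hge]
    by_cases hb : B (D e) < H e
    · simp [widestBody, block, eval, Cond.holds, after_natLoad, after_realLoad, after_realStore,
        after_natConst, h0, h1, hH, hB, h8, not_lt.2 hge, hb]
    · simp [widestBody, block, eval, Cond.holds, after_natLoad, after_realLoad, after_natAdd,
        h3, h0, h1, hH, hB, h8, not_lt.2 hge, hb]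

theorem widest_spec {n M : ℕ} {S D : ℕ → ℕ} {H : ℕ → ℝ} {b : ℝ} {m : Mem} (hc : Consts m)
    (h5 : m.nreg 5 = M) (hS : m.narr 0 = S) (hD : m.narr 1 = D) (hH : m.rarr 2 = H) (hb0 : 0 < b)
    (hB : m.rarr 4 = Function.update (fun _ => 0) 0 b) (hDn : ∀ e < M, D e < n)
    (hHb : ∀ e < M, H e < b) :
    Ex widest m (20 * (n + 1) * (M + 1) * (M + 1)) (fun m' => Frame widest m m' ∧
      0 ≤ m'.rreg 4 ∧ (∃ R, Separates M S D H (m'.rreg 4) R) ∧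
      ∀ x, 0 ≤ x → ∀ R, Separates M S D H x R → m'.rreg 4 ≤ x) := by
  refine Ex.frame (Ex.mono (Ex.seq (Ex.of_eval (c := op _) rfl (Q := fun m₁ => m₁ =
    { m with nreg := Function.update m.nreg 8 0 }) rfl)
    (T' := (n * (M + 1) * (M + 1) + M) * (13 + 2) + 2 + 1) ?_) ?_ fun _ h => h)
  · rintro m₁ rfl
    refine Ex.seq (T := (n * (M + 1) * (M + 1) + M) * (13 + 2) + 2) (T' := 1)
      (Ex.mono (Ex.loop (T := 13)
      (fun m' j => ∃ e ≤ M, m'.nreg 8 = e ∧ Widths M S D H b (m'.rarr 4) ∧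
        (∀ e' < e, min (m'.rarr 4 (S e')) (H e') ≤ m'.rarr 4 (D e')) ∧
        j = widthsLeft n M H (m'.rarr 4) * (M + 1) + (M - e))
      ⟨0, by omega, by simp, ?_, by omega, rfl⟩ ?_
      (Q := fun m' => m'.nreg 3 = 1 ∧ Widths M S D H b (m'.rarr 4) ∧
        ∀ e' < M, min (m'.rarr 4 (S e')) (H e') ≤ m'.rarr 4 (D e')) ?_) ?_ fun _ h => h) ?_
    · simp only [hB]
      refine ⟨by simp, fun v => ?_, fun v hv => ?_, fun v hv => ?_, fun x hx R hR v hv => ?_⟩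
      · simp only [Function.update_apply]; split_ifs <;> linarith
      · simpa [hv] using hb0
      · simp [hv]
      · have : v ≠ 0 := by rintro rfl; exact hv hR.source
        simpa [this] using hx
    · rintro m₂ j hF ⟨e, heM, h8, hW, hdone, rfl⟩ hb
      have k5 : m₂.nreg 5 = M := by rw [hF.nreg 5 rfl]; simpa using h5
      simp only [Cond.holds, h8, k5] at hb
      have key := eval_widestBody (m := m₂) (e := e) (B := m₂.rarr 4)
        (by rw [hF.nreg 3 rfl]; simpa using hc.n3)
        ((hF.rreg 2 rfl).trans hc.r2) ((hF.narr 0 rfl).trans hS) ((hF.narr 1 rfl).trans hD)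
        ((hF.rarr 2 rfl).trans hH) rfl h8
      by_cases hlt : m₂.rarr 4 (D e) < min (m₂.rarr 4 (S e)) (H e)
      · obtain ⟨hr4, hn8⟩ := key.1 hlt
        obtain ⟨hW', hdec⟩ := hW.relax hHb hDn hb hlt
        refine Ex.mono (Ex.of_eval (c := widestBody) rfl ⟨_, ?_, 0, Nat.zero_le _, hn8, ?_, ?_,
          rfl⟩) (by decide) fun _ h => h
        · rw [hr4]
          have := Nat.mul_le_mul_right (M + 1) hdec
          rw [Nat.succ_mul] at this
          omega
        · rw [hr4]; exact hW'
        · omega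
      · obtain ⟨hr4, hn8⟩ := key.2 hlt
        refine Ex.mono (Ex.of_eval (c := widestBody) rfl ⟨_, ?_, e + 1, hb, hn8, ?_, ?_,
          rfl⟩) (by decide) fun _ h => h
        · rw [hr4]; omega
        · rw [hr4]; exact hW
        · rw [hr4]
          intro e' he'
          rcases Nat.lt_succ_iff_lt_or_eq.1 he' with he' | rfl
          · exact hdone e' he'
          · exact not_lt.1 hlt
    · rintro m₂ j hF ⟨e, heM, h8, hW, hdone, rfl⟩ hb
      have k5 : m₂.nreg 5 = M := by rw [hF.nreg 5 rfl]; simpa using h5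
      simp only [Cond.holds, h8, k5] at hb
      obtain rfl : e = M := by omega
      exact ⟨by rw [hF.nreg 3 rfl]; simpa using hc.n3, hW, hdone⟩
    · have := Nat.mul_le_mul_right (M + 1) (widthsLeft_le n M H (m.rarr 4))
      refine Nat.add_le_add_right (Nat.mul_le_mul_right _ ?_) 2
      simp only
      omega
    · rintro m₂ ⟨h3, hW, hdone⟩
      refine Ex.of_eval (c := block _) rfl ?_
      have e : ((block [op (realLoad 4 4 3)]).eval m₂).rreg 4 = m₂.rarr 4 1 := by
        simp [block, eval, after_realLoad, h3]
      rw [e]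
      refine ⟨hW.nonneg 1, ⟨{v | m₂.rarr 4 1 < m₂.rarr 4 v}, ?_, fun h => lt_irrefl (m₂.rarr 4 1) h, ?_⟩,
        fun x hx R hR => hW.le x hx R hR 1 hR.sink⟩
      · have := hW.lt 1 one_ne_zero
        rw [← hW.source] at this
        exact this
      · intro e he hs hx
        exact (lt_min hs hx).trans_le (hdone e he)
  · have e : (op (natConst 8 0)).time = 1 := rfl
    rw [e]
    nlinarith [Nat.zero_le (n * (M + 1) * (M + 1)), Nat.zero_le (M * M), Nat.zero_le M]

end

/-! ### The copies -/

section

open Cmd Instr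

/-- Computes the real number `n` by counting: natural numbers cannot be converted otherwise. -/
def countVertices : Cmd :=
  loop (.natLt 8 0) (block [op (realAdd 5 5 3), op (natAdd 8 8 3)])

/-- Computes the natural number `c` by counting up to the real number `n² / ε`. -/
def countCopies : Cmd :=
  loop (.realLt 7 6) (block [op (realAdd 7 7 3), op (natAdd 6 6 3)])

/-- Computes the number of copies and the power of one copy. -/
def discretize : Cmd := block [
  block [op (realConst 5 0), op (natConst 8 0)],
  countVertices,
  block [op (realMul 6 5 5), op (realDiv 6 6 0), op (realConst 7 0), op (natConst 6 0)],
  countCopies,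
  block [op (realMul 1 0 4), op (realDiv 1 1 5)]]

theorem countVertices_spec {n : ℕ} {m : Mem} (hn : m.nreg 0 = n) (h3 : m.nreg 3 = 1)
    (h8 : m.nreg 8 = 0) (hr3 : m.rreg 3 = 1) (hr5 : m.rreg 5 = 0) :
    Ex countVertices m (n * 4 + 2) (fun m' => Frame countVertices m m' ∧ m'.rreg 5 = n) := by
  refine Ex.frame (Ex.loop (T := 2) (fun m' j => ∃ i, i + j = n ∧ m'.nreg 8 = i ∧ m'.rreg 5 = i)
    ⟨0, by omega, h8, by simpa using hr5⟩ ?_ ?_)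
  · rintro m₁ j hF ⟨i, hij, h8, hr5⟩ hb
    simp only [Cond.holds, h8, hF.nreg 0 rfl, hn] at hb
    refine Ex.of_eval rfl ⟨j - 1, by omega, i + 1, by omega, ?_, ?_⟩
    · simp [block, eval, after_realAdd, after_natAdd, h8, hF.nreg 3 rfl, h3]
    · simp [block, eval, after_realAdd, after_natAdd, hr5, hF.rreg 3 rfl, hr3]
  · rintro m₁ j hF ⟨i, hij, h8, hr5⟩ hb
    simp only [Cond.holds, h8, hF.nreg 0 rfl, hn] at hb
    rw [hr5]
    congr 1
    omega

theorem countCopies_spec {x : ℝ} {m : Mem} (h3 : m.nreg 3 = 1) (hr3 : m.rreg 3 = 1)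
    (hr6 : m.rreg 6 = x) (hr7 : m.rreg 7 = 0) (h6 : m.nreg 6 = 0) :
    Ex countCopies m (⌈x⌉₊ * 4 + 2) (fun m' => Frame countCopies m m' ∧ m'.nreg 6 = ⌈x⌉₊) := by
  refine Ex.frame (Ex.loop (T := 2) (fun m' j => ∃ i, i + j = ⌈x⌉₊ ∧ m'.nreg 6 = i ∧ m'.rreg 7 = i)
    ⟨0, by omega, h6, by simpa using hr7⟩ ?_ ?_)
  · rintro m₁ j hF ⟨i, hij, h6, hr7⟩ hb
    simp only [Cond.holds, hr7, hF.rreg 6 rfl, hr6] at hb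
    have := Nat.lt_ceil.2 hb
    refine Ex.of_eval rfl ⟨j - 1, by omega, i + 1, by omega, ?_, ?_⟩
    · simp [block, eval, after_realAdd, after_natAdd, h6, hF.nreg 3 rfl, h3]
    · simp [block, eval, after_realAdd, after_natAdd, hr7, hF.rreg 3 rfl, hr3]
  · rintro m₁ j hF ⟨i, hij, h6, hr7⟩ hb
    simp only [Cond.holds, hr7, hF.rreg 6 rfl, hr6] at hb
    have := mt Nat.lt_ceil.1 hb
    omega

theorem discretize_spec {n : ℕ} {m : Mem} (hc : Consts m) (hn : m.nreg 0 = n) :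
    Ex discretize m (n * 4 + ⌈(n : ℝ) ^ 2 / m.rreg 0⌉₊ * 4 + 12) (fun m' =>
      Frame discretize m m' ∧ m'.nreg 6 = ⌈(n : ℝ) ^ 2 / m.rreg 0⌉₊ ∧
      m'.rreg 1 = m.rreg 0 * m.rreg 4 / n) := by
  set c := ⌈(n : ℝ) ^ 2 / m.rreg 0⌉₊ with hcdef
  refine Ex.frame (Ex.mono (Ex.seq (Ex.of_eval (c := block _) rfl (Q := fun m₁ => Consts m₁ ∧
    m₁.nreg 0 = n ∧ m₁.nreg 8 = 0 ∧ m₁.rreg 5 = 0 ∧ m₁.rreg 0 = m.rreg 0 ∧ m₁.rreg 4 = m.rreg 4)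
    ?_) (T' := n * 4 + 2 + (4 + (c * 4 + 2 + (2 + 0)))) ?_) ?_ fun _ h => h)
  · simp only [block, eval, after_natConst, after_realConst]
    refine ⟨⟨?_, ?_, ?_, ?_, ?_⟩, ?_⟩ <;> simp [hc.n2, hc.n3, hc.n4, hc.r2, hc.r3, hn]
  · rintro m₁ ⟨hc1, hn1, h81, hr51, hr01, hr41⟩
    refine Ex.seq (countVertices_spec hn1 hc1.n3 h81 hc1.r3 hr51) ?_
    rintro m₂ ⟨hF, hr5⟩
    refine Ex.seq (T := 4) (Ex.of_eval (c := block _) rfl (Q := fun m₃ => m₃.nreg 3 = 1 ∧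
      m₃.rreg 3 = 1 ∧ m₃.nreg 6 = 0 ∧ m₃.rreg 7 = 0 ∧ m₃.rreg 5 = n ∧ m₃.rreg 0 = m.rreg 0 ∧
      m₃.rreg 4 = m.rreg 4 ∧ m₃.rreg 6 = (n : ℝ) ^ 2 / m.rreg 0) ?_) ?_
    · simp [block, eval, after_realMul, after_realDiv, after_realConst, after_natConst, hr5,
        hF.rreg 0 rfl, hF.rreg 3 rfl, hF.rreg 4 rfl, hF.nreg 3 rfl, hc1.n3, hc1.r3, hr01, hr41, sq]
    · rintro m₃ ⟨h3, hr3, h6, hr7, hr5, hr0, hr4, hr6⟩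
      refine Ex.seq (countCopies_spec h3 hr3 hr6 hr7 h6) ?_
      rintro m₄ ⟨hF', h6'⟩
      refine Ex.seq (T := 2) (Ex.of_eval (c := block _) rfl (Q := fun m₅ => m₅.nreg 6 = c ∧
        m₅.rreg 1 = m.rreg 0 * m.rreg 4 / n) ?_) fun m₅ h => Ex.of_eval rfl h
      simp [block, eval, after_realMul, after_realDiv, h6', hF'.rreg 0 rfl, hF'.rreg 4 rfl,
        hF'.rreg 5 rfl, hr0, hr4, hr5, hcdef]
  · have : (block [op (realConst 5 0), op (natConst 8 0)]).time = 2 := rfl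
    rw [this]
    omega

/-- Adds one copy to the current vertex, or goes on to the next vertex if it has all its copies. -/
def layoutBody : Cmd :=
  cond (.natLt 10 6)
    (block [op (natStore 4 9 8), op (realStore 3 9 6), op (realAdd 6 6 1), op (natAdd 9 9 3),
      op (natAdd 10 10 3)])
    (block [op (natStore 3 8 9), op (natAdd 8 8 3), op (natStore 2 8 9), op (natConst 10 0),
      op (realConst 6 0)])

/-- Makes every vertex its own predecessor: no vertex is on a path. -/
def resetPred : Cmd := loop (.natLt 8 7) (block [op (natStore 7 8 8), op (natAdd 8 8 3)])

/-- Numbers the copies and starts with no paths. -/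
def layout : Cmd := block [
  block [op (natConst 8 2), op (natConst 9 2), op (natConst 10 0), op (realConst 6 0),
    op (natStore 2 3 3), op (natStore 3 3 4), op (natStore 4 3 3), op (natStore 2 4 4)],
  loop (.natLt 8 0) layoutBody,
  block [op (natAdd 7 9 2), op (natConst 8 0)],
  resetPred]

/-- The first `a` vertices other than the terminals have got their `c` copies, of levels `0`, `α`,
`2α`, …, and the next vertex has got `j` copies. -/
structure Layout (c : ℕ) (α : ℝ) (a j : ℕ) (base lim own : ℕ → ℕ) (val : ℕ → ℝ) : Prop where
  base_zero : base 0 = 0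
  base_one : base 1 = 1
  base_eq : ∀ i ≤ a, base (2 + i) = 2 + i * c
  lim_zero : lim 0 = 0
  lim_one : lim 1 = 2
  lim_eq : ∀ i < a, lim (2 + i) = 2 + (i * c + c)
  own_zero : own 0 = 0
  own_one : own 1 = 1
  val_zero : val 0 = 0
  val_one : val 1 = 0
  own_eq : ∀ i i', (i < a ∧ i' < c) ∨ (i = a ∧ i' < j) → own (2 + (i * c + i')) = 2 + i
  val_eq : ∀ i i', (i < a ∧ i' < c) ∨ (i = a ∧ i' < j) → val (2 + (i * c + i')) = i' * α

variable {c a j : ℕ} {α : ℝ} {base lim own : ℕ → ℕ} {val : ℕ → ℝ}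

theorem mul_add_lt_mul {i a i' c : ℕ} (hi : i < a) (hi' : i' < c) : i * c + i' < a * c := by
  have := Nat.mul_le_mul_right c hi
  rw [Nat.succ_mul] at this
  omega

theorem Layout.add_copy (h : Layout c α a j base lim own val) :
    Layout c α a (j + 1) base lim (Function.update own (2 + (a * c + j)) (2 + a))
      (Function.update val (2 + (a * c + j)) (j * α)) where
  base_zero := h.base_zero
  base_one := h.base_one
  base_eq := h.base_eq
  lim_zero := h.lim_zero
  lim_one := h.lim_one
  lim_eq := h.lim_eq
  own_zero := by rw [Function.update_of_ne (by omega), h.own_zero]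
  own_one := by rw [Function.update_of_ne (by omega), h.own_one]
  val_zero := by rw [Function.update_of_ne (by omega), h.val_zero]
  val_one := by rw [Function.update_of_ne (by omega), h.val_one]
  own_eq i i' hi := by
    by_cases h' : i = a ∧ i' = j
    · rw [h'.1, h'.2, Function.update_self]
    · have hne : 2 + (i * c + i') ≠ 2 + (a * c + j) := by
        rcases hi with hi | hi
        · have := mul_add_lt_mul hi.1 hi.2; omega
        · rw [hi.1]; omega
      rw [Function.update_of_ne hne]
      exact h.own_eq i i' (by omega)
  val_eq i i' hi := by
    by_cases h' : i = a ∧ i' = j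
    · rw [h'.1, h'.2, Function.update_self]
    · have hne : 2 + (i * c + i') ≠ 2 + (a * c + j) := by
        rcases hi with hi | hi
        · have := mul_add_lt_mul hi.1 hi.2; omega
        · rw [hi.1]; omega
      rw [Function.update_of_ne hne]
      exact h.val_eq i i' (by omega)

theorem Layout.next_vertex (h : Layout c α a c base lim own val) :
    Layout c α (a + 1) 0 (Function.update base (2 + (a + 1)) (2 + (a * c + c)))
      (Function.update lim (2 + a) (2 + (a * c + c))) own val where
  base_zero := by rw [Function.update_of_ne (by omega), h.base_zero]
  base_one := by rw [Function.update_of_ne (by omega), h.base_one]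
  base_eq i hi := by
    by_cases h' : i = a + 1
    · rw [h', Function.update_self, Nat.succ_mul]
    · rw [Function.update_of_ne (by omega)]; exact h.base_eq i (by omega)
  lim_zero := by rw [Function.update_of_ne (by omega), h.lim_zero]
  lim_one := by rw [Function.update_of_ne (by omega), h.lim_one]
  lim_eq i hi := by
    by_cases h' : i = a
    · rw [h', Function.update_self]
    · rw [Function.update_of_ne (by omega)]; exact h.lim_eq i (by omega)
  own_zero := h.own_zero
  own_one := h.own_one
  val_zero := h.val_zero
  val_one := h.val_one
  own_eq i i' hi := h.own_eq i i' (by omega)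
  val_eq i i' hi := h.val_eq i i' (by omega)

theorem resetPred_spec {N : ℕ} {m : Mem} (h7 : m.nreg 7 = N) (h3 : m.nreg 3 = 1)
    (h8 : m.nreg 8 = 0) : Ex resetPred m (N * 4 + 2) (fun m' => ∀ y < N, m'.narr 7 y = y) := by
  refine Ex.loop (T := 2) (fun m' j => ∃ i, i + j = N ∧ m'.nreg 8 = i ∧ ∀ y < i, m'.narr 7 y = y)
    ⟨0, by omega, h8, by omega⟩ ?_ ?_
  · rintro m₁ j hF ⟨i, hij, h8, hp⟩ hb
    simp only [Cond.holds, h8, hF.nreg 7 rfl, h7] at hb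
    refine Ex.of_eval rfl ⟨j - 1, by omega, i + 1, by omega, ?_, fun y hy => ?_⟩
    · simp [block, eval, after_natStore, after_natAdd, h8, hF.nreg 3 rfl, h3]
    · have e : ((block [op (natStore 7 8 8), op (natAdd 8 8 3)]).eval m₁).narr 7 =
          Function.update (m₁.narr 7) i i := by
        simp [block, eval, after_natStore, after_natAdd, h8]
      rw [e, Function.update_apply]
      split_ifs with h'
      · exact h'.symm
      · exact hp y (by omega)
  · rintro m₁ j hF ⟨i, hij, h8, hp⟩ hb
    simp only [Cond.holds, h8, hF.nreg 7 rfl, h7] at hb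
    exact fun y hy => hp y (by omega)

theorem layout_spec {k : ℕ} {m : Mem} (hc : Consts m) (hn : m.nreg 0 = k + 2) (h6 : m.nreg 6 = c)
    (hα : m.rreg 1 = α) (hb : ∀ v, m.narr 2 v = 0) (hl : ∀ v, m.narr 3 v = 0)
    (ho : ∀ v, m.narr 4 v = 0) (hv : ∀ v, m.rarr 3 v = 0) :
    Ex layout m (40 * (k + 1) * (c + 1)) (fun m' => Frame layout m m' ∧ m'.nreg 7 = 2 + k * c ∧
      Layout c α k 0 (m'.narr 2) (m'.narr 3) (m'.narr 4) (m'.rarr 3) ∧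
      ∀ y < 2 + k * c, m'.narr 7 y = y) := by
  refine Ex.frame (Ex.mono (Ex.seq (Ex.of_eval (c := block _) rfl (Q := fun m₁ => Consts m₁ ∧
    m₁.nreg 0 = k + 2 ∧ m₁.nreg 6 = c ∧ m₁.rreg 1 = α ∧ m₁.nreg 8 = 2 ∧ m₁.nreg 9 = 2 ∧
    m₁.nreg 10 = 0 ∧ m₁.rreg 6 = 0 ∧
    Layout c α 0 0 (m₁.narr 2) (m₁.narr 3) (m₁.narr 4) (m₁.rarr 3)) ?_)
    (T' := (k * (c + 1) + c) * (12 + 2) + 2 + (2 + ((2 + k * c) * 4 + 2 + 0))) ?_) ?_ fun _ h => h)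
  · simp only [block, eval, after_natConst, after_realConst, after_natStore]
    refine ⟨⟨?_, ?_, ?_, ?_, ?_⟩, ?_, ?_, ?_, ?_, ?_, ?_, ?_, ?_, ?_, ?_, ?_, ?_, ?_, ?_, ?_, ?_, ?_,
      ?_, ?_⟩ <;> simp [hc.n2, hc.n3, hc.n4, hc.r2, hc.r3, hn, h6, hα, hb, hl, ho, hv]
  · rintro m₁ ⟨hc, hn, h6, hα, h8, h9, h10, hr6, hL⟩
    refine Ex.seq (Ex.loop (T := 12) (fun m' i => ∃ a j, a ≤ k ∧ j ≤ c ∧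
      i = (k - a) * (c + 1) + (c - j) ∧ m'.nreg 8 = 2 + a ∧ m'.nreg 9 = 2 + (a * c + j) ∧
      m'.nreg 10 = j ∧ m'.rreg 6 = j * α ∧ (a = k → j = 0) ∧
      Layout c α a j (m'.narr 2) (m'.narr 3) (m'.narr 4) (m'.rarr 3))
      ⟨0, 0, by omega, by omega, rfl, by simpa using h8, by simpa using h9, h10,
        by simpa using hr6, by omega, hL⟩ ?_
      (Q := fun m' => m'.nreg 9 = 2 + k * c ∧ m'.nreg 2 = 0 ∧ m'.nreg 3 = 1 ∧
        Layout c α k 0 (m'.narr 2) (m'.narr 3) (m'.narr 4) (m'.rarr 3)) ?_) ?_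
    · rintro m₂ i hF ⟨a, j, ha, hj, rfl, h8, h9, h10, hr6, haj, hL⟩ hb
      simp only [Cond.holds, h8, hF.nreg 0 rfl, hn] at hb
      have k6 := (hF.nreg 6 rfl).trans h6
      have k3 := (hF.nreg 3 rfl).trans hc.n3
      have kα := (hF.rreg 1 rfl).trans hα
      by_cases hjc : j < c
      · refine Ex.mono (Ex.of_eval (c := layoutBody) rfl ⟨_, ?_, a, j + 1, ha, hjc, rfl, ?_, ?_, ?_,
          ?_, by omega, ?_⟩) (by decide) fun _ h => h
        · omega
        · simp [layoutBody, block, eval, Cond.holds, after_natStore, after_realStore, after_realAdd,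
            after_natAdd, h8, h10, k6, hjc]
        · simp [layoutBody, block, eval, Cond.holds, after_natStore, after_realStore, after_realAdd,
            after_natAdd, h9, h10, k6, k3, hjc]
          omega
        · simp [layoutBody, block, eval, Cond.holds, after_natStore, after_realStore, after_realAdd,
            after_natAdd, h10, k6, k3, hjc]
        · simp [layoutBody, block, eval, Cond.holds, after_natStore, after_realStore, after_realAdd,
            after_natAdd, h10, hr6, kα, k6, hjc]
          ring
        · convert hL.add_copy using 1 <;>
            simp [layoutBody, block, eval, Cond.holds, after_natStore, after_realStore,
              after_realAdd, after_natAdd, h8, h9, h10, hr6, k6, hjc]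
      · obtain rfl : j = c := by omega
        refine Ex.mono (Ex.of_eval (c := layoutBody) rfl ⟨_, ?_, a + 1, 0, by omega, by omega, rfl,
          ?_, ?_, ?_, ?_, by omega, ?_⟩) (by decide) fun _ h => h
        · have : (k - a) * (j + 1) = (k - (a + 1)) * (j + 1) + (j + 1) := by
            rw [← Nat.succ_mul]; congr 1; omega
          omega
        · simp [layoutBody, block, eval, Cond.holds, after_natStore, after_realConst, after_natConst,
            after_natAdd, h8, h10, k6, k3]
          omega
        · simp [layoutBody, block, eval, Cond.holds, after_natStore, after_realConst, after_natConst,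
            after_natAdd, h9, h10, k6, Nat.succ_mul]
        · simp [layoutBody, block, eval, Cond.holds, after_natStore, after_realConst, after_natConst,
            after_natAdd, h10, k6]
        · simp [layoutBody, block, eval, Cond.holds, after_natStore, after_realConst, after_natConst,
            after_natAdd, h10, k6]
        · convert hL.next_vertex using 1 <;>
            simp [layoutBody, block, eval, Cond.holds, after_natStore, after_realConst,
              after_natConst, after_natAdd, h8, h9, h10, k6, k3, add_assoc]
    · rintro m₂ i hF ⟨a, j, ha, hj, rfl, h8, h9, h10, hr6, haj, hL⟩ hb
      simp only [Cond.holds, h8, hF.nreg 0 rfl, hn] at hb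
      obtain rfl : a = k := by omega
      obtain rfl := haj rfl
      exact ⟨h9, (hF.nreg 2 rfl).trans hc.n2, (hF.nreg 3 rfl).trans hc.n3, hL⟩
    · rintro m₂ ⟨h9, h2, h3, hL⟩
      refine Ex.seq (T := 2) (Ex.of_eval (c := block _) rfl (Q := fun m₃ => m₃.nreg 7 = 2 + k * c ∧
        m₃.nreg 3 = 1 ∧ m₃.nreg 8 = 0 ∧
        Layout c α k 0 (m₃.narr 2) (m₃.narr 3) (m₃.narr 4) (m₃.rarr 3)) ?_) ?_
      · simp [block, eval, after_natAdd, after_natConst, h9, h2, h3, hL]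
      · rintro m₃ ⟨h7, h3, h8, hL⟩
        refine Ex.seq (Ex.frame (resetPred_spec h7 h3 h8)) fun m₄ ⟨hF, hp⟩ => Ex.of_eval rfl ?_
        refine ⟨(hF.nreg 7 rfl).trans h7, ?_, hp⟩
        have e2 := hF.narr 2 rfl
        have e3 := hF.narr 3 rfl
        have e4 := hF.narr 4 rfl
        have e5 := hF.rarr 3 rfl
        change Layout c α k 0 (m₄.narr 2) (m₄.narr 3) (m₄.narr 4) (m₄.rarr 3)
        rw [e2, e3, e4, e5]
        exact hL
  · have : (block [op (natConst 8 2), op (natConst 9 2), op (natConst 10 0), op (realConst 6 0),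
      op (natStore 2 3 3), op (natStore 3 3 4), op (natStore 4 3 3), op (natStore 2 4 4)]).time
        = 8 := rfl
    rw [this]
    nlinarith [Nat.zero_le (k * c), Nat.zero_le k, Nat.zero_le c]

/-- The network built from the layout of the copies and the directed edges. -/
theorem Layout.valid {k : ℕ} {c : ℕ} {α : ℝ} {C : Net} (hα : 0 ≤ α) (hc : 0 < c)
    (hn : C.n = k + 2) (hN : C.N = 2 + k * c) (hd : ∀ e < C.M, C.dst e < k + 2)
    (h : Layout c α k 0 C.base C.lim C.own C.val) : C.Valid := by
  have hid : ∀ y, 2 ≤ y → y < C.N → ∃ i i', i < k ∧ i' < c ∧ y = 2 + (i * c + i') := by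
    intro y h2 hy
    refine ⟨(y - 2) / c, (y - 2) % c, Nat.div_lt_of_lt_mul ?_, Nat.mod_lt _ hc, ?_⟩
    · rw [mul_comm]; omega
    · have := Nat.div_add_mod' (y - 2) c; omega
  have hown : ∀ y < C.N, 0 < y → C.own y < C.n ∧ C.base (C.own y) ≤ y ∧ y < C.lim (C.own y) := by
    intro y hy h0
    rcases Nat.lt_or_ge y 2 with hlt | h2
    · obtain rfl : y = 1 := by omega
      rw [h.own_one, h.base_one, h.lim_one]
      omega
    · obtain ⟨i, i', hi, hi', rfl⟩ := hid y h2 hy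
      rw [h.own_eq i i' (.inl ⟨hi, hi'⟩), h.base_eq i hi.le, h.lim_eq i hi]
      omega
  have hblock : ∀ v < C.n, ∀ y, C.base v ≤ y → y < C.lim v →
      (v = 1 ∧ y = 1) ∨ ∃ i i', v = 2 + i ∧ i < k ∧ i' < c ∧ y = 2 + (i * c + i') := by
    intro v hv y hy hy'
    rcases Nat.lt_or_ge v 2 with hlt | h2
    · have h01 : v = 0 ∨ v = 1 := by omega
      rcases h01 with rfl | rfl
      · rw [h.lim_zero] at hy'; omega
      · rw [h.base_one] at hy; rw [h.lim_one] at hy'; omega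
    · obtain ⟨i, rfl⟩ := Nat.exists_eq_add_of_le h2
      rw [h.base_eq i (by omega)] at hy
      rw [h.lim_eq i (by omega)] at hy'
      exact .inr ⟨i, y - (2 + i * c), rfl, by omega, by omega, by omega⟩
  refine ⟨by omega, ?_, fun e he => hn ▸ hd e he, fun y hy => ?_, fun y hy h0 => (hown y hy h0).2.1,
    fun y hy h0 => (hown y hy h0).2.2, fun v hv y hy hy' => ?_, fun v hv => ?_,
    fun v hv y y' hy hyy' hy' => ?_⟩
  · have := Nat.le_mul_of_pos_right k hc
    omega
  · rcases Nat.eq_zero_or_pos y with rfl | h0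
    · rw [h.own_zero]; omega
    · exact (hown y hy h0).1
  · rcases hblock v hv y hy hy' with ⟨rfl, rfl⟩ | ⟨i, i', rfl, hi, hi', rfl⟩
    · exact ⟨one_pos, by omega, h.own_one⟩
    · have := mul_add_lt_mul hi hi'
      exact ⟨by omega, by omega, h.own_eq i i' (.inl ⟨hi, hi'⟩)⟩
  · rcases Nat.lt_or_ge v 2 with hlt | h2
    · have h01 : v = 0 ∨ v = 1 := by omega
      rcases h01 with rfl | rfl
      · rw [h.lim_zero, h.base_zero]
      · rw [h.base_one, h.lim_one]; omega
    · obtain ⟨i, rfl⟩ := Nat.exists_eq_add_of_le h2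
      rw [h.base_eq i (by omega), h.lim_eq i (by omega)]
      omega
  · rcases hblock v hv y hy (hyy'.trans_lt hy') with ⟨rfl, rfl⟩ | ⟨i, i', rfl, hi, hi', rfl⟩ <;>
      rcases hblock _ hv y' (hy.trans hyy') hy' with ⟨h1, rfl⟩ | ⟨a, a', h1, ha, ha', rfl⟩
    · exact le_rfl
    · omega
    · omega
    · obtain rfl : i = a := by omega
      rw [h.val_eq i i' (.inl ⟨hi, hi'⟩), h.val_eq i a' (.inl ⟨ha, ha'⟩)]
      exact mul_le_mul_of_nonneg_right (by exact_mod_cast (by omega : i' ≤ a')) hα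

end

/-! ### Finding a maximum system of disjoint paths -/

section

open Cmd Instr

/-- Visits the predecessor of the vertex in register 17, coming from the vertex in register 15. -/
def visit : Cmd := block [
  op (natLoad 18 7 17), op (natLoad 19 6 18),
  cond (.natLt 19 3)
    (block [op (natStore 6 18 3), op (natStore 8 18 15), op (natStore 9 18 17),
      op (natStore 10 14 18), op (natAdd 14 14 3)])
    skip]

/-- One step of the search. -/
def searchBody : Cmd :=
  cond (.natLt 8 5)
    (block [
      op (natLoad 9 0 8), op (natLoad 10 4 15),
      cond (.natLt 9 10) (op (natAdd 8 8 3)) (cond (.natLt 10 9) (op (natAdd 8 8 3)) (block [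
        op (natLoad 11 1 8), op (natLoad 17 5 11), op (natLoad 18 3 11),
        cond (.natLt 17 18) (block [
            op (realLoad 6 3 15), op (realLoad 7 3 17), op (realAdd 6 6 7), op (realLoad 7 0 8),
            cond (.realLt 6 7)
              (block [block [op (natAdd 18 17 3), op (natStore 5 11 18)], visit])
              (op (natAdd 8 8 3))])
          (op (natAdd 8 8 3))]))])
    (cond (.natLt 13 14)
      (block [block [op (natLoad 15 10 13), op (natAdd 13 13 3), op (natConst 8 0),
        op (natAdd 17 15 2)], visit])
      (op (natConst 16 0)))

/-- Marks one vertex as not visited, and sets one pointer to the first copy of its vertex. -/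
def resetSearchBody : Cmd :=
  block [op (natStore 6 8 2), op (natLoad 9 2 8), op (natStore 5 8 9), op (natAdd 8 8 3)]

/-- Searches for an augmenting path. Every step of the search scans one edge, enters one copy, or
takes one vertex from the queue. -/
def search : Cmd := block [
  op (natConst 8 0),
  loop (.natLt 8 7) resetSearchBody,
  block [op (natStore 6 2 3), op (natStore 10 2 2), op (natConst 13 0), op (natConst 14 1),
    op (natConst 15 0), op (natAdd 8 5 2), op (natConst 16 1)],
  loop (.natLt 2 16) searchBody]

/-- Gives `via z` the new predecessor `par z`, and goes on to it. -/
def augmentBody : Cmd :=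
  block [op (natLoad 17 9 15), op (natLoad 18 8 15), op (natStore 7 17 18), op (natAdd 15 18 2)]

/-- Follows the search tree back from the sink to the source. -/
def augment : Cmd := block [op (natLoad 15 8 3), loop (.natLt 2 15) augmentBody]

/-- One search, followed by an augmentation if it has reached the sink. -/
def maximizeBody : Cmd :=
  block [search, op (natLoad 12 6 3), cond (.natLt 2 12) augment skip]

/-- Augments until a search does not reach the sink. -/
def maximize : Cmd := block [op (natConst 12 1), loop (.natLt 2 12) maximizeBody]

/-- The memory holds the network `C`. -/
structure Loaded (C : Net) (m : Mem) : Prop where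
  n2 : m.nreg 2 = 0
  n3 : m.nreg 3 = 1
  M : m.nreg 5 = C.M
  N : m.nreg 7 = C.N
  src : m.narr 0 = C.src
  dst : m.narr 1 = C.dst
  base : m.narr 2 = C.base
  lim : m.narr 3 = C.lim
  own : m.narr 4 = C.own
  w : m.rarr 0 = C.w
  val : m.rarr 3 = C.val

/-- Whether a program does not write to the registers and arrays that hold the network. -/
def keepsNet (c : Cmd) : Bool :=
  !(c.setsNat 2 || c.setsNat 3 || c.setsNat 5 || c.setsNat 7 || c.setsNatArray 0 ||
    c.setsNatArray 1 || c.setsNatArray 2 || c.setsNatArray 3 || c.setsNatArray 4 ||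
    c.setsRealArray 0 || c.setsRealArray 3)

theorem Loaded.frame {C : Net} {m m' : Mem} {c : Cmd} (h : Loaded C m) (hF : Frame c m m')
    (hc : keepsNet c = true) : Loaded C m' := by
  simp only [keepsNet, Bool.not_eq_true', Bool.or_eq_false_iff] at hc
  obtain ⟨⟨⟨⟨⟨⟨⟨⟨⟨⟨h1, h2⟩, h3⟩, h4⟩, h5⟩, h6⟩, h7⟩, h8⟩, h9⟩, h10⟩, h11⟩ := hc
  exact ⟨(hF.nreg _ h1).trans h.n2, (hF.nreg _ h2).trans h.n3, (hF.nreg _ h3).trans h.M,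
    (hF.nreg _ h4).trans h.N, (hF.narr _ h5).trans h.src, (hF.narr _ h6).trans h.dst,
    (hF.narr _ h7).trans h.base, (hF.narr _ h8).trans h.lim, (hF.narr _ h9).trans h.own,
    (hF.rarr _ h10).trans h.w, (hF.rarr _ h11).trans h.val⟩

theorem frame_eval {c : Cmd} (hc : c.loopFree = true) (m : Mem) : Frame c m (c.eval m) := by
  obtain ⟨τ, -, m', hr, rfl⟩ := Ex.of_eval hc (m := m) (Q := (· = c.eval m)) rfl
  exact hr.frame

/-- The search tree held by the memory. -/
def TreeIn (C : Net) (pred : ℕ → ℕ) (m : Mem) : Prop :=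
  Tree C.N C.Adj pred (m.narr 6) (m.narr 8) (m.narr 9) (m.narr 10) (m.nreg 14)

/-- The state of the search held by the memory. -/
def ScanIn (C : Net) (pred : ℕ → ℕ) (m : Mem) : Prop :=
  Scan C pred (m.narr 6) (m.narr 10) (m.narr 5) (m.nreg 13) (m.nreg 14) (m.nreg 15) (m.nreg 8)

theorem visit_spec {C : Net} {pred : ℕ → ℕ} {y z : ℕ} {m : Mem} (h3 : m.nreg 3 = 1)
    (h7 : m.narr 7 = pred) (h15 : m.nreg 15 = z) (h17 : m.nreg 17 = y)
    (ht : TreeIn C pred m) (hy : y < C.N) (hp : pred y < C.N)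
    (hz : ∃ r < m.nreg 14, m.narr 10 r = z) (hA : z = y ∨ C.Adj z y) :
    TreeIn C pred (visit.eval m) ∧ (∀ x, m.narr 6 x = 1 → (visit.eval m).narr 6 x = 1) ∧
      (visit.eval m).narr 6 (pred y) = 1 ∧
      (∀ r < m.nreg 14, (visit.eval m).narr 10 r = m.narr 10 r) ∧
      m.nreg 14 ≤ (visit.eval m).nreg 14 := by
  by_cases hv : m.narr 6 (pred y) < 1
  · have e6 : (visit.eval m).narr 6 = Function.update (m.narr 6) (pred y) 1 := by
      simp [visit, block, eval, Cond.holds, after_natLoad, after_natStore, after_natAdd, h3, h7,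
        h17, hv, -Nat.lt_one_iff]
    have e8 : (visit.eval m).narr 8 = Function.update (m.narr 8) (pred y) z := by
      simp [visit, block, eval, Cond.holds, after_natLoad, after_natStore, after_natAdd, h3, h7,
        h15, h17, hv, -Nat.lt_one_iff]
    have e9 : (visit.eval m).narr 9 = Function.update (m.narr 9) (pred y) y := by
      simp [visit, block, eval, Cond.holds, after_natLoad, after_natStore, after_natAdd, h3, h7,
        h17, hv, -Nat.lt_one_iff]
    have e10 : (visit.eval m).narr 10 = Function.update (m.narr 10) (m.nreg 14) (pred y) := by
      simp [visit, block, eval, Cond.holds, after_natLoad, after_natStore, after_natAdd, h3, h7,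
        h17, hv, -Nat.lt_one_iff]
    have e14 : (visit.eval m).nreg 14 = m.nreg 14 + 1 := by
      simp [visit, block, eval, Cond.holds, after_natLoad, after_natStore, after_natAdd, h3, h7,
        h17, hv, -Nat.lt_one_iff]
    unfold TreeIn
    rw [e6, e8, e9, e10, e14]
    refine ⟨Tree.visit ht hy hp hz hA hv, fun x hx => ?_, by simp, fun r hr => ?_, by omega⟩
    · rw [Function.update_apply]; split_ifs <;> simp [hx]
    · exact Function.update_of_ne (by omega) _ _
  · have e : visit.eval m = { m with
        nreg := Function.update (Function.update m.nreg 18 (pred y)) 19 (m.narr 6 (pred y)) } := by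
      simp [visit, block, eval, Cond.holds, after_natLoad, h3, h7, h17, hv, -Nat.lt_one_iff]
    rw [e]
    have := Tree.vis_le ht _ hp
    exact ⟨ht, fun _ h => h, by simp only; omega, fun _ _ => rfl, by simp⟩

/-- A bound for the number of steps that the search has still to make. -/
def scanLeft (C : Net) (nxt : ℕ → ℕ) (q e : ℕ) : ℕ :=
  ∑ v ∈ Finset.range C.n, (C.lim v - nxt v) + (C.N - q) * (C.M + 1) + (C.M - e)

theorem scanLeft_init_le {C : Net} (hC : C.Valid) {nxt : ℕ → ℕ} (hn : ∀ v < C.n, nxt v = C.base v) :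
    scanLeft C nxt 0 C.M ≤ C.N * (C.M + 2) := by
  have h : ∑ v ∈ Finset.range C.n, (C.lim v - nxt v) ≤ C.N := by
    have hd : Set.PairwiseDisjoint (Finset.range C.n : Set ℕ)
        fun v => Finset.Ico (C.base v) (C.lim v) := by
      intro v hv v' hv' hne
      rw [Function.onFun, Finset.disjoint_left]
      intro y hy hy'
      rw [Finset.mem_Ico] at hy hy'
      rw [Finset.mem_coe, Finset.mem_range] at hv hv'
      exact hne ((hC.block v hv y hy.1 hy.2).2.2.symm.trans (hC.block v' hv' y hy'.1 hy'.2).2.2)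
    have h1 := Finset.card_biUnion hd
    have h2 : ((Finset.range C.n).biUnion fun v => Finset.Ico (C.base v) (C.lim v)) ⊆
        Finset.range C.N := by
      intro y hy
      obtain ⟨v, hv, hy⟩ := Finset.mem_biUnion.1 hy
      rw [Finset.mem_Ico] at hy
      exact Finset.mem_range.2 (hC.block v (Finset.mem_range.1 hv) y hy.1 hy.2).2.1
    have h3 := Finset.card_le_card h2
    rw [h1, Finset.card_range] at h3
    refine le_trans (le_of_eq (Finset.sum_congr rfl fun v hv => ?_)) h3
    rw [hn v (Finset.mem_range.1 hv), Nat.card_Ico]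
  unfold scanLeft
  rw [Nat.sub_zero, Nat.sub_self]
  nlinarith

theorem scanLeft_advance {C : Net} {nxt : ℕ → ℕ} {q e v : ℕ} (hv : v < C.n)
    (hl : nxt v < C.lim v) :
    scanLeft C (Function.update nxt v (nxt v + 1)) q e < scanLeft C nxt q e := by
  unfold scanLeft
  have : ∑ u ∈ Finset.range C.n, (C.lim u - Function.update nxt v (nxt v + 1) u) <
      ∑ u ∈ Finset.range C.n, (C.lim u - nxt u) := by
    refine Finset.sum_lt_sum (fun u _ => ?_) ⟨v, Finset.mem_range.2 hv, ?_⟩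
    · rw [Function.update_apply]
      split_ifs with h
      · subst h; omega
      · exact le_rfl
    · rw [Function.update_self]; omega
  omega

theorem scanLeft_dequeue {C : Net} {nxt : ℕ → ℕ} {q : ℕ} (hq : q < C.N) :
    scanLeft C nxt (q + 1) 0 < scanLeft C nxt q C.M := by
  unfold scanLeft
  have : (C.N - q) * (C.M + 1) = (C.N - (q + 1)) * (C.M + 1) + (C.M + 1) := by
    rw [← Nat.succ_mul]; congr 1; omega
  omega

/-- Every step of the search preserves the search tree and the scan invariant; it decreases the
number of steps left, or it ends the search with the queue empty and all edges scanned. -/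
theorem searchBody_spec {C : Net} {pred : ℕ → ℕ} {m : Mem} (hC : C.Valid) (hL : Loaded C m)
    (h7 : m.narr 7 = pred) (hp : ∀ y < C.N, pred y < C.N) (ht : TreeIn C pred m)
    (hs : ScanIn C pred m) :
    TreeIn C pred (searchBody.eval m) ∧ ScanIn C pred (searchBody.eval m) ∧
      (((searchBody.eval m).nreg 16 = m.nreg 16 ∧
        scanLeft C ((searchBody.eval m).narr 5) ((searchBody.eval m).nreg 13)
          ((searchBody.eval m).nreg 8) <
        scanLeft C (m.narr 5) (m.nreg 13) (m.nreg 8)) ∨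
      ((searchBody.eval m).nreg 16 = 0 ∧
        scanLeft C ((searchBody.eval m).narr 5) ((searchBody.eval m).nreg 13)
          ((searchBody.eval m).nreg 8) = scanLeft C (m.narr 5) (m.nreg 13) (m.nreg 8) ∧
        (searchBody.eval m).nreg 8 = C.M ∧
        (searchBody.eval m).nreg 13 = (searchBody.eval m).nreg 14)) := by
  -- Entering a copy and taking a vertex from the queue are followed by a visit.
  have hvisit : ∀ m₁ : Mem, Loaded C m₁ → m₁.narr 7 = pred → TreeIn C pred m₁ →
      m₁.nreg 17 < C.N → (∃ r < m₁.nreg 14, m₁.narr 10 r = m₁.nreg 15) →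
      (m₁.nreg 15 = m₁.nreg 17 ∨ C.Adj (m₁.nreg 15) (m₁.nreg 17)) →
      (∀ vis : ℕ → ℕ, (∀ Q T, (∀ x, m₁.narr 6 x = 1 → vis x = 1) →
        (∀ r < m₁.nreg 14, Q r = m₁.narr 10 r) → m₁.nreg 14 ≤ T → vis (pred (m₁.nreg 17)) = 1 →
        Scan C pred vis Q (m₁.narr 5) (m₁.nreg 13) T (m₁.nreg 15) (m₁.nreg 8))) →
      m₁.nreg 16 = m.nreg 16 → scanLeft C (m₁.narr 5) (m₁.nreg 13) (m₁.nreg 8) <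
        scanLeft C (m.narr 5) (m.nreg 13) (m.nreg 8) → searchBody.eval m = visit.eval m₁ →
      TreeIn C pred (searchBody.eval m) ∧ ScanIn C pred (searchBody.eval m) ∧
      (searchBody.eval m).nreg 16 = m.nreg 16 ∧
        scanLeft C ((searchBody.eval m).narr 5) ((searchBody.eval m).nreg 13)
          ((searchBody.eval m).nreg 8) < scanLeft C (m.narr 5) (m.nreg 13) (m.nreg 8) := by
    intro m₁ hL1 h71 ht1 hy hz hA hS h16 hlt he
    have hF := frame_eval (c := visit) rfl m₁
    obtain ⟨k1, k2, k3, k4, k5⟩ := visit_spec hL1.n3 h71 rfl rfl ht1 hy (hp _ hy) hz hA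
    rw [he, hF.narr 5 rfl, hF.nreg 13 rfl, hF.nreg 8 rfl, hF.nreg 16 rfl]
    refine ⟨k1, ?_, h16, hlt⟩
    unfold ScanIn
    rw [hF.narr 5 rfl, hF.nreg 13 rfl, hF.nreg 8 rfl, hF.nreg 15 rfl]
    exact hS _ _ _ k2 k4 k5 k3
  unfold ScanIn at hs
  by_cases he : m.nreg 8 < C.M
  · have hq := hs.pos he
    have hqT := hs.q_le
    have hzQ : ∃ r < m.nreg 14, m.narr 10 r = m.nreg 15 :=
      ⟨m.nreg 13 - 1, by omega, hs.cur hq⟩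
    have hskip : (C.src (m.nreg 8) = C.own (m.nreg 15) →
          C.Blocked (m.narr 5) (m.nreg 15) (m.nreg 8)) →
        (searchBody.eval m).narr = m.narr → (∀ r, r = 13 ∨ r = 14 ∨ r = 15 ∨ r = 16 →
          (searchBody.eval m).nreg r = m.nreg r) →
        (searchBody.eval m).nreg 8 = m.nreg 8 + 1 →
        TreeIn C pred (searchBody.eval m) ∧ ScanIn C pred (searchBody.eval m) ∧
        (searchBody.eval m).nreg 16 = m.nreg 16 ∧
        scanLeft C ((searchBody.eval m).narr 5) ((searchBody.eval m).nreg 13)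
          ((searchBody.eval m).nreg 8) < scanLeft C (m.narr 5) (m.nreg 13) (m.nreg 8) := by
      intro hb e1 e2 e3
      unfold TreeIn ScanIn
      rw [e1, e2 13 (by simp), e2 14 (by simp), e2 15 (by simp), e2 16 (by simp), e3]
      refine ⟨ht, hs.next_edge he hb, rfl, ?_⟩
      unfold scanLeft
      omega
    suffices h : TreeIn C pred (searchBody.eval m) ∧ ScanIn C pred (searchBody.eval m) ∧
        (searchBody.eval m).nreg 16 = m.nreg 16 ∧
        scanLeft C ((searchBody.eval m).narr 5) ((searchBody.eval m).nreg 13)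
          ((searchBody.eval m).nreg 8) < scanLeft C (m.narr 5) (m.nreg 13) (m.nreg 8) from
      ⟨h.1, h.2.1, .inl h.2.2⟩
    rcases lt_trichotomy (C.src (m.nreg 8)) (C.own (m.nreg 15)) with h1 | h1 | h1
    · refine hskip (fun h => by omega) ?_ ?_ ?_
      · simp [searchBody, block, eval, Cond.holds, after_natLoad, after_natAdd, hL.src, hL.own,
          hL.M, he, h1]
      · rintro r (rfl | rfl | rfl | rfl) <;>
        simp [searchBody, block, eval, Cond.holds, after_natLoad, after_natAdd, hL.src, hL.own,
          hL.M, he, h1]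
      · simp [searchBody, block, eval, Cond.holds, after_natLoad, after_natAdd, hL.src, hL.own,
          hL.M, hL.n3, he, h1]
    · have hdn := hC.dst_lt _ he
      by_cases h2 : m.narr 5 (C.dst (m.nreg 8)) < C.lim (C.dst (m.nreg 8))
      · have hbl := hC.block _ hdn _ (hs.base_le _ hdn) h2
        by_cases h3 : C.val (m.nreg 15) + C.val (m.narr 5 (C.dst (m.nreg 8))) < C.w (m.nreg 8)
        · refine hvisit { m with
            nreg := Function.update (Function.update (Function.update (Function.update
              (Function.update (Function.update m.nreg 9 (C.src (m.nreg 8))) 10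
              (C.own (m.nreg 15))) 11 (C.dst (m.nreg 8))) 17 (m.narr 5 (C.dst (m.nreg 8)))) 18
              (C.lim (C.dst (m.nreg 8)))) 18 (m.narr 5 (C.dst (m.nreg 8)) + 1)
            rreg := Function.update (Function.update (Function.update (Function.update
              m.rreg 6 (C.val (m.nreg 15))) 7 (C.val (m.narr 5 (C.dst (m.nreg 8))))) 6
              (C.val (m.nreg 15) + C.val (m.narr 5 (C.dst (m.nreg 8))))) 7 (C.w (m.nreg 8))
            narr := Function.update m.narr 5 (Function.update (m.narr 5) (C.dst (m.nreg 8))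
              (m.narr 5 (C.dst (m.nreg 8)) + 1)) } ?_ ?_ ?_ ?_ ?_ ?_ ?_ ?_ ?_ ?_
          · constructor <;> simp [hL.n2, hL.n3, hL.M, hL.N, hL.src, hL.dst, hL.base, hL.lim, hL.own,
              hL.w, hL.val]
          · simpa using h7
          · simpa [TreeIn] using ht
          · simpa using hbl.2.1
          · simpa using hzQ
          · right
            simpa using ⟨_, he, h1, hbl.2.2.symm, h3⟩
          · intro vis Q T' k2 k4 k5 k3
            simp at k2 k4 k5 k3
            simpa using (hs.mono k2 k4 k5).advance hC he h2 k3
          · simp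
          · simpa using scanLeft_advance hdn h2
          · simp [searchBody, block, eval, Cond.holds, after_natLoad, after_natAdd, after_realLoad,
              after_realAdd, after_natStore, hL.src, hL.own, hL.dst, hL.lim, hL.val, hL.w, hL.M,
              hL.n3, he, h1, h2, h3]
        · refine hskip (fun _ => .inr (not_lt.1 h3)) ?_ ?_ ?_
          · simp [searchBody, block, eval, Cond.holds, after_natLoad, after_natAdd, after_realLoad,
              after_realAdd, hL.src, hL.own, hL.dst, hL.lim, hL.val, hL.w, hL.M, he, h1, h2, h3]
          · rintro r (rfl | rfl | rfl | rfl) <;>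
            simp [searchBody, block, eval, Cond.holds, after_natLoad, after_natAdd, after_realLoad,
              after_realAdd, hL.src, hL.own, hL.dst, hL.lim, hL.val, hL.w, hL.M, he, h1, h2, h3]
          · simp [searchBody, block, eval, Cond.holds, after_natLoad, after_natAdd, after_realLoad,
              after_realAdd, hL.src, hL.own, hL.dst, hL.lim, hL.val, hL.w, hL.M, hL.n3, he, h1, h2,
              h3]
      · refine hskip (fun _ => .inl ?_) ?_ ?_ ?_
        · have := hs.le_lim _ hdn
          omega
        · simp [searchBody, block, eval, Cond.holds, after_natLoad, after_natAdd, hL.src, hL.own,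
            hL.dst, hL.lim, hL.M, he, h1, h2]
        · rintro r (rfl | rfl | rfl | rfl) <;>
          simp [searchBody, block, eval, Cond.holds, after_natLoad, after_natAdd, hL.src, hL.own,
            hL.dst, hL.lim, hL.M, he, h1, h2]
        · simp [searchBody, block, eval, Cond.holds, after_natLoad, after_natAdd, hL.src, hL.own,
            hL.dst, hL.lim, hL.M, hL.n3, he, h1, h2]
    · refine hskip (fun h => by omega) ?_ ?_ ?_
      · simp [searchBody, block, eval, Cond.holds, after_natLoad, after_natAdd, hL.src, hL.own,
          hL.M, he, h1, h1.not_gt]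
      · rintro r (rfl | rfl | rfl | rfl) <;>
        simp [searchBody, block, eval, Cond.holds, after_natLoad, after_natAdd, hL.src, hL.own,
          hL.M, he, h1, h1.not_gt]
      · simp [searchBody, block, eval, Cond.holds, after_natLoad, after_natAdd, hL.src, hL.own,
          hL.M, hL.n3, he, h1, h1.not_gt]
  · have heM : m.nreg 8 = C.M := by have := hs.e_le; omega
    by_cases hq : m.nreg 13 < m.nreg 14
    · have hQ : m.narr 10 (m.nreg 13) < C.N := Tree.lt ht _ hq
      have h := hvisit { m with
        nreg := Function.update (Function.update (Function.update (Function.update m.nreg 15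
          (m.narr 10 (m.nreg 13))) 13 (m.nreg 13 + 1)) 8 0) 17 (m.narr 10 (m.nreg 13)) }
        ?_ ?_ ?_ ?_ ?_ ?_ ?_ ?_ ?_ ?_
      · exact ⟨h.1, h.2.1, .inl h.2.2⟩
      · constructor <;> simp [hL.n2, hL.n3, hL.M, hL.N, hL.src, hL.dst, hL.base, hL.lim, hL.own,
          hL.w, hL.val]
      · simpa using h7
      · simpa [TreeIn] using ht
      · simpa using hQ
      · simpa using ⟨_, hq, rfl⟩
      · left; simp
      · intro vis Q T' k2 k4 k5 k3
        simp at k2 k4 k5 k3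
        rw [heM] at hs
        have e := k4 _ hq
        rw [← e] at k3
        simpa [e] using (hs.mono k2 k4 k5).dequeue (hq.trans_le k5) k3
      · simp
      · rw [heM]
        simpa using scanLeft_dequeue (hq.trans_le (Tree.card_le ht))
      · simp [searchBody, block, eval, Cond.holds, after_natLoad, after_natAdd, after_natConst,
          hL.M, hL.n2, hL.n3, he, hq]
    · have e : searchBody.eval m = { m with nreg := Function.update m.nreg 16 0 } := by
        simp [searchBody, block, eval, Cond.holds, after_natConst, hL.M, he, hq]
      rw [e]
      refine ⟨by simpa [TreeIn] using ht, by simpa [ScanIn] using hs, .inr ⟨by simp, by simp,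
        by simpa using heM, ?_⟩⟩
      have := hs.q_le
      simp
      omega

end

section

open Cmd Instr

variable {C : Net} {pred : ℕ → ℕ} {m : Mem}

theorem resetSearch_spec (hL : Loaded C m) (h8 : m.nreg 8 = 0) :
    Ex (loop (.natLt 8 7) resetSearchBody) m (C.N * 6 + 2) (fun m' =>
      ∀ y < C.N, m'.narr 6 y = 0 ∧ m'.narr 5 y = C.base y) := by
  refine Ex.loop (T := 4) (fun m' j => ∃ i, i + j = C.N ∧ m'.nreg 8 = i ∧
    ∀ y < i, m'.narr 6 y = 0 ∧ m'.narr 5 y = C.base y) ⟨0, by omega, h8, by omega⟩ ?_ ?_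
  · rintro m₁ j hF ⟨i, hij, h8, hp⟩ hb
    have hL1 := hL.frame hF rfl
    simp only [Cond.holds, h8, hL1.N] at hb
    refine Ex.of_eval (c := resetSearchBody) rfl ⟨j - 1, by omega, i + 1, by omega, ?_,
      fun y hy => ?_⟩
    · simp [resetSearchBody, block, eval, after_natStore, after_natAdd, after_natLoad, h8, hL1.n3]
    · have e6 : (resetSearchBody.eval m₁).narr 6 = Function.update (m₁.narr 6) i 0 := by
        simp [resetSearchBody, block, eval, after_natStore, after_natAdd, after_natLoad, h8, hL1.n2]
      have e5 : (resetSearchBody.eval m₁).narr 5 = Function.update (m₁.narr 5) i (C.base i) := by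
        simp [resetSearchBody, block, eval, after_natStore, after_natAdd, after_natLoad, h8,
          hL1.base]
      rw [e6, e5, Function.update_apply, Function.update_apply]
      split_ifs with h'
      · exact ⟨rfl, by rw [h']⟩
      · exact hp y (by omega)
  · rintro m₁ j hF ⟨i, hij, h8, hp⟩ hb
    have hL1 := hL.frame hF rfl
    simp only [Cond.holds, h8, hL1.N] at hb
    exact fun y hy => hp y (by omega)

/-- The memory holds the search tree of a complete search. -/
def Searched (C : Net) (m : Mem) : Prop :=
  TreeIn C (m.narr 7) m ∧ ∃ z, Scan C (m.narr 7) (m.narr 6) (m.narr 10) (m.narr 5) (m.nreg 14)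
    (m.nreg 14) z C.M

theorem search_spec (hC : C.Valid) (hL : Loaded C m) (hp : ∀ y < C.N, m.narr 7 y < C.N) :
    Ex search m (70 * (C.N + 1) * (C.M + 2)) (fun m' => Frame search m m' ∧ Searched C m') := by
  have hN : 2 ≤ C.N := hC.two_le.trans hC.n_le
  refine Ex.frame (Ex.mono (Ex.seq (Ex.frame (Ex.of_eval (c := op _) rfl
    (Q := fun m₁ => m₁.nreg 8 = 0) (by simp [eval, after_natConst])))
    (T' := C.N * 6 + 2 + (7 + ((C.N * (C.M + 2) + 1) * (50 + 2) + 2 + 0))) ?_) ?_ fun _ h => h)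
  · rintro m₁ ⟨hF1, h8⟩
    have hL1 := hL.frame hF1 rfl
    have h71 := hF1.narr 7 rfl
    refine Ex.seq (Ex.frame (resetSearch_spec hL1 h8)) ?_
    rintro m₂ ⟨hF2, hr⟩
    have hL2 := hL1.frame hF2 rfl
    have h72 := (hF2.narr 7 rfl).trans h71
    refine Ex.seq (T := 7) (Ex.frame (Ex.of_eval (c := block _) rfl (Q := fun m₃ =>
      TreeIn C (m.narr 7) m₃ ∧ ScanIn C (m.narr 7) m₃ ∧ m₃.nreg 16 = 1 ∧
      scanLeft C (m₃.narr 5) (m₃.nreg 13) (m₃.nreg 8) ≤ C.N * (C.M + 2)) ?_)) ?_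
    · have hn : ∀ v < C.n, m₂.narr 5 v = C.base v := fun v hv => (hr v (hv.trans_le hC.n_le)).2
      unfold TreeIn ScanIn
      simp only [block, eval, after_natStore, after_natConst, after_natAdd]
      refine ⟨?_, ?_, ?_, ?_⟩
      · simp [hL2.n2, hL2.n3]
        refine Tree.init (by omega) (fun x hx => ?_) (by simp)
        rw [Function.update_apply]
        split_ifs
        · rfl
        · exact (hr x hx).1
      · simp [hL2.n2, hL2.M]
        exact Scan.init hC hn
      · simp
      · simpa [hL2.n2, hL2.M] using scanLeft_init_le hC hn
    · rintro m₃ ⟨hF3, ht, hs, h16, hle⟩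
      have hL3 := hL2.frame hF3 rfl
      have h73 := (hF3.narr 7 rfl).trans h72
      refine Ex.seq (Q := Searched C) (T' := 0) (Ex.mono (Ex.loop (T := 50) (fun m' j =>
        TreeIn C (m.narr 7) m' ∧ ScanIn C (m.narr 7) m' ∧
        j = scanLeft C (m'.narr 5) (m'.nreg 13) (m'.nreg 8) + m'.nreg 16 ∧
        (m'.nreg 16 = 0 → m'.nreg 8 = C.M ∧ m'.nreg 13 = m'.nreg 14))
        ⟨ht, hs, rfl, by omega⟩ ?_ (Q := Searched C) ?_) ?_ fun _ h => h) ?_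
      · rintro m₄ j hF4 ⟨ht, hs, rfl, -⟩ hb
        have hL4 := hL3.frame hF4 rfl
        have h74 := (hF4.narr 7 rfl).trans h73
        simp only [Cond.holds, hL4.n2] at hb
        obtain ⟨k1, k2, k3⟩ := searchBody_spec hC hL4 h74 hp ht hs
        refine Ex.mono (Ex.of_eval (c := searchBody) rfl ⟨_, ?_, k1, k2, rfl, ?_⟩) (by decide)
          fun _ h => h
        · rcases k3 with k3 | k3 <;> omega
        · rcases k3 with k3 | k3
          · omega
          · exact fun _ => k3.2.2
      · rintro m₄ j hF4 ⟨ht, hs, rfl, hend⟩ hb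
        have hL4 := hL3.frame hF4 rfl
        have h74 := (hF4.narr 7 rfl).trans h73
        simp only [Cond.holds, hL4.n2] at hb
        obtain ⟨h8, h13⟩ := hend (by omega)
        unfold Searched
        rw [h74]
        unfold ScanIn at hs
        rw [h8, h13] at hs
        exact ⟨ht, _, hs⟩
      · have : scanLeft C (m₃.narr 5) (m₃.nreg 13) (m₃.nreg 8) + m₃.nreg 16 ≤
          C.N * (C.M + 2) + 1 := by omega
        exact Nat.add_le_add_right (Nat.mul_le_mul_right _ this) 2
      · exact fun m₅ h => Ex.of_eval (c := block []) rfl h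
  · have : (op (natConst 8 0)).time = 1 := rfl
    rw [this]
    nlinarith [Nat.zero_le (C.N * C.M), Nat.zero_le C.N, Nat.zero_le C.M]

theorem augment_spec (hC : C.Valid) (hL : Loaded C m) (hS : Searched C m)
    (hf : Flow C.N C.Adj (m.narr 7)) (h01 : ¬ C.Adj 0 1) (hv : m.narr 6 1 = 1) :
    Ex augment m (C.N * 6 + 3) (fun m' => Frame augment m m' ∧ Flow C.N C.Adj (m'.narr 7) ∧
      flowValue C.N (m'.narr 7) = flowValue C.N (m.narr 7) + 1) := by
  have hN : 2 ≤ C.N := hC.two_le.trans hC.n_le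
  have ht : TreeIn C (m.narr 7) m := hS.1
  obtain ⟨r₀, hr₀, ha₀⟩ := Tree.augment_init ht hf (by omega) h01 hv
  have hT := Tree.card_le ht
  refine Ex.frame (Ex.mono (Ex.seq (Ex.frame (Ex.of_eval (c := op _) rfl
    (Q := fun m₁ => m₁.nreg 15 = m.narr 8 1) (by simp [eval, after_natLoad, hL.n3])))
    (T' := r₀ * (4 + 2) + 2 + 0) ?_) ?_ fun _ h => h)
  · rintro m₁ ⟨hF1, h15⟩
    have hL1 := hL.frame hF1 rfl
    refine Ex.seq (Ex.loop (T := 4) (fun m' j => j < m.nreg 14 ∧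
      Augment C.N C.Adj (m.narr 7) (m.narr 9) (m.narr 10) (m'.narr 7) (m'.nreg 15) j)
      ⟨hr₀, by rw [h15, hF1.narr 7 rfl]; exact ha₀⟩ ?_
      (Q := fun m' => Flow C.N C.Adj (m'.narr 7) ∧
        flowValue C.N (m'.narr 7) = flowValue C.N (m.narr 7) + 1) ?_) ?_
    · rintro m₂ j hF2 ⟨hj, ha⟩ hb
      have hL2 := hL1.frame hF2 rfl
      simp only [Cond.holds, hL2.n2] at hb
      obtain ⟨r', hr', ha'⟩ := Tree.augment_step ht hj ha (by omega)
      have h8 : m₂.narr 8 = m.narr 8 := (hF2.narr 8 rfl).trans (hF1.narr 8 rfl)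
      have h9 : m₂.narr 9 = m.narr 9 := (hF2.narr 9 rfl).trans (hF1.narr 9 rfl)
      refine Ex.of_eval (c := augmentBody) rfl ⟨r', hr', by omega, ?_⟩
      convert ha' using 1 <;>
        simp [augmentBody, block, eval, after_natLoad, after_natStore, after_natAdd, h8, h9, hL2.n2]
    · rintro m₂ j hF2 ⟨hj, ha⟩ hb
      have hL2 := hL1.frame hF2 rfl
      simp only [Cond.holds, hL2.n2] at hb
      exact ha.done (by omega)
    · exact fun m₅ h => Ex.of_eval (c := block []) rfl h
  · have : (op (natLoad 15 8 3)).time = 1 := rfl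
    rw [this]
    omega

theorem maximize_spec (hC : C.Valid) (hL : Loaded C m) (hf : Flow C.N C.Adj (m.narr 7))
    (h01 : ¬ C.Adj 0 1) {B : ℕ}
    (hB : ∀ pred, Flow C.N C.Adj pred → flowValue C.N pred ≤ B) :
    Ex maximize m (90 * (B + 2) * (C.N + 1) * (C.M + 2)) (fun m' => Frame maximize m m' ∧
      Flow C.N C.Adj (m'.narr 7) ∧ Searched C m' ∧ m'.narr 6 1 ≠ 1) := by
  have hN : 2 ≤ C.N := hC.two_le.trans hC.n_le
  set T := 70 * (C.N + 1) * (C.M + 2) + (1 + (C.N * 6 + 3 + 2 + 0)) with hT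
  refine Ex.frame (Ex.mono (Ex.seq (Ex.frame (Ex.of_eval (c := op _) rfl
    (Q := fun m₁ => m₁.nreg 12 = 1) (by simp [eval, after_natConst])))
    (T' := (B + 1) * (T + 2) + 2 + 0) ?_) ?_ fun _ h => h)
  · rintro m₁ ⟨hF1, h12⟩
    have hL1 := hL.frame hF1 rfl
    have h71 := hF1.narr 7 rfl
    refine Ex.seq (Ex.mono (Ex.loop (T := T) (k₀ := B - flowValue C.N (m₁.narr 7) + m₁.nreg 12)
      (fun m' j => Flow C.N C.Adj (m'.narr 7) ∧
      m'.nreg 12 ≤ 1 ∧ (m'.nreg 12 = 0 → Searched C m' ∧ m'.narr 6 1 ≠ 1) ∧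
      j = B - flowValue C.N (m'.narr 7) + m'.nreg 12)
      ⟨h71 ▸ hf, by omega, by omega, rfl⟩ ?_ (Q := fun m' => Flow C.N C.Adj (m'.narr 7) ∧
        Searched C m' ∧ m'.narr 6 1 ≠ 1) ?_) ?_ fun _ h => h) ?_
    · rintro m₂ j hF2 ⟨hf, hle, -, rfl⟩ hb
      have hL2 := hL1.frame hF2 rfl
      simp only [Cond.holds, hL2.n2] at hb
      refine Ex.seq (search_spec hC hL2 hf.lt) ?_
      rintro m₃ ⟨hF3, hS⟩
      have hL3 := hL2.frame hF3 rfl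
      have h73 : m₃.narr 7 = m₂.narr 7 := hF3.narr 7 rfl
      have hvis : m₃.narr 6 1 ≤ 1 := Tree.vis_le hS.1 1 (by omega)
      refine Ex.seq (T := 1) (Ex.of_eval (c := op _) rfl (Q := fun m₄ => m₄ = { m₃ with
        nreg := Function.update m₃.nreg 12 (m₃.narr 6 1) })
        (by simp [eval, after_natLoad, hL3.n3])) ?_
      rintro m₄ rfl
      refine Ex.seq (T := C.N * 6 + 3 + 2) (Ex.cond (fun hh => ?_) fun hh => ?_)
        (Q := fun m' => ∃ k' < B - flowValue C.N (m₂.narr 7) + m₂.nreg 12,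
          Flow C.N C.Adj (m'.narr 7) ∧ m'.nreg 12 ≤ 1 ∧
          (m'.nreg 12 = 0 → Searched C m' ∧ m'.narr 6 1 ≠ 1) ∧
          k' = B - flowValue C.N (m'.narr 7) + m'.nreg 12)
        fun m₅ h => Ex.of_eval (c := block []) rfl h
      · simp [Cond.holds, hL3.n2] at hh
        have hL4 : Loaded C { m₃ with nreg := Function.update m₃.nreg 12 (m₃.narr 6 1) } := by
          constructor <;> simp [hL3.n2, hL3.n3, hL3.M, hL3.N, hL3.src, hL3.dst, hL3.base, hL3.lim,
            hL3.own, hL3.w, hL3.val]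
        have hS4 : Searched C { m₃ with nreg := Function.update m₃.nreg 12 (m₃.narr 6 1) } := by
          simpa [Searched, TreeIn] using hS
        refine Ex.mono (augment_spec hC hL4 hS4 (by simpa [h73] using hf) h01
          (by simp only; omega)) le_rfl ?_
        rintro m₅ ⟨hF5, hf5, hv5⟩
        have e12 : m₅.nreg 12 = m₃.narr 6 1 := by rw [hF5.nreg 12 rfl]; simp
        simp only [h73] at hv5
        have := hB _ hf5
        exact ⟨_, by omega, hf5, by omega, by omega, rfl⟩
      · simp [Cond.holds, hL3.n2] at hh
        refine Ex.mono (Ex.of_eval (c := skip) rfl (Q := fun m' => _) ⟨_, ?_, ?_, ?_, ?_, rfl⟩)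
          (Nat.zero_le _) fun _ h => h
        · simp [eval, h73, hh]; omega
        · simpa [eval, h73] using hf
        · simp [eval, hh]
        · intro _
          simp only [eval]
          exact ⟨by simpa [Searched, TreeIn] using hS, by omega⟩
    · rintro m₂ j hF2 ⟨hf, hle, hend, rfl⟩ hb
      have hL2 := hL1.frame hF2 rfl
      simp only [Cond.holds, hL2.n2] at hb
      exact ⟨hf, hend (by omega)⟩
    · exact Nat.add_le_add_right (Nat.mul_le_mul_right _ (by omega)) 2
    · exact fun m₅ h => Ex.of_eval (c := block []) rfl h
  · have : (op (natConst 12 1)).time = 1 := rfl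
    rw [this, hT]
    nlinarith [Nat.zero_le (C.N * C.M), Nat.zero_le C.N, Nat.zero_le C.M,
      Nat.zero_le (B * (C.N * C.M)), Nat.zero_le (B * C.N), Nat.zero_le (B * C.M), Nat.zero_le B]

/-! ### The output -/

/-- Adds the power of one copy to that of its vertex if the copy is in the cut. -/
def collectBody : Cmd := block [
  op (natLoad 9 6 8),
  cond (.natLt 9 3)
    (block [op (natLoad 10 4 8), op (natLoad 11 5 10),
      cond (.natLt 8 11)
        (block [op (natSub 10 10 4), op (realLoad 6 1 10), op (realAdd 6 6 1),
          op (realStore 1 10 6)])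
        skip])
    skip,
  op (natAdd 8 8 3)]

/-- Adds up the powers of the copies in the cut. -/
def collect : Cmd := block [op (natConst 8 2), loop (.natLt 8 7) collectBody]

theorem collect_spec {α : ℝ} (hL : Loaded C m) (h4 : m.nreg 4 = 2) (hα : m.rreg 1 = α)
    (h2N : 2 ≤ C.N) (hown : ∀ y, 2 ≤ y → y < C.N → 2 ≤ C.own y) (h0 : ∀ v, m.rarr 1 v = 0) :
    Ex collect m (20 * C.N + 10) (fun m' => ∀ v, m'.rarr 1 v =
      ((cutIds C (m.narr 6) (m.narr 5)).filter fun y => C.own y = v + 2).card * α) := by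
  set K := cutIds C (m.narr 6) (m.narr 5) with hK
  refine Ex.mono (Ex.seq (Ex.frame (Ex.of_eval (c := op _) rfl
    (Q := fun m₁ => m₁.nreg 8 = 2) (by simp [eval, after_natConst])))
    (T' := (C.N - 2) * (14 + 2) + 2 + 0) ?_) ?_ fun _ h => h
  · rintro m₁ ⟨hF1, h8⟩
    have hL1 := hL.frame hF1 rfl
    refine Ex.seq (Ex.loop (T := 14) (fun m' j => ∃ i, i + j = C.N ∧ 2 ≤ i ∧ m'.nreg 8 = i ∧
      ∀ v, m'.rarr 1 v = ((K.filter fun y => C.own y = v + 2).filter fun y => y < i).card * α)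
      ⟨2, by omega, le_rfl, h8, fun v => ?_⟩ ?_ (Q := fun m' => ∀ v, m'.rarr 1 v =
      (K.filter fun y => C.own y = v + 2).card * α) ?_)
      fun m₅ h => Ex.of_eval (c := block []) rfl h
    · rw [hF1.rarr 1 rfl, h0, Finset.filter_eq_empty_iff.2]
      · simp
      · intro y hy
        have := (Finset.mem_Ico.1 (Finset.mem_filter.1 (Finset.mem_filter.1 hy).1).1).1
        omega
    · rintro m₂ j hF2 ⟨i, hij, h2i, h8, hp⟩ hb
      have hL2 := hL1.frame hF2 rfl
      simp only [Cond.holds, h8, hL2.N] at hb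
      have h6 : m₂.narr 6 = m.narr 6 := (hF2.narr 6 rfl).trans (hF1.narr 6 rfl)
      have h5 : m₂.narr 5 = m.narr 5 := (hF2.narr 5 rfl).trans (hF1.narr 5 rfl)
      have h4' : m₂.nreg 4 = 2 := (hF2.nreg 4 rfl).trans ((hF1.nreg 4 rfl).trans h4)
      have hα' : m₂.rreg 1 = α := (hF2.rreg 1 rfl).trans ((hF1.rreg 1 rfl).trans hα)
      have hmem : i ∈ K ↔ m.narr 6 i < 1 ∧ i < m.narr 5 (C.own i) := by
        simp [hK, cutIds, h2i, hb]
      have hsucc : ∀ v, (K.filter fun y => C.own y = v + 2).filter (fun y => y < i + 1) =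
          if i ∈ K ∧ C.own i = v + 2 then
            insert i ((K.filter fun y => C.own y = v + 2).filter fun y => y < i)
          else (K.filter fun y => C.own y = v + 2).filter fun y => y < i := by
        intro v
        split_ifs with h <;> ext y <;> simp only [Finset.mem_filter, Finset.mem_insert]
        · constructor
          · rintro ⟨h1, h2⟩
            rcases Nat.lt_succ_iff_lt_or_eq.1 h2 with h2 | rfl
            · exact .inr ⟨h1, h2⟩
            · exact .inl rfl
          · rintro (rfl | ⟨h1, h2⟩)
            · exact ⟨h, by omega⟩
            · exact ⟨h1, by omega⟩
        · constructor
          · rintro ⟨h1, h2⟩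
            rcases Nat.lt_succ_iff_lt_or_eq.1 h2 with h2 | rfl
            · exact ⟨h1, h2⟩
            · exact absurd h1 h
          · exact fun ⟨h1, h2⟩ => ⟨h1, by omega⟩
      have hown2 := hown i h2i hb
      have key : (collectBody.eval m₂).nreg 8 = i + 1 ∧ (collectBody.eval m₂).rarr 1 =
          if i ∈ K then Function.update (m₂.rarr 1) (C.own i - 2) (m₂.rarr 1 (C.own i - 2) + α)
          else m₂.rarr 1 := by
        simp only [hmem]
        by_cases ha : m.narr 6 i < 1 <;> by_cases hb : i < m.narr 5 (C.own i) <;>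
          simp [collectBody, block, eval, Cond.holds, after_natLoad, after_natSub, after_natAdd,
            after_realLoad, after_realAdd, after_realStore, h8, h6, h5, h4', hα', hL2.n3, hL2.own,
            ha, hb, -Nat.lt_one_iff]
      refine Ex.mono (Ex.of_eval (c := collectBody) rfl ⟨j - 1, by omega, i + 1, by omega, by omega,
        key.1, fun v => ?_⟩) (by decide) fun _ h => h
      rw [key.2, hsucc]
      by_cases hiK : i ∈ K
      · by_cases hov : C.own i = v + 2
        · rw [if_pos hiK, if_pos ⟨hiK, hov⟩, Finset.card_insert_of_notMem (by simp), hov,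
            Nat.add_sub_cancel, Function.update_self, hp]
          push_cast
          ring
        · rw [if_pos hiK, if_neg (fun h => hov h.2), Function.update_of_ne (by omega), hp]
      · rw [if_neg hiK, if_neg (fun h => hiK h.1), hp]
    · rintro m₂ j hF2 ⟨i, hij, h2i, h8, hp⟩ hb v
      have hL2 := hL1.frame hF2 rfl
      simp only [Cond.holds, h8, hL2.N] at hb
      rw [hp, Finset.filter_true_of_mem]
      intro y hy
      have := (Finset.mem_Ico.1 (Finset.mem_filter.1 (Finset.mem_filter.1 hy).1).1).2
      omega
  · have : (op (natConst 8 2)).time = 1 := rfl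
    rw [this]
    omega

end

/-! ### The whole program -/

section

open Cmd Instr

section

variable {k : ℕ} {I : Instance (Fin k)} {L : List (Vert (Fin k) × Vert (Fin k))} {ε : ℝ}

theorem IsEdgeList.length_eq (h : IsEdgeList I L) : L.length = size I := by
  classical
  rw [size, ← List.length_map (as := L) (f := fun e => s(e.1, e.2)),
    ← List.toFinset_card_of_nodup h.1, ← Set.ncard_coe_finset]
  congr 1
  ext e
  simpa using (h.2 e)

theorem size_le (I : Instance (Fin k)) : size I ≤ (k + 2) ^ 2 := by
  have h1 : size I ≤ Nat.card (Sym2 (Vert (Fin k))) := by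
    have := Set.ncard_le_ncard (Set.subset_univ I.graph.edgeSet)
    rwa [Set.ncard_univ] at this
  have h2 : Nat.card (Sym2 (Vert (Fin k))) ≤ Nat.card (Vert (Fin k) × Vert (Fin k)) :=
    Nat.card_le_card_of_surjective (fun p => s(p.1, p.2))
      (fun e => e.inductionOn fun x y => ⟨(x, y), rfl⟩)
  have h3 : Nat.card (Vert (Fin k)) = k + 2 := by
    have := order_eq (Fin k)
    rwa [Fintype.card_fin] at this
  rw [Nat.card_prod, h3] at h2
  rw [sq]
  exact h1.trans h2

theorem code_lt (x : Vert (Fin k)) : code x < k + 2 := by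
  rcases x with _ | _ | x <;> simp [code]

theorem initial_edge (hL : IsEdgeList I L) {e : ℕ} (he : e < L.length) :
    ∃ x y, I.graph.Adj x y ∧ (initial I L ε).narr 0 e = code x ∧
      (initial I L ε).narr 1 e = code y ∧ (initial I L ε).rarr 0 e = I.weight s(x, y) := by
  have hmem : s(L[e].1, L[e].2) ∈ I.graph.edgeSet :=
    (hL.2 _).1 (List.mem_map.2 ⟨L[e], List.getElem_mem he, rfl⟩)
  refine ⟨L[e].1, L[e].2, by simpa using hmem, ?_, ?_, ?_⟩ <;> simp [initial, he]

/-- The arrays `S`, `D`, `W` and `H` list every edge in both directions. -/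
structure EdgeArrays (I : Instance (Fin k)) (M : ℕ) (S D : ℕ → ℕ) (W H : ℕ → ℝ) : Prop where
  edge : ∀ e < M, ∃ x y, I.graph.Adj x y ∧ S e = code x ∧ D e = code y ∧
    W e = I.weight s(x, y) ∧ H e = halfWeight (code x) (code y) (I.weight s(x, y))
  exists_edge : ∀ x y, I.graph.Adj x y → ∃ e < M, S e = code x ∧ D e = code y

theorem Prepared.edgeArrays (hL : IsEdgeList I L) {m : Mem}
    (h : Prepared ((initial I L ε).narr 0) ((initial I L ε).narr 1) ((initial I L ε).rarr 0)
      L.length L.length m) :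
    EdgeArrays I (L.length + L.length) (m.narr 0) (m.narr 1) (m.rarr 0) (m.rarr 2) := by
  refine ⟨fun e he => ?_, fun x y hxy => ?_⟩
  · rcases Nat.lt_or_ge e L.length with h1 | h1
    · obtain ⟨x, y, hxy, hs, hd, hw⟩ := initial_edge (ε := ε) hL h1
      refine ⟨x, y, hxy, (h.src e h1).trans hs, (h.dst e h1).trans hd, (h.w e h1).trans hw, ?_⟩
      rw [h.half e h1, hs, hd, hw]
    · obtain ⟨i, rfl⟩ := Nat.exists_eq_add_of_le' h1
      have hi : i < L.length := by omega
      obtain ⟨x, y, hxy, hs, hd, hw⟩ := initial_edge (ε := ε) hL hi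
      refine ⟨y, x, hxy.symm, (h.src' i hi).trans hd, (h.dst' i hi).trans hs, ?_, ?_⟩
      · rw [h.w' i hi, hw, Sym2.eq_swap]
      · rw [h.half' i hi, hs, hd, hw, halfWeight_comm, Sym2.eq_swap]
  · have hmem := (hL.2 s(x, y)).2 hxy
    obtain ⟨a, ha, hab⟩ := List.mem_map.1 hmem
    obtain ⟨e, he, rfl⟩ := List.mem_iff_getElem.1 ha
    have hs : (initial I L ε).narr 0 e = code L[e].1 := by simp [initial, he]
    have hd : (initial I L ε).narr 1 e = code L[e].2 := by simp [initial, he]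
    rcases Sym2.eq_iff.1 hab with ⟨h1, h2⟩ | ⟨h1, h2⟩
    · exact ⟨e, by omega, by rw [h.src e he, hs, h1], by rw [h.dst e he, hd, h2]⟩
    · exact ⟨e + L.length, by omega, by rw [h.src' e he, hd, h2], by rw [h.dst' e he, hs, h1]⟩

/-- The bottleneck value of an edge is the uniform power that removes it. An edge between the
terminals has weight `0`, and is removed by every power. -/
theorem lt_halfWeight_iff (hI : ∃ p, Feasible I p) {x : ℝ} (hx : 0 ≤ x) {u v : Vert (Fin k)}
    (huv : I.graph.Adj u v) :
    extend (fun _ => x) u + extend (fun _ => x) v < I.weight s(u, v) ↔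
      x < halfWeight (code u) (code v) (I.weight s(u, v)) := by
  have hst := weight_terminals hI
  have e0 : ∀ b w, halfWeight 0 b w = w := fun b w => if_pos two_pos
  have e1 : ∀ b w, halfWeight 1 b w = w := fun b w => if_pos one_lt_two
  have e2 : ∀ a b w, halfWeight (a + 2) (b + 2) w = w / 2 := fun a b w => by
    rw [halfWeight, if_neg (by omega), if_neg (by omega)]
  rcases u with _ | _ | u <;> rcases v with _ | _ | v <;>
    simp only [extend, code, zero_add, add_zero, e0, e1, e2, halfWeight_comm _ 0,
      halfWeight_comm _ 1]
  · exact absurd huv (I.graph.loopless.irrefl _)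
  · have := hst huv
    constructor <;> intro <;> linarith
  · have := hst huv.symm
    rw [Sym2.eq_swap] at this
    constructor <;> intro <;> linarith
  · exact absurd huv (I.graph.loopless.irrefl _)
  · constructor <;> intro <;> linarith

variable {M : ℕ} {S D : ℕ → ℕ} {W H : ℕ → ℝ}

theorem EdgeArrays.feasible_of_separates (h : EdgeArrays I M S D W H) (hI : ∃ p, Feasible I p)
    {x : ℝ} (hx : 0 ≤ x) {R : Set ℕ} (hR : Separates M S D H x R) :
    Feasible I fun _ => x := by
  refine ⟨fun _ => hx, not_reachable_of_closed {v | code v ∈ R} hR.source hR.sink ?_⟩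
  intro u hu v huv
  obtain ⟨e, he, hs, hd⟩ := h.exists_edge u v huv.1
  obtain ⟨u', v', -, hs', hd', -, hH⟩ := h.edge e he
  obtain rfl := code_injective (hs.symm.trans hs')
  obtain rfl := code_injective (hd.symm.trans hd')
  have hlt := (lt_halfWeight_iff hI hx huv.1).1 (not_le.1 huv.2)
  rw [← hH] at hlt
  have := hR.closed e he (by rw [hs]; exact hu) hlt
  rwa [hd] at this

theorem EdgeArrays.exists_separates (h : EdgeArrays I M S D W H)
    {x : ℝ} (hx : 0 ≤ x) (hf : Feasible I fun _ => x) : ∃ R, Separates M S D H x R := by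
  refine ⟨code '' {v | (remaining I fun _ => x).Reachable Vert.s v}, ⟨_, .refl _, rfl⟩, ?_, ?_⟩
  · rintro ⟨v, hv, hv1⟩
    have : v = Vert.t := code_injective hv1
    exact hf.2 (this ▸ hv)
  · rintro e he ⟨u', hu, hu'⟩ hlt
    obtain ⟨u, v, huv, hs, hd, -, hH⟩ := h.edge e he
    obtain rfl := code_injective (hu'.trans hs)
    rw [hH, ← lt_halfWeight_iff ⟨_, hf⟩ hx huv] at hlt
    have hadj : (remaining I fun _ => x).Adj u' v := ⟨huv, not_le.2 hlt⟩
    exact ⟨v, hu.trans hadj.reachable, hd.symm⟩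

/-- The least separating value is the bottleneck optimum, as separations correspond to the feasible
uniform powers. -/
theorem EdgeArrays.eq_bottleneck (h : EdgeArrays I M S D W H) (hI : ∃ p, Feasible I p) {x : ℝ}
    (hx : 0 ≤ x) (hR : ∃ R, Separates M S D H x R)
    (hle : ∀ y, 0 ≤ y → ∀ R, Separates M S D H y R → x ≤ y) : x = bottleneck I := by
  obtain ⟨R, hR⟩ := hR
  have hb := isLeast_bottleneck hI
  refine le_antisymm ?_ (hb.2 ⟨hx, h.feasible_of_separates hI hx hR⟩)
  obtain ⟨R', hR'⟩ := h.exists_separates hb.1.1 hb.1.2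
  exact hle _ hb.1.1 R' hR'

/-- The approximation scheme. -/
def scheme : Cmd := block [prepare, widest, discretize, layout, maximize, collect]

/-- The sum of the time bounds of the six parts of the program; the product in the bound is that of
`c` augmentations, `n c` vertices and `m` edges. -/
theorem scheme_time {n c l N : ℕ} (hn : 2 ≤ n) (hnc : n ≤ c) (hl : l ≤ c) (hN : N ≤ n * c) :
    30 * l + 30 + (20 * (n + 1) * (l + l + 1) * (l + l + 1) + (n * 4 + c * 4 + 12 +
      (40 * (n + 1) * (c + 1) + (90 * (c + 2) * (N + 1) * (l + l + 2) + (20 * N + 10 + 0))))) ≤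
      5000 * (n * c ^ 2 * max l 1) := by
  set q := max l 1 with hq
  have hq1 : 1 ≤ q := le_max_right _ _
  have hlq : l ≤ q := le_max_left _ _
  have hqc : q ≤ c := max_le hl (by omega)
  set X := n * c ^ 2 * q with hX
  have h1 : n * c * q ≤ X := by
    rw [hX, sq]
    exact Nat.mul_le_mul_right _ (Nat.mul_le_mul_left _ (Nat.le_mul_of_pos_left _ (by omega)))
  have h2 : n * c ≤ n * c * q := Nat.le_mul_of_pos_right _ (by omega)
  have h3 : c ≤ n * c := Nat.le_mul_of_pos_left _ (by omega)
  have e1 : 20 * (n + 1) * (l + l + 1) * (l + l + 1) ≤ 360 * X := by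
    calc 20 * (n + 1) * (l + l + 1) * (l + l + 1) ≤ 20 * (n + n) * (q + q + q) * (c + c + c) := by
          gcongr <;> omega
      _ = 360 * (n * c * q) := by ring
      _ ≤ 360 * X := by omega
  have e2 : 40 * (n + 1) * (c + 1) ≤ 160 * X := by
    calc 40 * (n + 1) * (c + 1) ≤ 40 * (n + n) * (c + c) := by gcongr <;> omega
      _ = 160 * (n * c) := by ring
      _ ≤ 160 * X := by omega
  have e3 : 90 * (c + 2) * (N + 1) * (l + l + 2) ≤ 1440 * X := by
    calc 90 * (c + 2) * (N + 1) * (l + l + 2) ≤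
          90 * (c + c) * (n * c + n * c) * (q + q + (q + q)) := by gcongr <;> omega
      _ = 1440 * X := by rw [hX]; ring
  omega

theorem scheme_spec (hI : ∃ p, Feasible I p) (hL : IsEdgeList I L) (h0 : 0 < ε) (h1 : ε ≤ 1) :
    Ex scheme (initial I L ε).mem
      (5000 * ((k + 2) * copies (Fin k) ε ^ 2 * max (size I) 1)) (fun m =>
      ∃ K, IsMinVertexCut (discreteGraph I ε) K ∧
        (fun v : Fin k => m.rarr 1 v) = cutPowers I ε K) := by
  have hord : order (Fin k) = k + 2 := by rw [order_eq, Fintype.card_fin]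
  set c := copies (Fin k) ε with hc
  have hcpos : 0 < c := copies_pos (Fin k) h0
  have hcsq : (k + 2) ^ 2 ≤ c := by
    have : (((k + 2) ^ 2 : ℕ) : ℝ) ≤ (order (Fin k) : ℝ) ^ 2 / ε := by
      rw [hord, le_div_iff₀ h0]
      push_cast
      nlinarith [sq_nonneg ((k : ℝ) + 2)]
    exact Nat.cast_le.1 (this.trans (Nat.le_ceil _))
  have hlen := hL.length_eq
  set l := L.length with hl
  have hlc : l ≤ c := hlen ▸ (size_le I).trans hcsq
  rw [← hlen]
  refine Ex.mono (Ex.seq (prepare_spec (l := l) (by simp [initial, State.mem, hl])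
    (by simp [initial, State.mem]) (by simp [initial, State.mem]) (by simp [initial, State.mem])
    ?_ (by simp [initial, State.mem])) ?_)
    (scheme_time (n := k + 2) (c := c) (l := l) (N := 2 + k * c) (by omega) (by nlinarith) hlc
      (by nlinarith)) fun _ h => h
  · intro e he
    obtain ⟨x, y, hxy, -, -, hw⟩ := initial_edge (ε := ε) hL he
    change 0 ≤ (initial I L ε).rarr 0 e
    rw [hw]
    exact I.weight_nonneg _ hxy
  rintro m₁ ⟨hF1, hc1, h5, hP, b, hb0, hr4, hb⟩
  have hE := Prepared.edgeArrays (ε := ε) hL hP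
  have hDn : ∀ e < l + l, m₁.narr 1 e < k + 2 := by
    intro e he
    obtain ⟨x, y, -, -, hd, -, -⟩ := hE.edge e he
    rw [hd]
    exact code_lt y
  have hHb : ∀ e < l + l, m₁.rarr 2 e < b := by
    intro e he
    rcases Nat.lt_or_ge e l with h | h
    · rw [hP.half e h]; exact hb e h
    · obtain ⟨i, rfl⟩ := Nat.exists_eq_add_of_le' h
      rw [hP.half' i (by omega)]
      exact hb i (by omega)
  refine Ex.seq (widest_spec (n := k + 2) hc1 h5 rfl rfl rfl hb0 hr4 hDn hHb) ?_
  rintro m₂ ⟨hF2, hp0, hpR, hple⟩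
  have hpstar := hE.eq_bottleneck hI hp0 hpR hple
  have hc2 : Consts m₂ := ⟨(hF2.nreg 2 rfl).trans hc1.n2, (hF2.nreg 3 rfl).trans hc1.n3,
    (hF2.nreg 4 rfl).trans hc1.n4, (hF2.rreg 2 rfl).trans hc1.r2, (hF2.rreg 3 rfl).trans hc1.r3⟩
  have hn2 : m₂.nreg 0 = k + 2 := by
    rw [hF2.nreg 0 rfl, hF1.nreg 0 rfl]; simp [initial, State.mem]
  have hε2 : m₂.rreg 0 = ε := by
    rw [hF2.rreg 0 rfl, hF1.rreg 0 rfl]; simp [initial, State.mem]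
  have hdis := discretize_spec hc2 hn2
  rw [hε2, hpstar, ← hord, ← copies, ← unit, hord, ← hc] at hdis
  refine Ex.seq hdis ?_
  rintro m₃ ⟨hF3, h6, hα⟩
  have hc3 : Consts m₃ := ⟨(hF3.nreg 2 rfl).trans hc2.n2, (hF3.nreg 3 rfl).trans hc2.n3,
    (hF3.nreg 4 rfl).trans hc2.n4, (hF3.rreg 2 rfl).trans hc2.r2, (hF3.rreg 3 rfl).trans hc2.r3⟩
  have hlay := layout_spec hc3 ((hF3.nreg 0 rfl).trans hn2) h6 hα
    (fun v => by rw [hF3.narr 2 rfl, hF2.narr 2 rfl, hF1.narr 2 rfl]; simp [initial, State.mem])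
    (fun v => by rw [hF3.narr 3 rfl, hF2.narr 3 rfl, hF1.narr 3 rfl]; simp [initial, State.mem])
    (fun v => by rw [hF3.narr 4 rfl, hF2.narr 4 rfl, hF1.narr 4 rfl]; simp [initial, State.mem])
    (fun v => by rw [hF3.rarr 3 rfl, hF2.rarr 3 rfl, hF1.rarr 3 rfl]; simp [initial, State.mem])
  refine Ex.seq (hlay.mono (T' := 40 * (k + 2 + 1) * (c + 1)) (by gcongr; omega) fun _ h => h) ?_
  rintro m₄ ⟨hF4, h7, hLay, hpred⟩
  -- The network in the memory is now complete.
  let C : Net := ⟨k + 2, 2 + k * c, l + l, m₄.narr 0, m₄.narr 1, m₄.narr 4, m₄.narr 2, m₄.narr 3,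
    m₄.rarr 0, m₄.rarr 3⟩
  have f0 : m₄.narr 0 = m₁.narr 0 := by rw [hF4.narr 0 rfl, hF3.narr 0 rfl, hF2.narr 0 rfl]
  have f1 : m₄.narr 1 = m₁.narr 1 := by rw [hF4.narr 1 rfl, hF3.narr 1 rfl, hF2.narr 1 rfl]
  have f2 : m₄.rarr 0 = m₁.rarr 0 := by rw [hF4.rarr 0 rfl, hF3.rarr 0 rfl, hF2.rarr 0 rfl]
  have hload : Loaded C m₄ := by
    refine ⟨(hF4.nreg 2 rfl).trans hc3.n2, (hF4.nreg 3 rfl).trans hc3.n3, ?_, h7, rfl, rfl, rfl,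
      rfl, rfl, rfl, rfl⟩
    rw [hF4.nreg 5 rfl, hF3.nreg 5 rfl, hF2.nreg 5 rfl, h5]
  have hvalid : C.Valid := hLay.valid (C := C) (unit_nonneg hI h0) hcpos rfl rfl
    fun e he => by
      change m₄.narr 1 e < k + 2
      rw [f1]
      exact hDn e he
  have henc : C.Encodes I (unit I ε) c := by
    refine ⟨rfl, ?_, ?_, fun e he => ?_, fun x y hxy => ?_⟩
    · rintro (_ | _ | ⟨v, i⟩)
      · exact hLay.own_zero
      · exact hLay.own_one
      · exact (hLay.own_eq v i (.inl ⟨v.2, i.2⟩)).trans (add_comm _ _)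
    · rintro (_ | _ | ⟨v, i⟩)
      · exact hLay.val_zero
      · exact hLay.val_one
      · exact hLay.val_eq v i (.inl ⟨v.2, i.2⟩)
    · obtain ⟨x, y, hxy, hs, hd, hw, -⟩ := hE.edge e he
      exact ⟨x, y, hxy, (congrFun f0 e).trans hs, (congrFun f1 e).trans hd,
        (congrFun f2 e).trans hw⟩
    · obtain ⟨e, he, hs, hd⟩ := hE.exists_edge x y hxy
      exact ⟨e, he, (congrFun f0 e).trans hs, (congrFun f1 e).trans hd⟩
  obtain ⟨K₀, hK₀, hlt⟩ := exists_small_cut hI h0 h1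
  refine Ex.seq (maximize_spec hvalid hload (Flow.of_eq_self (Nat.le_add_right _ _) hpred)
    (henc.not_adj_zero_one hI) (B := c) fun pred hf => (henc.value_le hI hf hK₀).trans hlt.le) ?_
  rintro m₅ ⟨hF5, hf, ⟨ht, z, hS⟩, hv⟩
  have hown : ∀ y, 2 ≤ y → y < C.N → 2 ≤ C.own y := by
    intro y h2 hy
    obtain ⟨x, rfl⟩ := exists_vid h2 hy
    rw [henc.own_eq]
    simp [proj, code]
  refine Ex.seq (collect_spec (α := unit I ε) (hload.frame hF5 rfl) ?_ ?_ (Nat.le_add_right _ _)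
    hown fun v => ?_) fun m₆ hout => Ex.of_eval (c := block []) rfl
      ⟨_, henc.isMinVertexCut hvalid hI hf ht hS hv, funext fun v => ?_⟩
  · rw [hF5.nreg 4 rfl, hF4.nreg 4 rfl]; exact hc3.n4
  · rw [hF5.rreg 1 rfl, hF4.rreg 1 rfl]; exact hα
  · rw [hF5.rarr 1 rfl, hF4.rarr 1 rfl, hF3.rarr 1 rfl, hF2.rarr 1 rfl, hF1.rarr 1 rfl]
    simp [initial, State.mem]
  · rw [henc.cutPowers_eq]
    exact hout v

/-- The running time of the program is `O(n⁵ max(m, 1) / ε²)`. -/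
theorem scheme_halts (hI : ∃ p, Feasible I p) (hL : IsEdgeList I L) (h0 : 0 < ε) (h1 : ε ≤ 1)
    {B : ℝ} (hB : 20000 * ((order (Fin k) : ℝ) ^ 5 * max (size I : ℝ) 1 * (1 / ε) ^ 2) ≤ B) :
    ∃ σ, HaltsWithin (scheme.code 0) (initial I L ε) B σ ∧
      ∃ K, IsMinVertexCut (discreteGraph I ε) K ∧ output k σ = cutPowers I ε K := by
  refine (scheme_spec hI hL h0 h1).haltsWithin rfl (le_trans ?_ hB)
  have hord : (order (Fin k) : ℝ) = k + 2 := by rw [order_eq, Fintype.card_fin]; push_cast; ring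
  have hc : (copies (Fin k) ε : ℝ) ≤ 2 * ((order (Fin k) : ℝ) ^ 2 * (1 / ε)) := by
    have h2 : (1 : ℝ) ≤ (order (Fin k) : ℝ) ^ 2 / ε := by
      rw [le_div_iff₀ h0, hord]
      nlinarith [(Nat.cast_nonneg k : (0 : ℝ) ≤ k)]
    have := Nat.ceil_lt_add_one (a := (order (Fin k) : ℝ) ^ 2 / ε) (by positivity)
    unfold copies
    rw [mul_one_div]
    linarith
  push_cast
  rw [← hord]
  calc 5000 * ((order (Fin k) : ℝ) * (copies (Fin k) ε : ℝ) ^ 2 * max (size I : ℝ) 1)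
      ≤ 5000 * ((order (Fin k) : ℝ) * (2 * ((order (Fin k) : ℝ) ^ 2 * (1 / ε))) ^ 2 *
        max (size I : ℝ) 1) := by gcongr
    _ = 20000 * ((order (Fin k) : ℝ) ^ 5 * max (size I : ℝ) 1 * (1 / ε) ^ 2) := by ring

end

theorem runsAlgorithm_scheme : RunsAlgorithm (scheme.code 0) fun n m ε =>
    20000 * (n : ℝ) ^ (5.5 : ℝ) * max (m : ℝ) 1 * ε ^ (-2.5 : ℝ) := by
  intro k I L ε hI hL h0 h1
  refine scheme_halts hI hL h0 h1 ?_
  have hn : (1 : ℝ) ≤ order (Fin k) := by rw [order_eq]; push_cast; linarith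
  have e1 : (order (Fin k) : ℝ) ^ 5 ≤ (order (Fin k) : ℝ) ^ (5.5 : ℝ) := by
    rw [← Real.rpow_natCast]
    exact Real.rpow_le_rpow_of_exponent_le hn (by norm_num)
  have e2 : (1 / ε) ^ 2 ≤ ε ^ (-2.5 : ℝ) := by
    rw [Real.rpow_neg h0.le, ← Real.inv_rpow h0.le, one_div, ← Real.rpow_natCast]
    exact Real.rpow_le_rpow_of_exponent_le ((one_le_inv₀ h0).2 h1) (by norm_num)
  calc 20000 * ((order (Fin k) : ℝ) ^ 5 * max (size I : ℝ) 1 * (1 / ε) ^ 2)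
      ≤ 20000 * ((order (Fin k) : ℝ) ^ (5.5 : ℝ) * max (size I : ℝ) 1 * ε ^ (-2.5 : ℝ)) := by
        gcongr
    _ = _ := by ring

theorem isFPTAS_scheme : IsFPTAS (scheme.code 0) := by
  refine ⟨6, 20000, fun k I L ε hI hL h0 h1 => ?_⟩
  have hn : (1 : ℝ) ≤ order (Fin k) := by rw [order_eq]; push_cast; linarith
  obtain ⟨σ, hσ, K, hK, hout⟩ := scheme_halts hI hL h0 h1
    (B := 20000 * ((order (Fin k) : ℝ) + size I) ^ 6 * (1 / ε) ^ 6) (by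
      have hs : (0 : ℝ) ≤ size I := Nat.cast_nonneg _
      have h2 : max (size I : ℝ) 1 ≤ (order (Fin k) : ℝ) + size I := max_le (by linarith)
        (by linarith)
      have h3 : (1 : ℝ) ≤ 1 / ε := by rw [le_div_iff₀ h0]; linarith
      calc 20000 * ((order (Fin k) : ℝ) ^ 5 * max (size I : ℝ) 1 * (1 / ε) ^ 2)
          ≤ 20000 * (((order (Fin k) : ℝ) + size I) ^ 5 * ((order (Fin k) : ℝ) + size I) *
            (1 / ε) ^ 6) := by
            gcongr
            · linarith
            · norm_num
        _ = _ := by ring)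
  refine ⟨σ, hσ, ?_⟩
  rw [hout]
  exact ⟨hK.feasible hI h0 h1, hK.sum_le hI h0⟩

end

end MSPEC

theorem mainTheorem1 :
    (∀ (V : Type u) [Fintype V] (I : MSPEC.Instance V) (ε : ℝ),
      (∃ p, MSPEC.Feasible I p) → 0 < ε → ε ≤ 1 →
        IsLeast (MSPEC.bottleneckPowers I) (MSPEC.bottleneck I) ∧
        IsLeast (MSPEC.feasibleCosts I) (MSPEC.opt I) ∧
        ∀ K : Finset (V × Fin (MSPEC.copies V ε)),
          MSPEC.IsMinVertexCut (MSPEC.discreteGraph I ε) K →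
            MSPEC.Feasible I (MSPEC.cutPowers I ε K) ∧
            ∑ v, MSPEC.cutPowers I ε K v ≤ (1 + ε) * MSPEC.opt I) ∧
    ∃ P : List MSPEC.Instr, MSPEC.IsFPTAS P ∧
      ∃ C : ℝ, MSPEC.RunsAlgorithm P fun n m ε =>
        C * (n : ℝ) ^ (5.5 : ℝ) * max (m : ℝ) 1 * ε ^ (-2.5 : ℝ) :=
  ⟨fun _ _ _ _ hI h0 h1 => ⟨MSPEC.isLeast_bottleneck hI, MSPEC.isLeast_opt hI,
    fun _ hK => ⟨hK.feasible hI h0 h1, hK.sum_le hI h0⟩⟩,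
    _, MSPEC.isFPTAS_scheme, _, MSPEC.runsAlgorithm_scheme⟩
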